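/- Let $G$ be a unicyclic graph (a connected simple graph with as many edges as vertices) on $n\ge 8$ vertices. Write $$\det(xI-Q(G))=\sum_{i=0}^n(-1)^i\varphi_i(G)\,x^{n-i},\qquad Q(G)=D(G)+A(G),$$ where $A(G)$ is the adjacency matrix and $D(G)$ the diagonal matrix of vertex degrees. Suppose that the cycle $C$ of $G$ has length $g\ge 5$ and that only pendent paths of length $1$ or $2$ are attached to $C$; that is, every vertex off $C$ lies on a path $av_1\cdots v_k$ with $k\in\{1,2\}$, $a\in C$, $d(a)\ge 3$, $d(v_k)=1$, and $d(v_1)=2$ if $k=2$. Let $u,v,w$ be distinct vertices of $C$ with $u\sim v$ and $v\sim w$, and suppose that there are pendent edges $uu'$, $vv'$, $ww'$ of $G$ (so $u',v',w'$ have degree $1$). Let $G'$ be the graph obtained from $G$ by deleting the edge $vw$, all edges $wx$ with $x\in N_G(w)\setminus\{v,w'\}$ and all edges $vx$ with $x\in N_G(v)\setminus\{u,w,v'\}$, and adding the edge $uw$ and all edges $ux$ with $x\in (N_G(w)\setminus\{v,w'\})\cup(N_G(v)\setminus\{u,w,v'\})$. Then $$\varphi_i(G)\ge\varphi_i(G'),\qquad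 i=0,1,\dots,n,$$ with equality if and only if $i\in\{0,1,n\}$, or $n=8$ and $i=7$. -/

import Mathlib

namespace SignlessUnicyclic

/-- A unicyclic graph: a connected (simple) graph with as many edges as vertices. -/
def IsUnicyclic {V : Type*} [Fintype V] (G : SimpleGraph V) : Prop :=
  G.Connected ∧ G.edgeSet.ncard = Fintype.card V

/-- The signless Laplacian matrix `Q(G) = D(G) + A(G)`. -/
def signlessLaplacian {V : Type*} [Fintype V] [DecidableEq V]
    (G : SimpleGraph V) [DecidableRel G.Adj] : Matrix V V ℤ :=
  G.degMatrix ℤ + G.adjMatrix ℤ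

open Classical in
/-- The signless Laplacian coefficient `φ_i(G)`, for `0 ≤ i ≤ n = |V|`, given by
`det (x I - Q(G)) = ∑ i, (-1) ^ i * φ_i * x ^ (n - i)`. -/
noncomputable def phi {V : Type*} [Fintype V] (G : SimpleGraph V) (i : ℕ) : ℤ :=
  (-1) ^ i * (signlessLaplacian G).charpoly.coeff (Fintype.card V - i)

/-- `p` is a pendent path `a v₁ ⋯ v_k` attached to `a`, with `k = p.length ≥ 1`: the vertex `a` has
degree at least `3`, the end `v_k` has degree `1`, and `v₁, …, v_{k-1}` have degree `2`. -/
def IsPendentPath {V : Type*} {G : SimpleGraph V} [G.LocallyFinite] {a b : V}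
    (p : G.Walk a b) : Prop :=
  p.IsPath ∧ 1 ≤ p.length ∧ 3 ≤ G.degree a ∧ G.degree b = 1 ∧
    ∀ x ∈ p.support, x ≠ a → x ≠ b → G.degree x = 2

/-- Only pendent paths of length `1` or `2` are attached to the cycle `c`: each vertex off the
cycle lies on such a path, attached to some vertex of the cycle. -/
def OnlyShortPendentPaths {V : Type*} {G : SimpleGraph V} [G.LocallyFinite] {r : V}
    (c : G.Walk r r) : Prop :=
  ∀ x, x ∉ c.support → ∃ a ∈ c.support, ∃ b, ∃ p : G.Walk a b,
    IsPendentPath p ∧ (p.length = 1 ∨ p.length = 2) ∧ x ∈ p.support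

/-- The pair `x x'` is a pendent edge attached to `x`. -/
def IsPendentEdgeAt {V : Type*} (G : SimpleGraph V) [G.LocallyFinite] (x x' : V) : Prop :=
  G.Adj x x' ∧ G.degree x' = 1

/-- The transformed graph: the edge `v w`, the edges from `w` to its neighbours other than
`v, w'`, and the edges from `v` to its neighbours other than `u, w, v'` are deleted; the edge `u w`
and edges from `u` to all these neighbours are added. -/
def shortenCycle {V : Type*} (G : SimpleGraph V) (u v w v' w' : V) : SimpleGraph V :=
  G.deleteEdges ({s(v, w)} ∪ (fun x => s(w, x)) '' (G.neighborSet w \ {v, w'}) ∪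
      (fun x => s(v, x)) '' (G.neighborSet v \ {u, w, v'})) ⊔
    SimpleGraph.fromEdgeSet ({s(u, w)} ∪ (fun x => s(u, x)) '' (G.neighborSet w \ {v, w'}) ∪
      (fun x => s(u, x)) '' (G.neighborSet v \ {u, w, v'}))

end SignlessUnicyclic

/-! ### Polynomials with nonnegative coefficients -/

namespace SignlessUnicyclic
open Polynomial Matrix

/-! Up to sign, the coefficients of the characteristic polynomial are sums of principal minors, so
`phi G i` is the coefficient of X^i in det(1 + X Q(G)), and two such determinants have to be
compared.

Let y and z be the neighbours of u and w on the cycle other than v. Deleting uv, vw, uy, wz from G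
leaves a forest F. Once u, v, w are removed as well, the vertices fall into blocks with no edges
between them: u', v', w'; the branches at u, v, w; and the link, which is the rest of the cycle with
all that hangs on it, a tree that contains y ≠ z because g ≥ 5. The transformation does not change
the matrix on these blocks, diagonal included; it only attaches every block except v', w' to u. For
t > 0 the Schur complement therefore turns both determinants at t into one common factor times a 3 ×
3 determinant (`Surgery.eval_diff`).

Two-colour F by signs σ. Conjugation by σ turns Q(F) into the Laplacian, so Q(F) is positive
semidefinite and its kernel is spanned by the restrictions of σ to the components. A branch block B
is hence positive definite, and it maps σ to ± the column that joins it to its root. Its share of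
the Schur complement is f / b with b = det(1 + X B) and f = |σ|² b - σᵀ adj(1 + X B) σ. The link
block is A + E_yy + E_zz, where A is the singular matrix of a tree; its share is expressed by p =
det(1 + X A) and by the entries a, b, N of adj(1 + X A) at (y,y), (z,z), (y,z). Diagonalising shows
that all these polynomials except N have nonnegative coefficients; N is controlled through a + b ±
2N (`isLink_of_kernel`).

Clearing denominators gives the difference `diffPoly`. It equals X² (1 + X) b_u b_v b_w `linkPoly`,
plus one term for each branch that is a multiple of its f, plus a remainder, all with nonnegative
coefficients (`exists_diffPoly_eq`). It is divisible by X² and has degree at most n - 1, and the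
first term is positive in degrees 2 to n - 2. In degree n - 1 this term has a positive multiple of
2h + 4 + 8e, where h is the size of the link and e = σ_y σ_z. This vanishes exactly for h = 2, when
yz is an edge and e = -1; then any nonempty branch still makes the coefficient positive. The
remaining case, h = 2 with all branches empty, is n = 8 (`coeff_diffPoly`). -/

/-- All coefficients of a real polynomial are nonnegative. -/
def NonnegCoeffs (f : ℝ[X]) : Prop := ∀ j, 0 ≤ f.coeff j

/-- All coefficients are nonnegative, and those up to degree `d` are positive. -/
def PosUpTo (d : ℕ) (f : ℝ[X]) : Prop := NonnegCoeffs f ∧ ∀ j ≤ d, 0 < f.coeff j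

namespace NonnegCoeffs
variable {f g : ℝ[X]}

lemma add (hf : NonnegCoeffs f) (hg : NonnegCoeffs g) : NonnegCoeffs (f + g) := fun j => by
  rw [coeff_add]; exact add_nonneg (hf j) (hg j)

lemma mul (hf : NonnegCoeffs f) (hg : NonnegCoeffs g) : NonnegCoeffs (f * g) := fun j => by
  rw [coeff_mul]; exact Finset.sum_nonneg fun p _ => mul_nonneg (hf _) (hg _)

lemma X : NonnegCoeffs (X : ℝ[X]) := fun j => by rw [coeff_X]; split_ifs <;> norm_num

lemma C {r : ℝ} (hr : 0 ≤ r) : NonnegCoeffs (C r) := fun j => by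
  rw [coeff_C]; split_ifs <;> simp [hr]

lemma one : NonnegCoeffs 1 := by simpa using C (zero_le_one)

lemma ofNat (n : ℕ) [n.AtLeastTwo] : NonnegCoeffs (OfNat.ofNat n) := by
  rw [← C_ofNat]; exact C (Nat.ofNat_nonneg n)

lemma pow (hf : NonnegCoeffs f) (n : ℕ) : NonnegCoeffs (f ^ n) := by
  induction n with
  | zero => simpa using one
  | succ n ih => rw [pow_succ]; exact ih.mul hf

lemma sum {ι : Type*} {s : Finset ι} {f : ι → ℝ[X]} (h : ∀ i ∈ s, NonnegCoeffs (f i)) :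
    NonnegCoeffs (∑ i ∈ s, f i) := fun j => by
  rw [finsetSum_coeff]; exact Finset.sum_nonneg fun i hi => h i hi j

lemma prod {ι : Type*} {s : Finset ι} {f : ι → ℝ[X]} (h : ∀ i ∈ s, NonnegCoeffs (f i)) :
    NonnegCoeffs (∏ i ∈ s, f i) := by
  classical
  induction s using Finset.induction_on with
  | empty => simpa using one
  | insert a s ha ih =>
    rw [Finset.prod_insert ha]
    exact (h a (Finset.mem_insert_self _ _)).mul
      (ih fun i hi => h i (Finset.mem_insert_of_mem hi))

end NonnegCoeffs

namespace PosUpTo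
variable {f g : ℝ[X]} {d e : ℕ}

lemma mul (hf : PosUpTo d f) (hg : PosUpTo e g) : PosUpTo (d + e) (f * g) := by
  refine ⟨hf.1.mul hg.1, fun j hj => ?_⟩
  rw [coeff_mul]
  -- The witness takes as much of the degree j from f as d allows.
  refine Finset.sum_pos' (fun p _ => mul_nonneg (hf.1 _) (hg.1 _)) ⟨(min j d, j - min j d), ?_, ?_⟩
  · simp
  · exact mul_pos (hf.2 _ (min_le_right _ _)) (hg.2 _ (by omega))

lemma add_left (hf : PosUpTo d f) (hg : NonnegCoeffs g) : PosUpTo d (f + g) :=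
  ⟨hf.1.add hg, fun j hj => by rw [coeff_add]; exact add_pos_of_pos_of_nonneg (hf.2 j hj) (hg j)⟩

lemma one_add {r : ℝ} (hr : 0 < r) : PosUpTo 1 (1 + Polynomial.C r * X) := by
  refine ⟨NonnegCoeffs.one.add ((NonnegCoeffs.C hr.le).mul .X), fun j hj => ?_⟩
  interval_cases j <;> simp [coeff_X, coeff_one, hr]

lemma prod {ι : Type*} {s : Finset ι} {f : ι → ℝ[X]} (h : ∀ i ∈ s, PosUpTo 1 (f i)) :
    PosUpTo s.card (∏ i ∈ s, f i) := by
  classical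
  induction s using Finset.induction_on with
  | empty => exact ⟨by simpa using .one, fun j hj => by simp at hj; simp [hj]⟩
  | insert a s ha ih =>
    rw [Finset.prod_insert ha, Finset.card_insert_of_notMem ha, add_comm]
    exact (h a (Finset.mem_insert_self _ _)).mul
      (ih fun i hi => h i (Finset.mem_insert_of_mem hi))

end PosUpTo

lemma nonnegCoeffs_prod {ι : Type*} {s : Finset ι} {l : ι → ℝ} (hl : ∀ i, 0 ≤ l i) :
    NonnegCoeffs (∏ m ∈ s, (1 + C (l m) * X)) :=
  .prod fun i _ => NonnegCoeffs.one.add ((NonnegCoeffs.C (hl i)).mul .X)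

lemma natDegree_prod_le {ι : Type*} {s : Finset ι} {l : ι → ℝ} :
    (∏ m ∈ s, (1 + C (l m) * X)).natDegree ≤ s.card := by
  refine (Polynomial.natDegree_prod_le _ _).trans ((Finset.sum_le_card_nsmul _ _ 1 fun i _ => ?_).trans ?_)
  · compute_degree
  · simp

/-! ### Spectral expansion of det(1 + X A) and of qᵀ adj(1 + X A) q -/

section Pencil
variable {ι : Type*} [Fintype ι] [DecidableEq ι]

/-- The polynomial matrix `1 + X A`. -/
noncomputable def pencil (A : Matrix ι ι ℝ) : Matrix ι ι ℝ[X] := 1 + (X : ℝ[X]) • A.map C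

/-- The polynomial `qᵀ adj(1 + X A) q`. -/
noncomputable def adjForm (A : Matrix ι ι ℝ) (q : ι → ℝ) : ℝ[X] :=
  ∑ i, ∑ j, C (q i) * (pencil A).adjugate i j * C (q j)

lemma exists_spectral {A : Matrix ι ι ℝ} (hA : A.PosSemidef) :
    ∃ (U : Matrix ι ι ℝ) (l : ι → ℝ), Uᵀ * U = 1 ∧ (∀ i, 0 ≤ l i) ∧ A = U * diagonal l * Uᵀ := by
  refine ⟨hA.1.eigenvectorUnitary, hA.1.eigenvalues, ?_, hA.eigenvalues_nonneg, ?_⟩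
  · have := Unitary.coe_star_mul_self hA.1.eigenvectorUnitary
    simpa [star_eq_conjTranspose] using this
  · have := hA.1.spectral_theorem
    rw [Unitary.conjStarAlgAut_apply] at this
    simpa [star_eq_conjTranspose, Function.comp_def] using this

section Spectral
variable {A U : Matrix ι ι ℝ} {l : ι → ℝ}

lemma pencil_eq_of_spectral (hU : Uᵀ * U = 1) (hA : A = U * diagonal l * Uᵀ) :
    pencil A = U.map C * diagonal (fun i => 1 + C (l i) * X) * (U.map C)ᵀ := by
  have h1 : U.map C * (U.map C)ᵀ = (1 : Matrix ι ι ℝ[X]) := by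
    rw [← transpose_map, ← Matrix.map_mul, mul_eq_one_comm.mp hU]; simp
  have h2 : diagonal (fun i => 1 + C (l i) * X) = 1 + (X : ℝ[X]) • (diagonal l).map C := by
    ext i j : 1
    by_cases h : i = j
    · subst h
      rw [diagonal_apply_eq, Matrix.add_apply, Matrix.one_apply_eq, Matrix.smul_apply, map_apply,
        diagonal_apply_eq, smul_eq_mul, mul_comm]
    · rw [diagonal_apply_ne _ h, Matrix.add_apply, Matrix.one_apply_ne h, Matrix.smul_apply,
        map_apply, diagonal_apply_ne _ h, C_0, smul_zero, add_zero]
  rw [h2, Matrix.mul_add, Matrix.add_mul, Matrix.mul_one, h1, pencil, hA, Matrix.map_mul,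
    Matrix.map_mul, transpose_map, Matrix.mul_smul, Matrix.smul_mul]

lemma det_pencil_of_spectral (hU : Uᵀ * U = 1) (hA : A = U * diagonal l * Uᵀ) :
    (pencil A).det = ∏ i, (1 + C (l i) * X) := by
  have h1 : U.map C * (U.map C)ᵀ = (1 : Matrix ι ι ℝ[X]) := by
    rw [← transpose_map, ← Matrix.map_mul, mul_eq_one_comm.mp hU]; simp
  have h2 : (U.map C).det * (U.map C)ᵀ.det = (1 : ℝ[X]) := by rw [← det_mul, h1, det_one]
  rw [pencil_eq_of_spectral hU hA, det_mul, det_mul, mul_right_comm, h2, one_mul, det_diagonal]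

/-- Adjugation reverses products. For orthogonal U the adjugates of U and Uᵀ are their determinants
times the transposes, and these determinants cancel, so only the adjugate of a diagonal matrix
remains. -/
lemma adjugate_pencil_of_spectral (hU : Uᵀ * U = 1) (hA : A = U * diagonal l * Uᵀ) (i j : ι) :
    (pencil A).adjugate i j =
      ∑ k, C (U i k * U j k) * ∏ m ∈ Finset.univ.erase k, (1 + C (l m) * X) := by
  have h1 : U.map C * (U.map C)ᵀ = (1 : Matrix ι ι ℝ[X]) := by
    rw [← transpose_map, ← Matrix.map_mul, mul_eq_one_comm.mp hU]; simp
  have h2 : (U.map C).det * (U.map C)ᵀ.det = (1 : ℝ[X]) := by rw [← det_mul, h1, det_one]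
  have h3 : (U.map C).adjugate = (U.map C).det • (U.map C)ᵀ := by
    calc (U.map C).adjugate = (U.map C).adjugate * (U.map C * (U.map C)ᵀ) := by
          rw [h1, Matrix.mul_one]
      _ = _ := by rw [← Matrix.mul_assoc, adjugate_mul, Matrix.smul_mul, Matrix.one_mul]
  have h4 : (U.map C)ᵀ.adjugate = (U.map C)ᵀ.det • (U.map C) := by
    rw [← adjugate_transpose, h3, det_transpose, transpose_smul, transpose_transpose]
  rw [pencil_eq_of_spectral hU hA, adjugate_mul_distrib, adjugate_mul_distrib, h3, h4,
    adjugate_diagonal, Matrix.mul_smul, Matrix.mul_smul, Matrix.smul_mul, smul_smul, h2, one_smul,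
    ← Matrix.mul_assoc, Matrix.mul_apply]
  refine Finset.sum_congr rfl fun k _ => ?_
  rw [Matrix.mul_diagonal]
  simp only [map_apply, transpose_apply, C_mul]
  ring

lemma adjForm_of_spectral (hU : Uᵀ * U = 1) (hA : A = U * diagonal l * Uᵀ) (q : ι → ℝ) :
    adjForm A q = ∑ k, C ((∑ i, q i * U i k) ^ 2) *
      ∏ m ∈ Finset.univ.erase k, (1 + C (l m) * X) := by
  unfold adjForm
  simp only [adjugate_pencil_of_spectral hU hA, Finset.mul_sum, Finset.sum_mul]
  have : ∀ k, C ((∑ i, q i * U i k) ^ 2) * ∏ m ∈ Finset.univ.erase k, (1 + C (l m) * X) =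
      ∑ i, ∑ j, C (q i) * (C (U i k * U j k) * ∏ m ∈ Finset.univ.erase k, (1 + C (l m) * X))
        * C (q j) := by
    intro k
    rw [sq, Finset.sum_mul_sum, map_sum, Finset.sum_mul]
    refine Finset.sum_congr rfl fun i _ => ?_
    rw [map_sum, Finset.sum_mul]
    refine Finset.sum_congr rfl fun j _ => ?_
    simp only [C_mul]; ring
  simp only [this]
  symm
  rw [Finset.sum_comm]
  refine Finset.sum_congr rfl fun i _ => ?_
  rw [Finset.sum_comm]

lemma sum_sq_eq_of_orthogonal (hU : Uᵀ * U = 1) (q : ι → ℝ) :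
    ∑ k, (∑ i, q i * U i k) ^ 2 = ∑ i, q i ^ 2 := by
  have h : (q ᵥ* U) ⬝ᵥ (q ᵥ* U) = q ⬝ᵥ q := by
    rw [← Matrix.mulVec_transpose, Matrix.dotProduct_mulVec, Matrix.vecMul_transpose,
      Matrix.mulVec_mulVec, mul_eq_one_comm.mp hU, Matrix.one_mulVec]
  simpa [dotProduct, vecMul, sq] using h

/-- In the eigenbasis the k-th terms of the two expansions differ by the factor (1 + l_k X) - 1 =
l_k X. From this form one reads off nonnegativity, the vanishing constant term and, for definite A,
the positive top coefficient. -/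
lemma sub_adjForm_of_spectral (hU : Uᵀ * U = 1) (hA : A = U * diagonal l * Uᵀ) (q : ι → ℝ) :
    C (∑ i, q i ^ 2) * (pencil A).det - adjForm A q =
      X * ∑ k, C ((∑ i, q i * U i k) ^ 2 * l k) *
        ∏ m ∈ Finset.univ.erase k, (1 + C (l m) * X) := by
  rw [adjForm_of_spectral hU hA, det_pencil_of_spectral hU hA, ← sum_sq_eq_of_orthogonal hU,
    map_sum, Finset.sum_mul, ← Finset.sum_sub_distrib, Finset.mul_sum]
  refine Finset.sum_congr rfl fun k _ => ?_
  rw [← Finset.mul_prod_erase Finset.univ (fun i => 1 + C (l i) * X) (Finset.mem_univ k), C_mul]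
  ring

end Spectral

section PosSemidef
variable {A : Matrix ι ι ℝ}

lemma nonnegCoeffs_det_pencil (hA : A.PosSemidef) : NonnegCoeffs (pencil A).det := by
  obtain ⟨U, l, hU, hl, h⟩ := exists_spectral hA
  rw [det_pencil_of_spectral hU h]
  exact nonnegCoeffs_prod hl

lemma natDegree_det_pencil_le (hA : A.PosSemidef) : (pencil A).det.natDegree ≤ Fintype.card ι := by
  obtain ⟨U, l, hU, hl, h⟩ := exists_spectral hA
  rw [det_pencil_of_spectral hU h]
  exact natDegree_prod_le

lemma coeff_card_det_pencil (hA : A.PosSemidef) :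
    (pencil A).det.coeff (Fintype.card ι) = A.det := by
  obtain ⟨U, l, hU, hl, h⟩ := exists_spectral hA
  have h2 : A.det = ∏ i, l i := by
    have : U.det * Uᵀ.det = 1 := by rw [mul_comm, ← det_mul, hU, det_one]
    rw [h, det_mul, det_mul, mul_right_comm, this, one_mul, det_diagonal]
  rw [det_pencil_of_spectral hU h, h2]
  have : ∀ s : Finset ι, (∏ m ∈ s, (1 + C (l m) * X)).coeff s.card = ∏ m ∈ s, l m := by
    intro s
    induction s using Finset.induction_on with
    | empty => simp
    | insert a s ha ih =>
      rw [Finset.prod_insert ha, Finset.prod_insert ha, Finset.card_insert_of_notMem ha, add_mul,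
        coeff_add, one_mul, mul_assoc, coeff_C_mul, coeff_X_mul, ih,
        coeff_eq_zero_of_natDegree_lt (Nat.lt_succ_of_le natDegree_prod_le), zero_add]
  simpa using this Finset.univ

lemma coeff_zero_det_pencil (A : Matrix ι ι ℝ) : (pencil A).det.coeff 0 = 1 := by
  rw [coeff_zero_eq_eval_zero, ← coe_evalRingHom, RingHom.map_det, ← det_one (R := ℝ) (n := ι)]
  congr 1
  ext i j
  by_cases h : i = j
  · subst h
    rw [Matrix.one_apply_eq, RingHom.mapMatrix_apply, map_apply, pencil, Matrix.add_apply,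
      Matrix.one_apply_eq, Matrix.smul_apply, smul_eq_mul]
    simp
  · rw [Matrix.one_apply_ne h, RingHom.mapMatrix_apply, map_apply, pencil, Matrix.add_apply,
      Matrix.one_apply_ne h, Matrix.smul_apply, smul_eq_mul]
    simp

lemma natDegree_adjugate_pencil_le (hA : A.PosSemidef) (i j : ι) :
    ((pencil A).adjugate i j).natDegree ≤ Fintype.card ι - 1 := by
  obtain ⟨U, l, hU, hl, h⟩ := exists_spectral hA
  rw [adjugate_pencil_of_spectral hU h]
  refine natDegree_sum_le_of_forall_le _ _ fun k _ => (natDegree_C_mul_le _ _).trans ?_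
  simpa using natDegree_prod_le (s := Finset.univ.erase k) (l := l)

lemma adjugate_pencil_symm (hA : A.PosSemidef) (i j : ι) :
    (pencil A).adjugate i j = (pencil A).adjugate j i := by
  obtain ⟨U, l, hU, hl, h⟩ := exists_spectral hA
  rw [adjugate_pencil_of_spectral hU h, adjugate_pencil_of_spectral hU h]
  exact Finset.sum_congr rfl fun k _ => by rw [mul_comm (U i k)]

lemma nonnegCoeffs_adjForm (hA : A.PosSemidef) (q : ι → ℝ) : NonnegCoeffs (adjForm A q) := by
  obtain ⟨U, l, hU, hl, h⟩ := exists_spectral hA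
  rw [adjForm_of_spectral hU h]
  exact .sum fun k _ => (NonnegCoeffs.C (sq_nonneg _)).mul (nonnegCoeffs_prod hl)

lemma nonnegCoeffs_sub_adjForm (hA : A.PosSemidef) (q : ι → ℝ) :
    NonnegCoeffs (C (∑ i, q i ^ 2) * (pencil A).det - adjForm A q) := by
  obtain ⟨U, l, hU, hl, h⟩ := exists_spectral hA
  rw [sub_adjForm_of_spectral hU h]
  exact NonnegCoeffs.X.mul (.sum fun k _ =>
    (NonnegCoeffs.C (mul_nonneg (sq_nonneg _) (hl k))).mul (nonnegCoeffs_prod hl))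

lemma coeff_zero_sub_adjForm (hA : A.PosSemidef) (q : ι → ℝ) :
    (C (∑ i, q i ^ 2) * (pencil A).det - adjForm A q).coeff 0 = 0 := by
  obtain ⟨U, l, hU, hl, h⟩ := exists_spectral hA
  rw [sub_adjForm_of_spectral hU h]
  exact coeff_X_mul_zero _

lemma natDegree_sub_adjForm_le (hA : A.PosSemidef) (q : ι → ℝ) :
    (C (∑ i, q i ^ 2) * (pencil A).det - adjForm A q).natDegree ≤ Fintype.card ι := by
  refine (natDegree_sub_le _ _).trans (max_le ?_ ?_)
  · exact (natDegree_C_mul_le _ _).trans (natDegree_det_pencil_le hA)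
  · unfold adjForm
    refine natDegree_sum_le_of_forall_le _ _ fun i _ => natDegree_sum_le_of_forall_le _ _ fun j _ =>
      ?_
    exact (natDegree_mul_C_le _ _).trans ((natDegree_C_mul_le _ _).trans
      ((natDegree_adjugate_pencil_le hA i j).trans (Nat.sub_le _ _)))

end PosSemidef

section PosDef
variable {A : Matrix ι ι ℝ}

lemma exists_spectral_pos (hA : A.PosDef) :
    ∃ (U : Matrix ι ι ℝ) (l : ι → ℝ), Uᵀ * U = 1 ∧ (∀ i, 0 < l i) ∧ A = U * diagonal l * Uᵀ := by
  obtain ⟨U, l, hU, hl, h⟩ := exists_spectral hA.posSemidef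
  refine ⟨U, l, hU, fun i => (hl i).lt_of_ne' fun h0 => hA.det_pos.ne' ?_, h⟩
  rw [h, det_mul, det_mul, det_diagonal, Finset.prod_eq_zero (Finset.mem_univ i) h0]
  simp

lemma posUpTo_det_pencil (hA : A.PosDef) : PosUpTo (Fintype.card ι) (pencil A).det := by
  obtain ⟨U, l, hU, hl, h⟩ := exists_spectral_pos hA
  rw [det_pencil_of_spectral hU h]
  exact PosUpTo.prod fun i _ => PosUpTo.one_add (hl i)

/-- A nonzero q has a nonzero component along some eigenvector, and every eigenvalue is positive. -/
lemma coeff_card_sub_adjForm_pos (hA : A.PosDef) {q : ι → ℝ} (hq : q ≠ 0) :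
    0 < (C (∑ i, q i ^ 2) * (pencil A).det - adjForm A q).coeff (Fintype.card ι) := by
  obtain ⟨U, l, hU, hl, h⟩ := exists_spectral_pos hA
  obtain ⟨i₀, hi₀⟩ := Function.ne_iff.mp hq
  have hcard : Fintype.card ι = (Fintype.card ι - 1) + 1 :=
    (Nat.succ_pred_eq_of_pos (Fintype.card_pos_iff.mpr ⟨i₀⟩)).symm
  have hpos : 0 < ∑ k, (∑ i, q i * U i k) ^ 2 := by
    rw [sum_sq_eq_of_orthogonal hU]
    exact Finset.sum_pos' (fun i _ => sq_nonneg _) ⟨i₀, Finset.mem_univ _, by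
      have : q i₀ ≠ 0 := hi₀
      positivity⟩
  obtain ⟨k, -, hk⟩ := Finset.exists_ne_zero_of_sum_ne_zero hpos.ne'
  have hP : ∀ k, PosUpTo (Fintype.card ι - 1)
      (∏ m ∈ Finset.univ.erase k, (1 + C (l m) * X)) := fun k => by
    simpa using PosUpTo.prod (s := Finset.univ.erase k) fun i _ => PosUpTo.one_add (hl i)
  rw [sub_adjForm_of_spectral hU h, hcard, coeff_X_mul, finsetSum_coeff]
  simp only [coeff_C_mul]
  refine Finset.sum_pos' (fun k _ => mul_nonneg (mul_nonneg (sq_nonneg _) (hl k).le)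
    ((hP k).1 _)) ⟨k, Finset.mem_univ _, mul_pos (mul_pos ?_ (hl k)) ((hP k).2 _ le_rfl)⟩
  exact (sq_nonneg _).lt_of_ne' hk

end PosDef
end Pencil
end SignlessUnicyclic

/-! ### Signs and zeros of the coefficients of the difference polynomial -/

namespace SignlessUnicyclic
open Polynomial Matrix

lemma NonnegCoeffs.coeff_mul_pos {f g : ℝ[X]} {i j : ℕ} (hf : NonnegCoeffs f) (hg : NonnegCoeffs g)
    (hi : 0 < f.coeff i) (hj : 0 < g.coeff j) : 0 < (f * g).coeff (i + j) := by
  rw [coeff_mul]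
  exact Finset.sum_pos' (fun p _ => mul_nonneg (hf _) (hg _))
    ⟨(i, j), by simp, mul_pos hi hj⟩

/-- Serves the top degree n - 1, where a nonempty branch has to help. The constant 5 = 2 + 2 + 1
counts (1 + X)², the quadratic factor q and X. -/
lemma coeff_pos_of_branch {q b₁ b₂ k f : ℝ[X]} {h c₁ c₂ c₃ i : ℕ} (hq : NonnegCoeffs q)
    (hq' : 0 < q.coeff 2) (h₁ : PosUpTo c₁ b₁) (h₂ : PosUpTo c₂ b₂) (hk : PosUpTo h k)
    (hf : NonnegCoeffs f) (hf' : 0 < f.coeff c₃) (hi : 5 + h + c₁ + c₂ + c₃ = i) :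
    0 < ((1 + X) ^ 2 * q * (b₁ * b₂ * X * k) * f).coeff i := by
  have hx : NonnegCoeffs ((1 + X) ^ 2 : ℝ[X]) := (NonnegCoeffs.one.add .X).pow 2
  have hx' : 0 < ((1 + X) ^ 2 : ℝ[X]).coeff 2 := by
    have : ((1 + X) ^ 2 : ℝ[X]) = 1 + C 2 * X + X ^ 2 := by rw [C_ofNat]; ring
    rw [this]; simp [coeff_one]
  have hX1 : 0 < (X : ℝ[X]).coeff 1 := by simp
  have hb := h₁.1.mul h₂.1
  have e1 := hx.coeff_mul_pos hq hx' hq'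
  have e2 := h₁.1.coeff_mul_pos h₂.1 (h₁.2 _ le_rfl) (h₂.2 _ le_rfl)
  have e3 := (hb.mul .X).coeff_mul_pos hk.1 (hb.coeff_mul_pos .X e2 hX1) (hk.2 _ le_rfl)
  have e4 := (hx.mul hq).coeff_mul_pos ((hb.mul .X).mul hk.1) e1 e3
  have e5 := ((hx.mul hq).mul ((hb.mul .X).mul hk.1)).coeff_mul_pos hf e4 hf'
  rwa [show 2 + 2 + (c₁ + c₂ + 1 + h) + c₃ = i by omega] at e5

/-- The properties of the polynomials `b = det(1 + X A)` and `f = |q|² b - qᵀ adj(1 + X A) q` of a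
branch with `c` vertices, where `A` is positive definite. -/
structure IsBranch (c : ℕ) (b f : ℝ[X]) : Prop where
  pos : PosUpTo c b
  deg : b.natDegree ≤ c
  coeff_zero : b.coeff 0 = 1
  nonneg : NonnegCoeffs f
  deg_le : f.natDegree ≤ c
  coeff_zero' : f.coeff 0 = 0
  top_pos : 0 < c → 0 < f.coeff c

/-- The properties of `p = det(1 + X A)`, of the entries `a`, `b`, `N` of `adj(1 + X A)` at two
vertices, and of the determinant `δ` after raising the degree of these vertices, where `A` is the
signless Laplacian matrix of a tree with `h` vertices. -/
structure IsLink (h : ℕ) (p a b N δ : ℝ[X]) : Prop where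
  two_le : 2 ≤ h
  p_nonneg : NonnegCoeffs p
  a_nonneg : NonnegCoeffs a
  b_nonneg : NonnegCoeffs b
  sub_a : NonnegCoeffs (p - a)
  sub_b : NonnegCoeffs (p - b)
  add_two : NonnegCoeffs (a + b + 2 * N)
  sub_add_two : NonnegCoeffs (2 * p - (a + b - 2 * N))
  pos_a : PosUpTo h (p + X * a)
  pos_b : PosUpTo h (p + X * b)
  deg_p : p.natDegree ≤ h - 1
  deg_a : a.natDegree ≤ h - 1
  deg_b : b.natDegree ≤ h - 1
  deg_N : N.natDegree ≤ h - 1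
  δ_nonneg : NonnegCoeffs δ
  deg_δ : δ.natDegree ≤ h
  top : ∃ k e : ℝ, 0 < k ∧ |e| = 1 ∧ (h = 2 → e = -1) ∧ p.coeff (h - 1) = h * k ∧
    a.coeff (h - 1) = k ∧ b.coeff (h - 1) = k ∧ N.coeff (h - 1) = e * k

/-- The part of the difference that comes from the link alone. -/
noncomputable def linkPoly (p a b N : ℝ[X]) : ℝ[X] :=
  (1 + 2 * X) * ((1 + X) * (2 * p + X * (a + b)) + 2 * (1 + 4 * X + 2 * X ^ 2) * N) +
    (1 + X) * (1 + 4 * X + 2 * X ^ 2) * p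

/-- The difference of the two determinants. -/
noncomputable def diffPoly (p a b N δ bu fu bv fv bw fw : ℝ[X]) : ℝ[X] :=
  (1 + X) * (bv * ((1 + 2 * X) * (1 + X) * X *
      (bu * bw * X * (2 * p + X * (a + b)) + δ * (fu * bw + fw * bu)) +
      2 * (1 + 2 * X) * (1 + 4 * X + 2 * X ^ 2) * X ^ 2 * N * bu * bw +
      (1 + X) * (1 + 4 * X + 2 * X ^ 2) * (bu * bw * X ^ 2 * p + X * (p + X * b) * bu * fw +
        X * (p + X * a) * bw * fu + fu * fw * δ)) +
    fv * (1 + X) * ((1 + 3 * X + X ^ 2) *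
      (bu * bw * X * (2 * p + X * (a + b)) + δ * (fu * bw + fw * bu)) +
      (1 + X) * (bu * bw * X ^ 2 * p + X * (p + X * b) * bu * fw +
        X * (p + X * a) * bw * fu + fu * fw * δ)))

section
variable {h : ℕ} {p a b N δ : ℝ[X]} (H : IsLink h p a b N δ)
include H

/-- Half the sum of a + b + 2N and 2p - (a + b - 2N). -/
lemma IsLink.add_two_mul : NonnegCoeffs (p + 2 * N) := fun j => by
  have h1 := H.add_two j
  have h2 := H.sub_add_two j
  rw [← C_ofNat] at h1 h2 ⊢
  simp only [coeff_add, coeff_sub, coeff_C_mul] at h1 h2 ⊢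
  linarith

lemma IsLink.posUpTo_linkPoly : PosUpTo (h + 1) (linkPoly p a b N) := by
  have hk := H.pos_a
  have h1 := H.add_two_mul
  have h2 := H.add_two
  have h3 := H.a_nonneg
  have h4 := H.b_nonneg
  have h5 := H.sub_a
  -- N may have negative coefficients and is absorbed into p + 2N and a + b + 2N. The product with p
  -- + X a, which is positive up to degree h, gives positivity up to h + 1.
  have e : linkPoly p a b N = (p + X * a) * (2 + 3 * X) + ((p + 2 * N) +
      X * (2 * (p - a) + 6 * (p + 2 * N) + (a + b)) + X ^ 2 * (10 * (p + 2 * N) + 3 * b) +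
      X ^ 3 * (2 * (p + 2 * N) + 2 * (a + b + 2 * N))) := by
    unfold linkPoly; ring
  rw [e]
  refine (hk.mul (e := 1) ⟨?_, fun j hj => ?_⟩).add_left ?_
  · repeat' first | assumption | exact .one | exact .X | exact .ofNat _ | apply NonnegCoeffs.add |
      apply NonnegCoeffs.pow |
      apply NonnegCoeffs.mul
  · rw [← C_ofNat, ← C_ofNat]
    interval_cases j <;> simp [coeff_X, coeff_C]
  · repeat' first | assumption | exact .one | exact .X | exact .ofNat _ | apply NonnegCoeffs.add |
      apply NonnegCoeffs.pow |
      apply NonnegCoeffs.mul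

lemma IsLink.posUpTo_linkPoly_of_two_lt (hh : 2 < h) : PosUpTo (h + 2) (linkPoly p a b N) := by
  refine ⟨H.posUpTo_linkPoly.1, fun j hj => ?_⟩
  rcases Nat.lt_or_ge (h + 1) j with hj' | hj'
  · obtain rfl : j = (h - 1) + 3 := by omega
    have h1 := H.add_two_mul
    have h2 := H.add_two
    have h3 := H.a_nonneg
    have h4 := H.b_nonneg
    have h5 := H.p_nonneg
    -- Degree h + 2 is decided by the X³ summand; of the others only nonnegativity is needed.
    have e : linkPoly p a b N = ((2 * p + (p + 2 * N)) +
        X * (5 * p + 6 * (p + 2 * N) + (a + b)) + X ^ 2 * (10 * (p + 2 * N) + 3 * (a + b))) +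
        X ^ 3 * (2 * (p + 2 * N) + 2 * (a + b + 2 * N)) := by
      unfold linkPoly; ring
    rw [e, coeff_add]
    refine add_pos_of_nonneg_of_pos ?_ ?_
    · generalize h - 1 + 3 = j
      revert j
      change NonnegCoeffs _
      repeat' first | assumption | exact .one | exact .X | exact .ofNat _ |
        apply NonnegCoeffs.add | apply NonnegCoeffs.pow |
      apply NonnegCoeffs.mul
    -- The coefficient is k (2h + 4 + 8e), positive for h ≥ 3 since e ≥ -1.
    · obtain ⟨k, e, hk, he, -, e1, e2, e3, e4⟩ := H.top
      rw [mul_comm, coeff_mul_X_pow, ← C_ofNat]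
      simp only [coeff_add, coeff_C_mul, e1, e2, e3, e4]
      have h6 : (3 : ℝ) ≤ h := by exact_mod_cast hh
      have h7 := (abs_le.mp he.le).1
      nlinarith [mul_le_mul_of_nonneg_right h6 hk.le, mul_le_mul_of_nonneg_right h7 hk.le]
  · exact H.posUpTo_linkPoly.2 j hj'

/-- For h = 2 and e = -1 the top coefficient k (2h + 4 + 8e) vanishes. This is the source of the
exceptional equality at n = 8, i = 7. -/
lemma IsLink.natDegree_linkPoly_le (hh : h = 2) : (linkPoly p a b N).natDegree ≤ 3 := by
  subst hh
  obtain ⟨k, e, hk, -, he, e1, e2, e3, e4⟩ := H.top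
  have e : linkPoly p a b N = ((2 * p + (p + 2 * N)) +
      X * (5 * p + 6 * (p + 2 * N) + (a + b)) + X ^ 2 * (10 * (p + 2 * N) + 3 * (a + b))) +
      X ^ 3 * (2 * (p + 2 * N) + 2 * (a + b + 2 * N)) := by
    unfold linkPoly; ring
  have d1 := H.deg_p
  have d2 := H.deg_a
  have d3 := H.deg_b
  have d4 := H.deg_N
  norm_num at d1 d2 d3 d4 e1 e2 e3 e4
  have key : (2 * (p + 2 * N) + 2 * (a + b + 2 * N)).natDegree ≤ 0 := by
    rw [natDegree_le_iff_coeff_eq_zero]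
    intro j hj
    rw [← C_ofNat]
    simp only [coeff_add, coeff_C_mul]
    rcases Nat.lt_or_ge 1 j with hj' | hj'
    · rw [coeff_eq_zero_of_natDegree_lt (d1.trans_lt hj'),
        coeff_eq_zero_of_natDegree_lt (d2.trans_lt hj'),
        coeff_eq_zero_of_natDegree_lt (d3.trans_lt hj'),
        coeff_eq_zero_of_natDegree_lt (d4.trans_lt hj')]
      norm_num
    · obtain rfl : j = 1 := by omega
      rw [e1, e2, e3, e4, he rfl]
      ring
  have f1 : (2 * p + (p + 2 * N)).natDegree ≤ 1 := by compute_degree!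
  have f2 : (5 * p + 6 * (p + 2 * N) + (a + b)).natDegree ≤ 1 := by compute_degree!
  have f3 : (10 * (p + 2 * N) + 3 * (a + b)).natDegree ≤ 1 := by compute_degree!
  rw [e]
  generalize 2 * p + (p + 2 * N) = q1 at *
  generalize 5 * p + 6 * (p + 2 * N) + (a + b) = q2 at *
  generalize 10 * (p + 2 * N) + 3 * (a + b) = q3 at *
  generalize 2 * (p + 2 * N) + 2 * (a + b + 2 * N) = q4 at *
  have g1 := natDegree_mul_le_of_le (natDegree_X_le (R := ℝ)) f2
  have g2 := natDegree_mul_le_of_le (natDegree_X_pow_le (R := ℝ) 2) f3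
  have g3 := natDegree_mul_le_of_le (natDegree_X_pow_le (R := ℝ) 3) key
  exact natDegree_add_le_of_degree_le (natDegree_add_le_of_degree_le
    (natDegree_add_le_of_degree_le (f1.trans (by norm_num)) (g1.trans (by norm_num))) g2) g3

variable {bu fu bv fv bw fw : ℝ[X]} {cu cv cw : ℕ} (Bu : IsBranch cu bu fu) (Bv : IsBranch cv bv fv)
  (Bw : IsBranch cw bw fw)
include Bu Bv Bw

/-- The bound is n - 1 for n = 6 + h + cu + cv + cw, so the coefficients at n agree. -/
lemma natDegree_diffPoly_le :
    (diffPoly p a b N δ bu fu bv fv bw fw).natDegree ≤ 5 + h + cu + cv + cw := by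
  have hh := H.two_le
  have d1 := H.deg_p
  have d2 := H.deg_a
  have d3 := H.deg_b
  have d4 := H.deg_N
  have d5 := H.deg_δ
  have x1 : (1 + X : ℝ[X]).natDegree ≤ 1 := by compute_degree!
  have x2 : (1 + 2 * X : ℝ[X]).natDegree ≤ 1 := by compute_degree!
  have x3 : (1 + 4 * X + 2 * X ^ 2 : ℝ[X]).natDegree ≤ 2 := by compute_degree!
  have x4 : (1 + 3 * X + X ^ 2 : ℝ[X]).natDegree ≤ 2 := by compute_degree!
  have x5 : (2 : ℝ[X]).natDegree ≤ 0 := by compute_degree!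
  have x6 := natDegree_X_le (R := ℝ)
  have x7 := natDegree_X_pow_le (R := ℝ) 2
  have s1 : (2 * p + X * (a + b)).natDegree ≤ h := natDegree_add_le_of_degree_le
    ((natDegree_mul_le_of_le x5 d1).trans (by omega))
    ((natDegree_mul_le_of_le x6 (natDegree_add_le_of_degree_le d2 d3)).trans (by omega))
  have s2 : (p + X * a).natDegree ≤ h := natDegree_add_le_of_degree_le (d1.trans (by omega))
    ((natDegree_mul_le_of_le x6 d2).trans (by omega))
  have s3 : (p + X * b).natDegree ≤ h := natDegree_add_le_of_degree_le (d1.trans (by omega))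
    ((natDegree_mul_le_of_le x6 d3).trans (by omega))
  have t1 : (bu * bw * X * (2 * p + X * (a + b)) + δ * (fu * bw + fw * bu)).natDegree ≤
      cu + cw + h + 1 := by
    refine natDegree_add_le_of_degree_le ?_ ?_
    · exact (natDegree_mul_le_of_le (natDegree_mul_le_of_le
        (natDegree_mul_le_of_le Bu.deg Bw.deg) x6) s1).trans (by omega)
    · refine (natDegree_mul_le_of_le d5 (natDegree_add_le_of_degree_le (n := cu + cw)
        (natDegree_mul_le_of_le Bu.deg_le Bw.deg) ?_)).trans (by omega)
      exact (natDegree_mul_le_of_le Bw.deg_le Bu.deg).trans (by omega)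
  have t2 : (bu * bw * X ^ 2 * p + X * (p + X * b) * bu * fw + X * (p + X * a) * bw * fu +
      fu * fw * δ).natDegree ≤ cu + cw + h + 1 := by
    refine natDegree_add_le_of_degree_le (natDegree_add_le_of_degree_le
      (natDegree_add_le_of_degree_le ?_ ?_) ?_) ?_
    · exact (natDegree_mul_le_of_le (natDegree_mul_le_of_le
        (natDegree_mul_le_of_le Bu.deg Bw.deg) x7) d1).trans (by omega)
    · exact (natDegree_mul_le_of_le (natDegree_mul_le_of_le
        (natDegree_mul_le_of_le x6 s3) Bu.deg) Bw.deg_le).trans (by omega)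
    · exact (natDegree_mul_le_of_le (natDegree_mul_le_of_le
        (natDegree_mul_le_of_le x6 s2) Bw.deg) Bu.deg_le).trans (by omega)
    · exact (natDegree_mul_le_of_le (natDegree_mul_le_of_le Bu.deg_le Bw.deg_le) d5).trans
        (by omega)
  unfold diffPoly
  generalize bu * bw * X * (2 * p + X * (a + b)) + δ * (fu * bw + fw * bu) = T1 at *
  generalize bu * bw * X ^ 2 * p + X * (p + X * b) * bu * fw + X * (p + X * a) * bw * fu +
      fu * fw * δ = T2 at *
  have r1 : ((1 + 2 * X) * (1 + X) * X * T1 + 2 * (1 + 2 * X) * (1 + 4 * X + 2 * X ^ 2) * X ^ 2 *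
      N * bu * bw + (1 + X) * (1 + 4 * X + 2 * X ^ 2) * T2).natDegree ≤ cu + cw + h + 4 := by
    refine natDegree_add_le_of_degree_le (natDegree_add_le_of_degree_le ?_ ?_) ?_
    · exact (natDegree_mul_le_of_le (natDegree_mul_le_of_le
        (natDegree_mul_le_of_le x2 x1) x6) t1).trans (by omega)
    · exact (natDegree_mul_le_of_le (natDegree_mul_le_of_le (natDegree_mul_le_of_le
        (natDegree_mul_le_of_le (natDegree_mul_le_of_le (natDegree_mul_le_of_le x5 x2) x3) x7) d4)
        Bu.deg) Bw.deg).trans (by omega)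
    · exact (natDegree_mul_le_of_le (natDegree_mul_le_of_le x1 x3) t2).trans (by omega)
  have r2 : ((1 + 3 * X + X ^ 2) * T1 + (1 + X) * T2).natDegree ≤ cu + cw + h + 3 :=
    natDegree_add_le_of_degree_le ((natDegree_mul_le_of_le x4 t1).trans (by omega))
      ((natDegree_mul_le_of_le x1 t2).trans (by omega))
  refine (natDegree_mul_le_of_le x1 (natDegree_add_le_of_degree_le (n := cu + cv + cw + h + 4)
    ((natDegree_mul_le_of_le Bv.deg r1).trans (by omega))
    ((natDegree_mul_le_of_le (natDegree_mul_le_of_le Bv.deg_le x1) r2).trans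
      (by omega)))).trans (by omega)

-- Each f has zero constant term, so every summand carries two factors X.
omit H in
lemma X_sq_dvd_diffPoly : X ^ 2 ∣ diffPoly p a b N δ bu fu bv fv bw fw := by
  obtain ⟨gu, rfl⟩ := X_dvd_iff.mpr Bu.coeff_zero'
  obtain ⟨gv, rfl⟩ := X_dvd_iff.mpr Bv.coeff_zero'
  obtain ⟨gw, rfl⟩ := X_dvd_iff.mpr Bw.coeff_zero'
  refine ⟨(1 + X) * (bv * ((1 + 2 * X) * (1 + X) *
      (bu * bw * (2 * p + X * (a + b)) + δ * (gu * bw + gw * bu)) +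
      2 * (1 + 2 * X) * (1 + 4 * X + 2 * X ^ 2) * N * bu * bw +
      (1 + X) * (1 + 4 * X + 2 * X ^ 2) * (bu * bw * p + (p + X * b) * bu * gw +
        (p + X * a) * bw * gu + gu * gw * δ)) +
    gv * (1 + X) * ((1 + 3 * X + X ^ 2) *
      (bu * bw * (2 * p + X * (a + b)) + δ * (gu * bw + gw * bu)) +
      (1 + X) * (bu * bw * X * p + X * (p + X * b) * bu * gw +
        X * (p + X * a) * bw * gu + X * gu * gw * δ))), ?_⟩
  unfold diffPoly
  ring

/-- All occurrences of N go into `linkPoly`. For each branch one term of full degree n - 1 is set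
apart, to replace `linkPoly` at that degree when h = 2. The remainder is a sum of products of
nonnegative polynomials. -/
lemma exists_diffPoly_eq : ∃ R, NonnegCoeffs R ∧ diffPoly p a b N δ bu fu bv fv bw fw =
    X ^ 2 * ((1 + X) * bv * bu * bw * linkPoly p a b N) +
    (1 + X) ^ 2 * (1 + 3 * X + X ^ 2) * (bu * bw * X * (p + X * b)) * fv +
    (1 + X) ^ 2 * (1 + 4 * X + 2 * X ^ 2) * (bv * bw * X * (p + X * a)) * fu +
    (1 + X) ^ 2 * (1 + 4 * X + 2 * X ^ 2) * (bv * bu * X * (p + X * b)) * fw + R := by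
  have h1 := H.p_nonneg
  have h2 := H.a_nonneg
  have h3 := H.b_nonneg
  have h4 := H.δ_nonneg
  have h5 := Bu.nonneg
  have h6 := Bv.nonneg
  have h7 := Bw.nonneg
  have h8 := Bu.pos.1
  have h9 := Bv.pos.1
  have h10 := Bw.pos.1
  refine ⟨(1 + X) * (bv * ((1 + 2 * X) * (1 + X) * X * (δ * (fu * bw + fw * bu)) +
      (1 + X) * (1 + 4 * X + 2 * X ^ 2) * (fu * fw * δ)) +
    fv * (1 + X) * ((1 + 3 * X + X ^ 2) *
      (bu * bw * X * (p + X * a) + δ * (fu * bw + fw * bu)) +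
      (1 + X) * (bu * bw * X ^ 2 * p + X * (p + X * b) * bu * fw +
        X * (p + X * a) * bw * fu + fu * fw * δ))), ?_, ?_⟩
  · repeat' first | assumption | exact .one | exact .X | exact .ofNat _ |
      apply NonnegCoeffs.add | apply NonnegCoeffs.pow |
      apply NonnegCoeffs.mul
  · unfold diffPoly linkPoly
    ring

lemma coeff_le_diffPoly (i : ℕ) :
    0 ≤ (X ^ 2 * ((1 + X) * bv * bu * bw * linkPoly p a b N)).coeff i ∧
    (X ^ 2 * ((1 + X) * bv * bu * bw * linkPoly p a b N)).coeff i ≤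
      (diffPoly p a b N δ bu fu bv fv bw fw).coeff i ∧
    ((1 + X) ^ 2 * (1 + 3 * X + X ^ 2) * (bu * bw * X * (p + X * b)) * fv).coeff i ≤
      (diffPoly p a b N δ bu fu bv fv bw fw).coeff i ∧
    ((1 + X) ^ 2 * (1 + 4 * X + 2 * X ^ 2) * (bv * bw * X * (p + X * a)) * fu).coeff i ≤
      (diffPoly p a b N δ bu fu bv fv bw fw).coeff i ∧
    ((1 + X) ^ 2 * (1 + 4 * X + 2 * X ^ 2) * (bv * bu * X * (p + X * b)) * fw).coeff i ≤
      (diffPoly p a b N δ bu fu bv fv bw fw).coeff i := by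
  obtain ⟨R, hR, hD⟩ := exists_diffPoly_eq H Bu Bv Bw
  have n1 := Bu.nonneg
  have n2 := Bv.nonneg
  have n3 := Bw.nonneg
  have n4 := Bu.pos.1
  have n5 := Bv.pos.1
  have n6 := Bw.pos.1
  have n7 := H.pos_a.1
  have n8 := H.pos_b.1
  have nE := H.posUpTo_linkPoly.1
  have hx1 : NonnegCoeffs (1 + X) := NonnegCoeffs.one.add .X
  have y1 : NonnegCoeffs (1 + 3 * X + X ^ 2 : ℝ[X]) := by
    repeat' first | exact .one | exact .X | exact .ofNat _ |
      apply NonnegCoeffs.add | apply NonnegCoeffs.pow | apply NonnegCoeffs.mul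
  have y2 : NonnegCoeffs (1 + 4 * X + 2 * X ^ 2 : ℝ[X]) := by
    repeat' first | exact .one | exact .X | exact .ofNat _ |
      apply NonnegCoeffs.add | apply NonnegCoeffs.pow | apply NonnegCoeffs.mul
  have m0 : NonnegCoeffs (X ^ 2 * ((1 + X) * bv * bu * bw * linkPoly p a b N)) :=
    (NonnegCoeffs.X.pow 2).mul ((((hx1.mul n5).mul n4).mul n6).mul nE)
  have m1 : NonnegCoeffs ((1 + X) ^ 2 * (1 + 3 * X + X ^ 2) * (bu * bw * X * (p + X * b)) * fv) :=
    (((hx1.pow 2).mul y1).mul (((n4.mul n6).mul .X).mul n8)).mul n2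
  have m2 : NonnegCoeffs
      ((1 + X) ^ 2 * (1 + 4 * X + 2 * X ^ 2) * (bv * bw * X * (p + X * a)) * fu) :=
    (((hx1.pow 2).mul y2).mul (((n5.mul n6).mul .X).mul n7)).mul n1
  have m3 : NonnegCoeffs
      ((1 + X) ^ 2 * (1 + 4 * X + 2 * X ^ 2) * (bv * bu * X * (p + X * b)) * fw) :=
    (((hx1.pow 2).mul y2).mul (((n5.mul n4).mul .X).mul n8)).mul n3
  rw [hD]
  generalize X ^ 2 * ((1 + X) * bv * bu * bw * linkPoly p a b N) = A0 at *
  generalize (1 + X) ^ 2 * (1 + 3 * X + X ^ 2) * (bu * bw * X * (p + X * b)) * fv = A1 at *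
  generalize (1 + X) ^ 2 * (1 + 4 * X + 2 * X ^ 2) * (bv * bw * X * (p + X * a)) * fu = A2 at *
  generalize (1 + X) ^ 2 * (1 + 4 * X + 2 * X ^ 2) * (bv * bu * X * (p + X * b)) * fw = A3 at *
  simp only [coeff_add]
  have g0 := m0 i
  have g1 := m1 i
  have g2 := m2 i
  have g3 := m3 i
  have g4 := hR i
  refine ⟨g0, ?_, ?_, ?_, ?_⟩ <;> linarith

lemma coeff_diffPoly (i : ℕ) :
    0 ≤ (diffPoly p a b N δ bu fu bv fv bw fw).coeff i ∧
    ((diffPoly p a b N δ bu fu bv fv bw fw).coeff i = 0 ↔ i = 0 ∨ i = 1 ∨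
      6 + h + cu + cv + cw ≤ i ∨ (6 + h + cu + cv + cw = 8 ∧ i = 7)) := by
  obtain ⟨g, g0, g1, g2, g3⟩ := coeff_le_diffPoly H Bu Bv Bw i
  have hdeg := natDegree_diffPoly_le H Bu Bv Bw
  have hdvd := X_sq_dvd_diffPoly (p := p) (a := a) (b := b) (N := N) (δ := δ) Bu Bv Bw
  have hh := H.two_le
  have y1 : NonnegCoeffs (1 + 3 * X + X ^ 2 : ℝ[X]) := by
    repeat' first | exact .one | exact .X | exact .ofNat _ |
      apply NonnegCoeffs.add | apply NonnegCoeffs.pow | apply NonnegCoeffs.mul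
  have y2 : NonnegCoeffs (1 + 4 * X + 2 * X ^ 2 : ℝ[X]) := by
    repeat' first | exact .one | exact .X | exact .ofNat _ |
      apply NonnegCoeffs.add | apply NonnegCoeffs.pow | apply NonnegCoeffs.mul
  have x1 : PosUpTo 1 (1 + X : ℝ[X]) := by simpa using PosUpTo.one_add zero_lt_one
  have z1 : 0 < (1 + 3 * X + X ^ 2 : ℝ[X]).coeff 2 := by
    rw [← C_ofNat]; simp [coeff_one]
  have z2 : 0 < (1 + 4 * X + 2 * X ^ 2 : ℝ[X]).coeff 2 := by
    rw [← C_ofNat, ← C_ofNat]; simp [coeff_one]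
  refine ⟨g.trans g0, fun hz => ?_, ?_⟩
  · rw [hz] at g0 g1 g2 g3
    by_contra! hcon
    obtain ⟨hi0, hi1, hin, hi8⟩ := hcon
    obtain ⟨j, rfl⟩ : ∃ j, i = j + 2 := ⟨i - 2, by omega⟩
    rw [mul_comm, coeff_mul_X_pow] at g0
    -- As i = j + 2, this is i ≤ n - 2; the alternative is i = n - 1.
    by_cases hlow : j ≤ 2 + h + cu + cv + cw
    · exact g0.not_gt
        (((((x1.mul Bv.pos).mul Bu.pos).mul Bw.pos).mul H.posUpTo_linkPoly).2 _ (by omega))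
    · by_cases h2 : 2 < h
      · exact g0.not_gt (((((x1.mul Bv.pos).mul Bu.pos).mul Bw.pos).mul
          (H.posUpTo_linkPoly_of_two_lt h2)).2 _ (by omega))
      · rcases Nat.eq_zero_or_pos cv with hv | hv
        · rcases Nat.eq_zero_or_pos cu with hu | hu
          · rcases Nat.eq_zero_or_pos cw with hw | hw
            · omega
            · exact g3.not_gt (coeff_pos_of_branch y2 z2 Bv.pos Bu.pos H.pos_b Bw.nonneg
                (Bw.top_pos hw) (by omega))
          · exact g2.not_gt (coeff_pos_of_branch y2 z2 Bv.pos Bw.pos H.pos_a Bu.nonneg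
              (Bu.top_pos hu) (by omega))
        · exact g1.not_gt (coeff_pos_of_branch y1 z1 Bu.pos Bw.pos H.pos_b Bv.nonneg
            (Bv.top_pos hv) (by omega))
  · rintro (rfl | rfl | hi | ⟨h8, rfl⟩)
    · exact (X_pow_dvd_iff.mp hdvd) 0 (by norm_num)
    · exact (X_pow_dvd_iff.mp hdvd) 1 (by norm_num)
    · exact coeff_eq_zero_of_natDegree_lt (by omega)
    · obtain rfl : cu = 0 := by omega
      obtain rfl : cv = 0 := by omega
      obtain rfl : cw = 0 := by omega
      have eb : ∀ {b f}, IsBranch 0 b f → b = 1 ∧ f = 0 := fun {b f} B =>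
        ⟨by rw [eq_C_of_natDegree_le_zero B.deg, B.coeff_zero, C_1],
          by rw [eq_C_of_natDegree_le_zero B.deg_le, B.coeff_zero', C_0]⟩
      obtain ⟨rfl, rfl⟩ := eb Bu
      obtain ⟨rfl, rfl⟩ := eb Bv
      obtain ⟨rfl, rfl⟩ := eb Bw
      -- With empty branches only `linkPoly` survives, and the degree is at most 1 + 2 + 3 = 6.
      have e : diffPoly p a b N δ 1 0 1 0 1 0 = (1 + X) * (X ^ 2 * linkPoly p a b N) := by
        unfold diffPoly linkPoly; ring
      rw [e]
      refine coeff_eq_zero_of_natDegree_lt (lt_of_le_of_lt (natDegree_mul_le_of_le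
        (m := 1) (by compute_degree!) (natDegree_mul_le_of_le (natDegree_X_pow_le 2)
        (H.natDegree_linkPoly_le (by omega)))) (by norm_num))

end
end SignlessUnicyclic

/-! ### The polynomials of a branch and of the link -/

namespace SignlessUnicyclic
open Polynomial Matrix

/-- Only row y changes, and the determinant is affine in that row. -/
lemma det_add_smul_single {ι R : Type*} [Fintype ι] [DecidableEq ι] [CommRing R]
    (M : Matrix ι ι R) (y : ι) (c : R) :
    (M + c • Matrix.single y y 1).det = M.det + c * M.adjugate y y := by
  have h : M + c • Matrix.single y y 1 = M.updateRow y (M y + c • Pi.single y 1) := by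
    ext i j
    by_cases hi : i = y
    · subst hi; simp [Matrix.single_apply, Pi.single_apply, eq_comm]
    · simp [hi, Ne.symm hi]
  rw [h, det_updateRow_add, det_updateRow_smul, updateRow_eq_self, adjugate_apply]

variable {ι : Type*} [Fintype ι] [DecidableEq ι]

omit [Fintype ι] in
lemma pencil_add_single (A : Matrix ι ι ℝ) (y : ι) :
    pencil (A + Matrix.single y y 1) = pencil A + (X : ℝ[X]) • Matrix.single y y 1 := by
  unfold pencil
  rw [Matrix.map_add _ (fun _ _ => C_add), smul_add, add_assoc]
  congr 3
  ext i j : 1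
  by_cases h : y = i ∧ y = j
  · obtain ⟨rfl, rfl⟩ := h; simp
  · rw [map_apply, Matrix.single_apply_of_ne _ _ _ _ _ h, Matrix.single_apply_of_ne _ _ _ _ _ h, C_0]

lemma det_pencil_add_single (A : Matrix ι ι ℝ) (y : ι) :
    (pencil (A + Matrix.single y y 1)).det = (pencil A).det + X * (pencil A).adjugate y y := by
  rw [pencil_add_single, det_add_smul_single]

lemma isBranch_of_posDef {A : Matrix ι ι ℝ} (hA : A.PosDef) {q : ι → ℝ} (hq : ∀ i, q i ^ 2 = 1) :
    IsBranch (Fintype.card ι) (pencil A).det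
      (C (∑ i, q i ^ 2) * (pencil A).det - adjForm A q) where
  pos := posUpTo_det_pencil hA
  deg := natDegree_det_pencil_le hA.posSemidef
  coeff_zero := coeff_zero_det_pencil A
  nonneg := nonnegCoeffs_sub_adjForm hA.posSemidef q
  deg_le := natDegree_sub_adjForm_le hA.posSemidef q
  coeff_zero' := coeff_zero_sub_adjForm hA.posSemidef q
  top_pos h := by
    obtain ⟨i⟩ := Fintype.card_pos_iff.mp h
    refine coeff_card_sub_adjForm_pos hA fun h0 => ?_
    have := hq i
    simp [h0] at this

lemma adjForm_single (A : Matrix ι ι ℝ) (y : ι) :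
    adjForm A (Pi.single y 1) = (pencil A).adjugate y y := by
  unfold adjForm
  rw [Finset.sum_eq_single y (fun i _ hi => by simp [hi]) (by simp),
    Finset.sum_eq_single y (fun i _ hi => by simp [hi]) (by simp)]
  simp

/-- Taken at e = 1 and e = -1, this bounds the off-diagonal entry N from both sides. -/
lemma adjForm_pair {A : Matrix ι ι ℝ} (hA : A.PosSemidef) {y z : ι} (hyz : y ≠ z) (e : ℝ) :
    adjForm A (Pi.single y 1 + Pi.single z e) = (pencil A).adjugate y y +
      C (e ^ 2) * (pencil A).adjugate z z + C (2 * e) * (pencil A).adjugate y z := by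
  unfold adjForm
  have h1 : ∀ f : ι → ℝ[X], ∑ i, C ((Pi.single y 1 + Pi.single z e : ι → ℝ) i) * f i =
      f y + C e * f z := fun f => by
    rw [Fintype.sum_eq_add y z hyz]
    · simp [hyz, hyz.symm]
    · rintro i ⟨hy, hz⟩; simp [hy, hz]
  have h2 : ∀ f : ι → ℝ[X], ∑ i, f i * C ((Pi.single y 1 + Pi.single z e : ι → ℝ) i) =
      f y + f z * C e := fun f => by
    rw [Fintype.sum_eq_add y z hyz]
    · simp [hyz, hyz.symm]
    · rintro i ⟨hy, hz⟩; simp [hy, hz]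
  have h3 : ∀ i, ∑ j, C ((Pi.single y 1 + Pi.single z e : ι → ℝ) i) * (pencil A).adjugate i j *
      C ((Pi.single y 1 + Pi.single z e : ι → ℝ) j) =
      C ((Pi.single y 1 + Pi.single z e : ι → ℝ) i) *
        ((pencil A).adjugate i y + (pencil A).adjugate i z * C e) := fun i => by
    rw [← h2 ((pencil A).adjugate i), Finset.mul_sum]
    exact Finset.sum_congr rfl fun j _ => mul_assoc _ _ _
  simp only [h3]
  rw [h1, adjugate_pencil_symm hA z y]
  simp only [C_mul, C_pow, C_ofNat]
  ring

lemma sum_sq_pair {y z : ι} (hyz : y ≠ z) (e : ℝ) :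
    ∑ i, (Pi.single y 1 + Pi.single z e : ι → ℝ) i ^ 2 = 1 + e ^ 2 := by
  rw [Fintype.sum_eq_add y z hyz]
  · simp [hyz, hyz.symm]
  · rintro i ⟨hy, hz⟩; simp [hy, hz]

lemma sum_sq_single (y : ι) : ∑ i, (Pi.single y 1 : ι → ℝ) i ^ 2 = 1 := by
  rw [Fintype.sum_eq_single y fun i hi => by simp [hi]]; simp

section Kernel
variable {A : Matrix ι ι ℝ} {σ : ι → ℝ}

/-- A vector on which both quadratic forms vanish lies in the kernel of A, hence on the line of σ,
and is zero at y; but σ has no zero entry. -/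
lemma posDef_add_single (hA : A.PosSemidef) (hσ : ∀ i, σ i ^ 2 = 1)
    (hker : ∀ g, A *ᵥ g = 0 → ∀ i j, g i * σ j = g j * σ i) (y : ι) :
    (A + Matrix.single y y 1).PosDef := by
  have hE : (Matrix.single y y (1 : ℝ)).PosSemidef := by
    rw [← Matrix.diagonal_single]
    exact PosSemidef.diagonal fun i => by
      by_cases h : i = y
      · subst h; simp
      · simp [h]
  have hE' : ∀ x : ι → ℝ, star x ⬝ᵥ (Matrix.single y y (1 : ℝ) *ᵥ x) = x y ^ 2 := fun x => by
    rw [← Matrix.diagonal_single, dotProduct, Fintype.sum_eq_single y]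
    · simp [mulVec_diagonal, sq]
    · intro i hi; simp [mulVec_diagonal, hi]
  refine PosDef.of_dotProduct_mulVec_pos (hA.add hE).1 fun x hx => ?_
  rw [add_mulVec, dotProduct_add, hE']
  have h1 := hA.dotProduct_mulVec_nonneg x
  refine lt_of_le_of_ne (by positivity) fun h0 => hx ?_
  have h2 : star x ⬝ᵥ A *ᵥ x = 0 := by nlinarith [sq_nonneg (x y)]
  have h3 : x y = 0 := by
    have : x y ^ 2 = 0 := by linarith
    simpa using this
  have h4 := hker x ((hA.dotProduct_mulVec_zero_iff x).mp h2)
  ext i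
  have h5 := h4 i y
  rw [h3, zero_mul] at h5
  have h6 : σ y ≠ 0 := fun h => by simpa [h] using hσ y
  simpa [h6] using h5

/-- The coefficient of X^(h-1) in adj(1 + X A) is annihilated by A, so it is a positive multiple of
σ σᵀ; this gives all the top coefficients. The inequalities are those of the quadratic forms at e_y,
e_z, e_y + e_z and e_y - e_z. -/
lemma isLink_of_kernel (hA : A.PosSemidef) (hσ : ∀ i, σ i ^ 2 = 1) (hAσ : A *ᵥ σ = 0)
    (hker : ∀ g, A *ᵥ g = 0 → ∀ i j, g i * σ j = g j * σ i) {y z : ι} (hyz : y ≠ z)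
    (htwo : Fintype.card ι = 2 → σ y * σ z = -1) :
    IsLink (Fintype.card ι) (pencil A).det ((pencil A).adjugate y y) ((pencil A).adjugate z z)
      ((pencil A).adjugate y z)
      (pencil (A + Matrix.single y y 1 + Matrix.single z z 1)).det := by
  have hcard : 2 ≤ Fintype.card ι := by
    have := Fintype.one_lt_card_iff.mpr ⟨y, z, hyz⟩
    omega
  have hne : ∀ i, σ i ≠ 0 := fun i h => by simpa [h] using hσ i
  have hdet : A.det = 0 := by
    by_contra h
    have h2 := congrArg (A⁻¹ *ᵥ ·) hAσ
    simp only [mulVec_mulVec, nonsing_inv_mul _ (isUnit_iff_ne_zero.mpr h), one_mulVec,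
      mulVec_zero] at h2
    exact hne y (congrFun h2 y)
  have hpc : (pencil A).det.coeff (Fintype.card ι) = 0 := by rw [coeff_card_det_pencil hA, hdet]
  have hpa : PosUpTo (Fintype.card ι) ((pencil A).det + X * (pencil A).adjugate y y) := by
    rw [← det_pencil_add_single]
    exact posUpTo_det_pencil (posDef_add_single hA hσ hker y)
  have hpb : PosUpTo (Fintype.card ι) ((pencil A).det + X * (pencil A).adjugate z z) := by
    rw [← det_pencil_add_single]
    exact posUpTo_det_pencil (posDef_add_single hA hσ hker z)
  have hX : ∀ f : ℝ[X], (f * X).coeff (Fintype.card ι) = f.coeff (Fintype.card ι - 1) := fun f => by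
    rw [← coeff_mul_X f (Fintype.card ι - 1)]
    congr 1
    omega
  -- Compare coefficients of X^h in (1 + X A) adj(1 + X A) = det(1 + X A) · 1: the right side has
  -- none because det A = 0, and adj(1 + X A) has degree at most h - 1.
  have hcol : ∀ k, A *ᵥ (fun j => ((pencil A).adjugate j k).coeff (Fintype.card ι - 1)) = 0 := by
    intro k
    ext i
    have h1 := congrArg (coeff · (Fintype.card ι)) (congrFun (congrFun (mul_adjugate (pencil A)) i) k)
    simp only [Matrix.mul_apply, finsetSum_coeff, Matrix.smul_apply, smul_eq_mul] at h1
    rw [show ((pencil A).det * (1 : Matrix ι ι ℝ[X]) i k).coeff (Fintype.card ι) = 0 by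
      by_cases h : i = k
      · subst h; simp [hpc]
      · simp [h]] at h1
    refine Eq.trans (Finset.sum_congr rfl fun j _ => ?_) h1
    have h2 : (pencil A i j * (pencil A).adjugate j k) =
        (1 : Matrix ι ι ℝ[X]) i j * (pencil A).adjugate j k +
          C (A i j) * ((pencil A).adjugate j k * X) := by
      rw [show pencil A i j = (1 : Matrix ι ι ℝ[X]) i j + X * C (A i j) from rfl]; ring
    have h3 : ((1 : Matrix ι ι ℝ[X]) i j * (pencil A).adjugate j k).coeff (Fintype.card ι) = 0 := by
      by_cases h : i = j
      · subst h
        rw [Matrix.one_apply_eq, one_mul]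
        exact coeff_eq_zero_of_natDegree_lt
          ((natDegree_adjugate_pencil_le hA _ _).trans_lt (by omega))
      · simp [h]
    rw [h2, coeff_add, h3, zero_add, coeff_C_mul, hX]
  have hker' : ∀ i k, ((pencil A).adjugate i k).coeff (Fintype.card ι - 1) * σ k =
      ((pencil A).adjugate k k).coeff (Fintype.card ι - 1) * σ i := fun i k => hker _ (hcol k) i k
  have hka : 0 < ((pencil A).adjugate y y).coeff (Fintype.card ι - 1) := by
    have := hpa.2 _ le_rfl
    rwa [coeff_add, hpc, zero_add, mul_comm, hX] at this
  have hN : ((pencil A).adjugate y z).coeff (Fintype.card ι - 1) =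
      σ y * σ z * ((pencil A).adjugate y y).coeff (Fintype.card ι - 1) := by
    rw [adjugate_pencil_symm hA y z]
    have h1 := hker' z y
    linear_combination σ y * h1 - ((pencil A).adjugate z y).coeff (Fintype.card ι - 1) * hσ y
  -- Since 1 + X A fixes σ, adj(1 + X A) σ = det(1 + X A) σ; row y of this in degree h - 1 has h
  -- equal summands on the left.
  have hsum : (pencil A).det.coeff (Fintype.card ι - 1) =
      Fintype.card ι * ((pencil A).adjugate y y).coeff (Fintype.card ι - 1) := by
    have h1 : pencil A *ᵥ (fun j => C (σ j)) = fun j => C (σ j) := by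
      have h2 : A.map C *ᵥ (fun j => C (σ j)) = 0 := by
        ext1 i
        have := congrArg C (congrFun hAσ i)
        simpa [mulVec, dotProduct, map_sum] using this
      rw [pencil, add_mulVec, one_mulVec, smul_mulVec, h2, smul_zero, add_zero]
    have h3 := congrArg ((pencil A).adjugate *ᵥ ·) h1
    simp only [mulVec_mulVec, adjugate_mul, smul_mulVec, one_mulVec] at h3
    have h4 := congrArg (coeff · (Fintype.card ι - 1)) (congrFun h3 y)
    simp only [Pi.smul_apply, smul_eq_mul, mulVec, dotProduct, finsetSum_coeff, coeff_mul_C] at h4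
    have h5 : ∀ j, ((pencil A).adjugate y j).coeff (Fintype.card ι - 1) * σ j =
        ((pencil A).adjugate y y).coeff (Fintype.card ι - 1) * σ y := fun j => by
      rw [adjugate_pencil_symm hA y j]
      have h6 := hker' j y
      linear_combination σ y * σ j * h6 -
        ((pencil A).adjugate j y).coeff (Fintype.card ι - 1) * σ j * hσ y +
        ((pencil A).adjugate y y).coeff (Fintype.card ι - 1) * σ y * hσ j
    simp only [h5, Finset.sum_const, Finset.card_univ, nsmul_eq_mul] at h4
    exact mul_right_cancel₀ (hne y) (by linarith)
  have hb : ((pencil A).adjugate z z).coeff (Fintype.card ι - 1) =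
      ((pencil A).adjugate y y).coeff (Fintype.card ι - 1) := by
    have h1 := hker' y z
    rw [hN] at h1
    refine mul_right_cancel₀ (hne y) ?_
    linear_combination -h1 + σ y * ((pencil A).adjugate y y).coeff (Fintype.card ι - 1) * hσ z
  refine ⟨hcard, nonnegCoeffs_det_pencil hA, ?_, ?_, ?_, ?_, ?_, ?_, hpa, hpb, ?_,
    natDegree_adjugate_pencil_le hA _ _, natDegree_adjugate_pencil_le hA _ _,
    natDegree_adjugate_pencil_le hA _ _, nonnegCoeffs_det_pencil ?_, natDegree_det_pencil_le ?_,
    _, σ y * σ z, hka, ?_, htwo, hsum, rfl, hb, hN⟩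
  · rw [← adjForm_single]; exact nonnegCoeffs_adjForm hA _
  · rw [← adjForm_single]; exact nonnegCoeffs_adjForm hA _
  · have := nonnegCoeffs_sub_adjForm hA (Pi.single y 1)
    rwa [sum_sq_single, adjForm_single, C_1, one_mul] at this
  · have := nonnegCoeffs_sub_adjForm hA (Pi.single z 1)
    rwa [sum_sq_single, adjForm_single, C_1, one_mul] at this
  · have := nonnegCoeffs_adjForm hA (Pi.single y 1 + Pi.single z 1)
    rw [adjForm_pair hA hyz] at this
    convert this using 1
    rw [one_pow, mul_one, C_1, one_mul, C_ofNat]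
  · have := nonnegCoeffs_sub_adjForm hA (Pi.single y 1 + Pi.single z (-1))
    rw [adjForm_pair hA hyz, sum_sq_pair hyz] at this
    convert this using 1
    simp only [C_add, C_mul, C_pow, C_neg, C_1, C_ofNat]
    ring
  · rw [natDegree_le_iff_coeff_eq_zero]
    intro j hj
    rcases (Nat.lt_or_ge (Fintype.card ι) j) with h | h
    · exact coeff_eq_zero_of_natDegree_lt ((natDegree_det_pencil_le hA).trans_lt h)
    · rwa [show j = Fintype.card ι by omega]
  · exact ((posDef_add_single hA hσ hker y).posSemidef.add (by
      rw [← Matrix.diagonal_single]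
      exact PosSemidef.diagonal fun i => by
        by_cases h : i = z
        · subst h; simp
        · simp [h]))
  · exact ((posDef_add_single hA hσ hker y).posSemidef.add (by
      rw [← Matrix.diagonal_single]
      exact PosSemidef.diagonal fun i => by
        by_cases h : i = z
        · subst h; simp
        · simp [h]))
  · rw [← sq_eq_sq₀ (abs_nonneg _) zero_le_one, sq_abs, mul_pow, hσ, hσ]; norm_num
end Kernel
end SignlessUnicyclic

/-! ### Evaluation at t > 0: the closed form of the difference and the shares of the blocks -/

namespace SignlessUnicyclic
open Polynomial Matrix

/-- U, Y, W are the diagonal entries at u, v, w and S the entry at (u,w) of the Schur complement for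
G; U' is the entry at u after the transformation. The prefactor is the determinant on the remaining
vertices, where the three pendent ones give (1 + t)³; it clears all denominators. -/
lemma diff_eq {t p a b N δ bu fu bv fv bw fw : ℝ} (ht : 0 < t) (hδ : δ ≠ 0) (hbu : bu ≠ 0)
    (hbv : bv ≠ 0) (hbw : bw ≠ 0) (hrel : (p + t * a) * (p + t * b) - t ^ 2 * N ^ 2 = p * δ)
    {U U' W Y S : ℝ}
    (hU : U = 1 + t + t / (1 + t) + fu / bu + t * (p + t * b) / δ)
    (hY : Y = 1 + 2 * t + t / (1 + t) + fv / bv)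
    (hW : W = 1 + t + t / (1 + t) + fw / bw + t * (p + t * a) / δ)
    (hS : S = -(t ^ 2 * N / δ))
    (hU' : U' = 1 + 2 * t + t / (1 + t) + fu / bu + fv / bv + fw / bw + t * (p + t * b) / δ +
      t * (p + t * a) / δ - 2 * (t ^ 2 * N / δ)) :
    (1 + t) ^ 3 * δ * bu * bv * bw * (U * Y * W + 2 * t * t * S - U * t ^ 2 - Y * S ^ 2 - W * t ^ 2) -
    (1 + t) ^ 3 * δ * bu * bv * bw * (U' * (1 + t + t / (1 + t)) * (1 + t + t / (1 + t)) -
      2 * t ^ 2 * (1 + t + t / (1 + t))) =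
    (1 + t) * (bv * ((1 + 2 * t) * (1 + t) * t *
      (bu * bw * t * (2 * p + t * (a + b)) + δ * (fu * bw + fw * bu)) +
      2 * (1 + 2 * t) * (1 + 4 * t + 2 * t ^ 2) * t ^ 2 * N * bu * bw +
      (1 + t) * (1 + 4 * t + 2 * t ^ 2) * (bu * bw * t ^ 2 * p + t * (p + t * b) * bu * fw +
        t * (p + t * a) * bw * fu + fu * fw * δ)) +
    fv * (1 + t) * ((1 + 3 * t + t ^ 2) *
      (bu * bw * t * (2 * p + t * (a + b)) + δ * (fu * bw + fw * bu)) +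
      (1 + t) * (bu * bw * t ^ 2 * p + t * (p + t * b) * bu * fw +
        t * (p + t * a) * bw * fu + fu * fw * δ))) := by
  have h1 : (1 + t) ≠ 0 := by positivity
  have e1 : 2 * p + t * (a + b) = (p + t * b) + (p + t * a) := by ring
  rw [e1]
  generalize p + t * b = k at *
  generalize p + t * a = l at *
  -- Eliminating p by the rank-two relation leaves an identity of rational functions in independent
  -- variables.
  obtain rfl : p = (l * k - t ^ 2 * N ^ 2) / δ := by field_simp; linarith
  subst hU hY hW hS hU'
  field_simp
  ring

section Single
variable {ι R : Type*} [Fintype ι] [DecidableEq ι] [CommRing R]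

/-- The (y,z) entry of the adjugate does not see row z; nor does it see column y, which is the
companion lemma. Hence N is the same for A and for the link block. -/
lemma adjugate_add_smul_single_same (M : Matrix ι ι R) (y z : ι) (c : R) :
    (M + c • Matrix.single z z 1).adjugate y z = M.adjugate y z := by
  rw [adjugate_apply, adjugate_apply]
  congr 1
  ext i j
  by_cases hi : i = z
  · subst hi; simp
  · simp [hi, Ne.symm hi]

lemma adjugate_add_smul_single_same' (M : Matrix ι ι R) (y z : ι) (c : R) :
    (M + c • Matrix.single y y 1).adjugate y z = M.adjugate y z := by
  rw [← transpose_apply (adjugate _) z y, ← transpose_apply M.adjugate z y, adjugate_transpose,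
    adjugate_transpose, transpose_add, transpose_smul, Matrix.transpose_single,
    adjugate_add_smul_single_same]

end Single

section Eval
variable {ι : Type*} [Fintype ι] [DecidableEq ι]

lemma evalRingHom_mapMatrix_pencil (A : Matrix ι ι ℝ) (t : ℝ) :
    (evalRingHom t).mapMatrix (pencil A) = 1 + t • A := by
  ext i j
  rw [RingHom.mapMatrix_apply, map_apply, pencil, Matrix.add_apply, Matrix.smul_apply, map_apply,
    Matrix.add_apply, Matrix.smul_apply, map_add, smul_eq_mul, map_mul]
  by_cases h : i = j
  · subst h; simp
  · simp [h]

lemma eval_det_pencil (A : Matrix ι ι ℝ) (t : ℝ) : (pencil A).det.eval t = (1 + t • A).det := by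
  rw [← coe_evalRingHom, RingHom.map_det, evalRingHom_mapMatrix_pencil]

lemma eval_adjugate_pencil (A : Matrix ι ι ℝ) (t : ℝ) (i j : ι) :
    ((pencil A).adjugate i j).eval t = (1 + t • A).adjugate i j := by
  rw [← evalRingHom_mapMatrix_pencil, ← RingHom.map_adjugate]
  rfl

lemma eval_adjForm (A : Matrix ι ι ℝ) (q : ι → ℝ) (t : ℝ) :
    (adjForm A q).eval t = q ⬝ᵥ (1 + t • A).adjugate *ᵥ q := by
  simp only [adjForm, eval_finsetSum, eval_mul, eval_C, eval_adjugate_pencil, dotProduct, mulVec,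
    Finset.mul_sum, mul_assoc]

lemma det_one_add_smul_pos {A : Matrix ι ι ℝ} (hA : A.PosSemidef) {t : ℝ} (ht : 0 < t) :
    0 < (1 + t • A).det :=
  (PosDef.one.add_posSemidef (hA.smul ht.le)).det_pos

lemma inv_apply_eq_div (M : Matrix ι ι ℝ) (i j : ι) : M⁻¹ i j = M.adjugate i j / M.det := by
  rw [inv_def, Matrix.smul_apply, smul_eq_mul, Ring.inverse_eq_inv', div_eq_inv_mul]

/-- Put M = 1 + t A. As x = s A σ, the vector t x is s (M σ - σ). After substitution M⁻¹ cancels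
everywhere except in σᵀ M⁻¹ σ, which is the adjugate form over det M. -/
lemma branch_eval {A : Matrix ι ι ℝ} (hA : A.IsSymm) {t : ℝ} (hdet : (1 + t • A).det ≠ 0)
    {x σ : ι → ℝ} {s : ℝ} (hs : s ^ 2 = 1) (hx : A *ᵥ σ = s • x) (hxσ : ∀ i, x i * σ i = s * x i) :
    t * ∑ i, x i - t ^ 2 * (x ⬝ᵥ (1 + t • A)⁻¹ *ᵥ x) =
      (C (∑ i, σ i ^ 2) * (pencil A).det - adjForm A σ).eval t / (pencil A).det.eval t := by
  have hu : IsUnit (1 + t • A).det := isUnit_iff_ne_zero.mpr hdet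
  have hx' : x = s • A *ᵥ σ := by rw [hx, smul_smul, ← sq, hs, one_smul]
  have h1 : ∑ i, x i = σ ⬝ᵥ A *ᵥ σ := by
    rw [hx, dotProduct]
    refine Finset.sum_congr rfl fun i _ => ?_
    rw [Pi.smul_apply, smul_eq_mul]
    linear_combination -x i * hs - s * hxσ i
  have hM : t • A *ᵥ σ = (1 + t • A) *ᵥ σ - σ := by
    rw [add_mulVec, one_mulVec, smul_mulVec, add_sub_cancel_left]
  have hsymm : (1 + t • A)ᵀ = 1 + t • A := by
    rw [transpose_add, transpose_smul, hA.eq, transpose_one]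
  have h2 : t ^ 2 * (x ⬝ᵥ (1 + t • A)⁻¹ *ᵥ x) =
      (t • A *ᵥ σ) ⬝ᵥ (1 + t • A)⁻¹ *ᵥ (t • A *ᵥ σ) := by
    rw [hx']
    simp only [mulVec_smul, dotProduct_smul, smul_dotProduct, smul_eq_mul]
    linear_combination (t ^ 2 * (A *ᵥ σ ⬝ᵥ (1 + t • A)⁻¹ *ᵥ A *ᵥ σ)) * hs
  have h3 : (1 + t • A)⁻¹ *ᵥ ((1 + t • A) *ᵥ σ - σ) = σ - (1 + t • A)⁻¹ *ᵥ σ := by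
    rw [mulVec_sub, mulVec_mulVec, nonsing_inv_mul _ hu, one_mulVec]
  have h4 : ((1 + t • A) *ᵥ σ) ⬝ᵥ (1 + t • A)⁻¹ *ᵥ σ = σ ⬝ᵥ σ := by
    rw [← hsymm, mulVec_transpose, ← dotProduct_mulVec, hsymm, mulVec_mulVec,
      mul_nonsing_inv _ hu, one_mulVec]
  have h5 : (adjForm A σ).eval t = (1 + t • A).det * (σ ⬝ᵥ (1 + t • A)⁻¹ *ᵥ σ) := by
    rw [eval_adjForm, inv_def, smul_mulVec, dotProduct_smul, Ring.inverse_eq_inv', smul_eq_mul,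
      mul_inv_cancel_left₀ hdet]
  rw [h2, h1, hM, h3, eval_sub, h5, eval_mul, eval_C, eval_det_pencil]
  rw [eq_div_iff hdet, sub_dotProduct, dotProduct_sub, dotProduct_sub, h4]
  have h6 : t * (σ ⬝ᵥ A *ᵥ σ) = σ ⬝ᵥ (1 + t • A) *ᵥ σ - σ ⬝ᵥ σ := by
    rw [← dotProduct_sub, ← hM, dotProduct_smul, smul_eq_mul]
  rw [h6, show ∑ i, σ i ^ 2 = σ ⬝ᵥ σ by simp [dotProduct, sq], dotProduct_comm ((1 + t • A) *ᵥ σ) σ]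
  ring

/-- The first three identities come from adding the two diagonal units one at a time. The last is
the matrix determinant lemma for the rank-two update, with a 2 × 2 determinant of entries of (1 + t
A)⁻¹. -/
lemma link_eval {A : Matrix ι ι ℝ} (hA : A.PosSemidef) {t : ℝ} (ht : 0 < t) (y z : ι)
    {p a b N δ : ℝ} (hp : p = (pencil A).det.eval t) (ha : a = ((pencil A).adjugate y y).eval t)
    (hb : b = ((pencil A).adjugate z z).eval t) (hN : N = ((pencil A).adjugate y z).eval t)
    {M : Matrix ι ι ℝ} (hM : M = 1 + t • (A + Matrix.single y y 1 + Matrix.single z z 1))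
    (hδ : δ = M.det) (hδ0 : δ ≠ 0) :
    t - t ^ 2 * M⁻¹ y y = t * (p + t * b) / δ ∧ t - t ^ 2 * M⁻¹ z z = t * (p + t * a) / δ ∧
    M⁻¹ y z = N / δ ∧ (p + t * a) * (p + t * b) - t ^ 2 * N ^ 2 = p * δ := by
  have hsymm : ∀ i j, (1 + t • A).adjugate i j = (1 + t • A).adjugate j i := fun i j => by
    rw [← eval_adjugate_pencil, adjugate_pencil_symm hA, eval_adjugate_pencil]
  have hdet := (det_one_add_smul_pos hA ht).ne'
  rw [eval_det_pencil] at hp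
  rw [eval_adjugate_pencil] at ha hb hN
  set B := 1 + t • A with hB
  -- Either order of the updates exhibits the diagonal adjugate entry at the vertex that is added
  -- last.
  have hM1 : M = (B + t • Matrix.single z z 1) + t • Matrix.single y y 1 := by
    rw [hM, hB]; simp only [smul_add]; abel
  have hM2 : M = (B + t • Matrix.single y y 1) + t • Matrix.single z z 1 := by
    rw [hM, hB]; simp only [smul_add]; abel
  have h1 : δ = (p + t * b) + t * M.adjugate y y := by
    rw [hδ]
    nth_rewrite 1 [hM1]
    rw [det_add_smul_single, det_add_smul_single, hM1, adjugate_add_smul_single_same, hp, hb]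
  have h2 : δ = (p + t * a) + t * M.adjugate z z := by
    rw [hδ]
    nth_rewrite 1 [hM2]
    rw [det_add_smul_single, det_add_smul_single, hM2, adjugate_add_smul_single_same, hp, ha]
  refine ⟨?_, ?_, ?_, ?_⟩
  · rw [inv_apply_eq_div, ← hδ]
    field_simp
    linarith
  · rw [inv_apply_eq_div, ← hδ]
    field_simp
    linarith
  · rw [inv_apply_eq_div, ← hδ, hM1, adjugate_add_smul_single_same',
      adjugate_add_smul_single_same, hN]
  · let U : Matrix ι (Fin 2) ℝ := Matrix.of fun i k => if i = ![y, z] k then 1 else 0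
    have e1 : M = B + U * (t • Uᵀ) := by
      rw [hM, hB, add_assoc A, smul_add, ← add_assoc]
      congr 1
      rw [Matrix.mul_smul]
      congr 1
      ext i j
      simp [U, Matrix.mul_apply, Matrix.single_apply, Fin.sum_univ_two, ite_and, eq_comm]
      split_ifs <;> simp_all
    have e2 : ∀ k l, ((t • Uᵀ) * B⁻¹ * U) k l = t * B⁻¹ (![y, z] k) (![y, z] l) := by
      intro k l
      simp only [Matrix.mul_assoc, Matrix.smul_mul, Matrix.smul_apply, smul_eq_mul]
      congr 1
      simp [U, Matrix.mul_apply]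
    have e3 := det_add_mul (A := B) U (t • Uᵀ) (isUnit_iff_ne_zero.mpr hdet)
    rw [← e1, ← hδ, det_fin_two] at e3
    simp only [Matrix.add_apply, e2] at e3
    simp only [inv_apply_eq_div, cons_val_zero, cons_val_one, Matrix.one_apply_eq] at e3
    rw [Matrix.one_apply_ne (by decide), Matrix.one_apply_ne (by decide), hsymm z y, ← hN, ← ha,
      ← hb, ← hp] at e3
    rw [← hp] at hdet
    rw [e3]
    field_simp
    ring

end Eval
end SignlessUnicyclic

/-! ### Schur complements and block diagonal matrices -/

namespace SignlessUnicyclic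
open Polynomial Matrix

section Schur
variable {V K : Type*} [Fintype V] [DecidableEq V] [Field K]

/-- The vertices other than three given ones. -/
abbrev Rest (u v w : V) : Type _ := {r : V // r ≠ u ∧ r ≠ v ∧ r ≠ w}

/-- A vertex is one of three given ones or one of the rest. -/
def threeSumRest {u v w : V} (huv : u ≠ v) (huw : u ≠ w) (hvw : v ≠ w) :
    Fin 3 ⊕ Rest u v w ≃ V where
  toFun := Sum.elim ![u, v, w] Subtype.val
  invFun x := if hu : x = u then .inl 0 else if hv : x = v then .inl 1 else
    if hw : x = w then .inl 2 else .inr ⟨x, hu, hv, hw⟩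
  left_inv x := by
    rcases x with x | ⟨x, h1, h2, h3⟩
    · fin_cases x <;> simp [huv.symm, huw.symm, hvw.symm]
    · simp [h1, h2, h3]
  right_inv x := by
    by_cases hu : x = u
    · simp [hu]
    · by_cases hv : x = v
      · subst hv; simp [hu]
      · by_cases hw : x = w
        · subst hw; simp [hu, hv]
        · simp [hu, hv, hw]

/-- The Schur complement formula for three vertices. -/
lemma det_eq_det_mul_schur {M : Matrix V V K} (hM : M.IsSymm) {u v w : V} (huv : u ≠ v)
    (huw : u ≠ w) (hvw : v ≠ w) {D : Matrix (Rest u v w) (Rest u v w) K}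
    (hD : D = M.submatrix Subtype.val Subtype.val) (hdet : D.det ≠ 0) {a b c d e f : K}
    {x y z : Rest u v w → K} (hx : ∀ r : Rest u v w, M r u = x r)
    (hy : ∀ r : Rest u v w, M r v = y r)
    (hz : ∀ r : Rest u v w, M r w = z r)
    (ha : a = M u u - x ⬝ᵥ D⁻¹ *ᵥ x) (hb : b = M v v - y ⬝ᵥ D⁻¹ *ᵥ y)
    (hc : c = M w w - z ⬝ᵥ D⁻¹ *ᵥ z) (hd : d = M u v - x ⬝ᵥ D⁻¹ *ᵥ y)
    (he : e = M v w - y ⬝ᵥ D⁻¹ *ᵥ z) (hf : f = M u w - x ⬝ᵥ D⁻¹ *ᵥ z) :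
    M.det = D.det * (a * b * c + 2 * d * e * f - a * e ^ 2 - b * f ^ 2 - c * d ^ 2) := by
  have hDu : IsUnit D.det := isUnit_iff_ne_zero.mpr hdet
  let := D.invertibleOfIsUnitDet hDu
  have hDs : D⁻¹ᵀ = D⁻¹ := by
    rw [transpose_nonsing_inv, hD, transpose_submatrix, hM.eq]
  have hcomm : ∀ p q : Rest u v w → K, p ⬝ᵥ D⁻¹ *ᵥ q = q ⬝ᵥ D⁻¹ *ᵥ p := fun p q => by
    rw [dotProduct_mulVec, ← mulVec_transpose, hDs, dotProduct_comm]
  let k : Fin 3 → V := ![u, v, w]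
  let Xc : Matrix (Rest u v w) (Fin 3) K := M.submatrix Subtype.val k
  have h1 : M.submatrix (threeSumRest huv huw hvw) (threeSumRest huv huw hvw) =
      fromBlocks (M.submatrix k k) Xcᵀ Xc D := by
    ext i j
    rcases i with i | i <;> rcases j with j | j
    · rfl
    · exact hM.apply _ _
    · rfl
    · rw [hD]; rfl
  rw [← det_submatrix_equiv_self (threeSumRest huv huw hvw) M, h1, det_fromBlocks₂₂, det_fin_three,
    invOf_eq_nonsing_inv]
  congr 1
  have hcol : (fun r => Xc r 0) = x ∧ (fun r => Xc r 1) = y ∧ (fun r => Xc r 2) = z :=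
    ⟨_root_.funext hx, _root_.funext hy, _root_.funext hz⟩
  have h2 : ∀ i j, (Xcᵀ * D⁻¹ * Xc) i j = (fun r => Xc r i) ⬝ᵥ D⁻¹ *ᵥ (fun r => Xc r j) := by
    intro i j
    rw [Matrix.mul_assoc]
    rfl
  simp only [Matrix.sub_apply, h2, hcol, submatrix_apply]
  simp only [show k 0 = u from rfl, show k 1 = v from rfl, show k 2 = w from rfl]
  rw [hcomm y x, hcomm z x, hcomm z y, hM.apply u v, hM.apply u w, hM.apply v w, ← ha, ← hb, ← hc,
    ← hd, ← he, ← hf]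
  ring

end Schur

section Blocks
variable {R K : Type*} [Fintype R] [DecidableEq R] [Field K] {n : ℕ} {M : Matrix R R K}
  {l : R → Fin n}

lemma det_eq_prod_of_label (hM : ∀ r s, l r ≠ l s → M r s = 0) :
    M.det = ∏ k, (M.toSquareBlock l k).det :=
  BlockTriangular.det_fintype fun r s h => hM r s h.ne'

/-- The coordinate projection onto a label class commutes with M, hence with M⁻¹. -/
lemma inv_apply_of_label_ne (hM : ∀ r s, l r ≠ l s → M r s = 0) (hdet : M.det ≠ 0) {r s : R}
    (h : l r ≠ l s) : M⁻¹ r s = 0 := by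
  have hu : IsUnit M.det := isUnit_iff_ne_zero.mpr hdet
  let D : Matrix R R K := diagonal fun i => if l i = l r then 1 else 0
  have hc : D * M = M * D := by
    ext i j
    rw [diagonal_mul, mul_diagonal]
    by_cases hij : l i = l j
    · rw [hij, mul_comm]
    · rw [hM i j hij]; simp
  have hc' : D * M⁻¹ = M⁻¹ * D := by
    calc D * M⁻¹ = M⁻¹ * M * (D * M⁻¹) := by rw [nonsing_inv_mul _ hu, Matrix.one_mul]
      _ = M⁻¹ * (D * M) * M⁻¹ := by rw [hc]; simp only [Matrix.mul_assoc]
      _ = M⁻¹ * D * (M * M⁻¹) := by simp only [Matrix.mul_assoc]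
      _ = M⁻¹ * D := by rw [mul_nonsing_inv _ hu, Matrix.mul_one]
  have := congrFun (congrFun hc' r) s
  rw [diagonal_mul, mul_diagonal, if_pos rfl, if_neg h.symm] at this
  simpa using this

omit [DecidableEq R] in
lemma sum_eq_sum_block {f : R → K} {k : Fin n} (h : ∀ r, l r ≠ k → f r = 0) :
    ∑ r, f r = ∑ r : {r // l r = k}, f r := by
  rw [← Fintype.sum_subtype_add_sum_subtype (fun r => l r = k) f,
    Fintype.sum_eq_zero (fun r : {r // ¬ l r = k} => f r) fun r => h r r.2, add_zero]

lemma inv_toSquareBlock (hM : ∀ r s, l r ≠ l s → M r s = 0) (hdet : M.det ≠ 0) (k : Fin n) :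
    (M.toSquareBlock l k)⁻¹ = M⁻¹.toSquareBlock l k := by
  refine inv_eq_right_inv ?_
  ext i j
  have h1 := congrFun (congrFun (mul_nonsing_inv M (isUnit_iff_ne_zero.mpr hdet)) i.1) j.1
  rw [Matrix.mul_apply] at h1
  rw [Matrix.mul_apply]
  rw [sum_eq_sum_block (l := l) (k := k) fun r hr => by
    rw [hM i.1 r (by rw [i.2]; exact hr.symm), zero_mul]] at h1
  refine h1.trans ?_
  by_cases h : i = j
  · subst h; simp
  · rw [Matrix.one_apply_ne h, Matrix.one_apply_ne (fun h' => h (Subtype.ext h'))]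

lemma dotProduct_eq_toSquareBlock (hM : ∀ r s, l r ≠ l s → M r s = 0) (hdet : M.det ≠ 0)
    {k : Fin n} {x y : R → K} (hx : ∀ r, l r ≠ k → x r = 0) (hy : ∀ r, l r ≠ k → y r = 0) :
    x ⬝ᵥ M⁻¹ *ᵥ y =
      (fun r : {r // l r = k} => x r) ⬝ᵥ (M.toSquareBlock l k)⁻¹ *ᵥ (fun r => y r) := by
  rw [inv_toSquareBlock hM hdet, dotProduct, sum_eq_sum_block (l := l) (k := k) fun r hr => by
    rw [hx r hr, zero_mul]]
  refine Finset.sum_congr rfl fun r _ => ?_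
  congr 1
  rw [mulVec, dotProduct, sum_eq_sum_block (l := l) (k := k) fun s hs => by rw [hy s hs, mul_zero]]
  rfl

lemma dotProduct_eq_zero_of_label_ne (hM : ∀ r s, l r ≠ l s → M r s = 0) (hdet : M.det ≠ 0)
    {x y : R → K} {k m : Fin n} (hkm : k ≠ m) (hx : ∀ r, l r ≠ k → x r = 0)
    (hy : ∀ r, l r ≠ m → y r = 0) : x ⬝ᵥ M⁻¹ *ᵥ y = 0 := by
  refine Finset.sum_eq_zero fun r _ => ?_
  by_cases hr : l r = k
  · rw [mulVec, dotProduct, Finset.sum_eq_zero fun s _ => ?_, mul_zero]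
    by_cases hs : l s = m
    · rw [inv_apply_of_label_ne hM hdet (by rw [hr, hs]; exact hkm), zero_mul]
    · rw [hy s hs, mul_zero]
  · rw [hx r hr, zero_mul]

end Blocks
end SignlessUnicyclic

/-! ### Shares of the blocks in a Schur complement -/

namespace SignlessUnicyclic
open Polynomial Matrix

section Response
variable {R : Type*} [Fintype R] [DecidableEq R] {n : ℕ}

/-- The contribution of the block with label `k` to a Schur complement. -/
noncomputable def blockForm (M : Matrix R R ℝ) (l : R → Fin n) (k : Fin n) (x y : R → ℝ) : ℝ :=
  (fun r : {r // l r = k} => x r) ⬝ᵥ (M.toSquareBlock l k)⁻¹ *ᵥ (fun r => y r)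

/-- The contribution of the block with label `k` to a diagonal entry of a Schur complement. -/
noncomputable def response (t : ℝ) (M : Matrix R R ℝ) (l : R → Fin n) (k : Fin n) (x : R → ℝ) : ℝ :=
  t * ∑ r : {r // l r = k}, x r - t ^ 2 * blockForm M l k x x

variable {M : Matrix R R ℝ} {l : R → Fin n}

lemma dotProduct_inv_eq_sum_blockForm (hM : ∀ r s, l r ≠ l s → M r s = 0) (hdet : M.det ≠ 0)
    (x y : R → ℝ) : x ⬝ᵥ M⁻¹ *ᵥ y = ∑ k, blockForm M l k x y := by
  let P : Fin n → (R → ℝ) → R → ℝ := fun k x r => if l r = k then x r else 0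
  have hP : ∀ x, x = ∑ k, P k x := fun x => by
    ext r
    simp [P, Finset.sum_apply]
  have hsupp : ∀ k x r, l r ≠ k → P k x r = 0 := fun k x r h => by simp [P, h]
  conv_lhs => rw [hP x, hP y]
  rw [sum_dotProduct]
  refine Finset.sum_congr rfl fun k _ => ?_
  rw [mulVec_sum, dotProduct_sum, Finset.sum_eq_single k]
  · rw [dotProduct_eq_toSquareBlock hM hdet (hsupp k x) (hsupp k y), blockForm]
    congr 1
    · ext r; simp [P, r.2]
    · congr 1
      ext r; simp [P, r.2]
  · intro m _ hm
    exact dotProduct_eq_zero_of_label_ne hM hdet hm.symm (hsupp k x) (hsupp m y)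
  · simp

omit [DecidableEq R] in
lemma sum_eq_sum_label (x : R → ℝ) : ∑ r, x r = ∑ k, ∑ r : {r // l r = k}, x r :=
  (Fintype.sum_fiberwise l x).symm

/-- The diagonal entry of Q at a vertex is a degree, so it contains the sum of the column x. Pairing
this sum with the quadratic form makes the diagonal of the Schur complement additive over blocks. -/
lemma response_sum (hM : ∀ r s, l r ≠ l s → M r s = 0) (hdet : M.det ≠ 0) (t : ℝ) (x : R → ℝ) :
    t * ∑ r, x r - t ^ 2 * (x ⬝ᵥ M⁻¹ *ᵥ x) = ∑ k, response t M l k x := by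
  rw [dotProduct_inv_eq_sum_blockForm hM hdet, sum_eq_sum_label (l := l), Finset.mul_sum,
    Finset.mul_sum, ← Finset.sum_sub_distrib]
  rfl

lemma blockForm_congr {k : Fin n} {x x' y y' : R → ℝ} (hx : ∀ r, l r = k → x r = x' r)
    (hy : ∀ r, l r = k → y r = y' r) : blockForm M l k x y = blockForm M l k x' y' := by
  unfold blockForm
  rw [show (fun r : {r // l r = k} => x r) = fun r : {r // l r = k} => x' r from
      _root_.funext fun r => hx r r.2,
    show (fun r : {r // l r = k} => y r) = fun r : {r // l r = k} => y' r from
      _root_.funext fun r => hy r r.2]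

lemma response_congr {t : ℝ} {k : Fin n} {x x' : R → ℝ} (hx : ∀ r, l r = k → x r = x' r) :
    response t M l k x = response t M l k x' := by
  unfold response
  rw [blockForm_congr hx hx, show (fun r : {r // l r = k} => x r) = fun r : {r // l r = k} => x' r from
    _root_.funext fun r => hx r r.2]

lemma blockForm_eq_zero_left {k : Fin n} {x y : R → ℝ} (hx : ∀ r, l r = k → x r = 0) :
    blockForm M l k x y = 0 := by
  unfold blockForm
  rw [show (fun r : {r // l r = k} => x r) = 0 from _root_.funext fun r => hx r r.2,
    zero_dotProduct]

lemma blockForm_eq_zero_right {k : Fin n} {x y : R → ℝ} (hy : ∀ r, l r = k → y r = 0) :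
    blockForm M l k x y = 0 := by
  unfold blockForm
  rw [show (fun r : {r // l r = k} => y r) = 0 from _root_.funext fun r => hy r r.2,
    mulVec_zero, dotProduct_zero]

lemma response_eq_zero {t : ℝ} {k : Fin n} {x : R → ℝ} (hx : ∀ r, l r = k → x r = 0) :
    response t M l k x = 0 := by
  unfold response
  rw [blockForm_eq_zero_left hx, Fintype.sum_eq_zero _ fun r : {r // l r = k} => hx r r.2]
  simp

lemma det_toSquareBlock_of_unique {k : Fin n} {r₀ : R} (h : ∀ r, l r = k ↔ r = r₀) :
    (M.toSquareBlock l k).det = M r₀ r₀ := by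
  let : Unique {r // l r = k} := ⟨⟨⟨r₀, (h r₀).mpr rfl⟩⟩, fun r => Subtype.ext ((h r).mp r.2)⟩
  rw [det_unique]
  rfl

lemma response_of_unique {t : ℝ} (ht : 0 < t) {k : Fin n} {r₀ : R} (h : ∀ r, l r = k ↔ r = r₀)
    (hM : M r₀ r₀ = 1 + t) {x : R → ℝ} (hx : x r₀ = 1) : response t M l k x = t / (1 + t) := by
  let : Unique {r // l r = k} := ⟨⟨⟨r₀, (h r₀).mpr rfl⟩⟩, fun r => Subtype.ext ((h r).mp r.2)⟩
  have e : ∀ r : {r // l r = k}, (r : R) = r₀ := fun r => (h r).mp r.2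
  have h1 : (M.toSquareBlock l k)⁻¹ default default = (1 + t)⁻¹ := by
    rw [inv_apply_eq_div, det_unique, adjugate_subsingleton, Matrix.one_apply_eq, one_div]
    congr 1
  simp only [response, blockForm, Fintype.sum_unique, dotProduct, mulVec, h1, e, hx]
  field_simp
  ring

lemma blockForm_add_left (k : Fin n) (x y z : R → ℝ) :
    blockForm M l k (x + y) z = blockForm M l k x z + blockForm M l k y z := by
  simp only [blockForm, ← add_dotProduct]
  rfl

lemma blockForm_add_right (k : Fin n) (x y z : R → ℝ) :
    blockForm M l k x (y + z) = blockForm M l k x y + blockForm M l k x z := by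
  simp only [blockForm, ← dotProduct_add, ← mulVec_add]
  rfl

lemma blockForm_ite {k : Fin n} (i j : {r // l r = k}) :
    blockForm M l k (fun r => if r = i then 1 else 0) (fun r => if r = j then 1 else 0) =
      (M.toSquareBlock l k)⁻¹ i j := by
  simp only [blockForm, dotProduct, mulVec, ← Subtype.ext_iff]
  simp

lemma sum_ite_block {k : Fin n} (i : {r // l r = k}) :
    ∑ r : {r // l r = k}, (if (r : R) = i then (1 : ℝ) else 0) = 1 := by
  simp only [← Subtype.ext_iff]
  simp

end Response

/-! ### The abstract transformation of matrices and its determinant identity -/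

variable {V : Type*} [Fintype V] [DecidableEq V]

/-- Two signless Laplacian matrices that differ by moving the neighbours of `v` and `w` to `u`. The
rest of the vertices falls into blocks that are labelled by `l`: the pendent vertices `p 0`, `p 1`
and `p 2`, the branches at `u`, `v`, `w` with labels `3`, `4` and `5`, and a link with label `6`
from `y` next to `u` to `z` next to `w`. -/
structure Surgery (Q Q' : Matrix V V ℝ) {u v w : V} (l : Rest u v w → Fin 7)
    (p : Fin 3 → Rest u v w) (y z : {r // l r = 6}) (σ : Rest u v w → ℝ) (s : Fin 3 → ℝ)
    (A : Matrix {r // l r = 6} {r // l r = 6} ℝ) : Prop where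
  huv : u ≠ v
  huw : u ≠ w
  hvw : v ≠ w
  symm : Q.IsSymm
  symm' : Q'.IsSymm
  rest : ∀ r s : Rest u v w, Q' r s = Q r s
  label : ∀ r s : Rest u v w, l r ≠ l s → Q r s = 0
  l_zero : ∀ r, l r = 0 ↔ r = p 0
  l_one : ∀ r, l r = 1 ↔ r = p 1
  l_two : ∀ r, l r = 2 ↔ r = p 2
  diag : ∀ k, Q (p k) (p k) = 1
  uu : Q u u = 1 + ∑ r : Rest u v w, Q r u
  vv : Q v v = 2 + ∑ r : Rest u v w, Q r v
  ww : Q w w = 1 + ∑ r : Rest u v w, Q r w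
  uv : Q u v = 1
  vw : Q v w = 1
  uw : Q u w = 0
  col_u : ∀ r : Rest u v w, l r ≠ 3 → Q r u = if r = p 0 ∨ r = y then 1 else 0
  col_v : ∀ r : Rest u v w, l r ≠ 4 → Q r v = if r = p 1 then 1 else 0
  col_w : ∀ r : Rest u v w, l r ≠ 5 → Q r w = if r = p 2 ∨ r = z then 1 else 0
  uu' : Q' u u = 2 + ∑ r : Rest u v w, Q' r u
  vv' : Q' v v = 1 + ∑ r : Rest u v w, Q' r v
  ww' : Q' w w = 1 + ∑ r : Rest u v w, Q' r w
  uv' : Q' u v = 1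
  vw' : Q' v w = 0
  uw' : Q' u w = 1
  col_u' : ∀ r : Rest u v w, r ≠ p 1 → r ≠ p 2 → Q' r u = Q r u + Q r v + Q r w
  col_u'_one : Q' (p 1) u = 0
  col_u'_two : Q' (p 2) u = 0
  col_v' : ∀ r : Rest u v w, Q' r v = if r = p 1 then 1 else 0
  col_w' : ∀ r : Rest u v w, Q' r w = if r = p 2 then 1 else 0
  sq_σ : ∀ r, σ r ^ 2 = 1
  sq_s : ∀ k, s k ^ 2 = 1
  posDef : ∀ k : Fin 7, k = 3 ∨ k = 4 ∨ k = 5 → ((Q.submatrix Subtype.val Subtype.val :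
    Matrix (Rest u v w) (Rest u v w) ℝ).toSquareBlock l k).PosDef
  mulVec_u : (Q.submatrix Subtype.val Subtype.val : Matrix (Rest u v w) (Rest u v w) ℝ).toSquareBlock
    l 3 *ᵥ (fun r => σ r) = s 0 • fun r => Q r.1 u
  mulVec_v : (Q.submatrix Subtype.val Subtype.val : Matrix (Rest u v w) (Rest u v w) ℝ).toSquareBlock
    l 4 *ᵥ (fun r => σ r) = s 1 • fun r => Q r.1 v
  mulVec_w : (Q.submatrix Subtype.val Subtype.val : Matrix (Rest u v w) (Rest u v w) ℝ).toSquareBlock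
    l 5 *ᵥ (fun r => σ r) = s 2 • fun r => Q r.1 w
  sign_u : ∀ r : Rest u v w, l r = 3 → Q r u * σ r = s 0 * Q r u
  sign_v : ∀ r : Rest u v w, l r = 4 → Q r v * σ r = s 1 * Q r v
  sign_w : ∀ r : Rest u v w, l r = 5 → Q r w * σ r = s 2 * Q r w
  link : (Q.submatrix Subtype.val Subtype.val : Matrix (Rest u v w) (Rest u v w) ℝ).toSquareBlock
    l 6 = A + Matrix.single y y 1 + Matrix.single z z 1
  link_psd : A.PosSemidef
  link_σ : A *ᵥ (fun r => σ r) = 0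
  link_ker : ∀ g, A *ᵥ g = 0 → ∀ i j : {r // l r = 6}, g i * σ j = g j * σ i
  y_ne_z : y ≠ z
  sign_two : Fintype.card {r // l r = 6} = 2 → σ y * σ z = -1

namespace Surgery
variable {Q Q' : Matrix V V ℝ} {u v w : V} {l : Rest u v w → Fin 7}
    {p : Fin 3 → Rest u v w} {y z : {r // l r = 6}} {σ : Rest u v w → ℝ} {s : Fin 3 → ℝ}
    {A : Matrix {r // l r = 6} {r // l r = 6} ℝ}

/-- The block of a matrix with label `k`. -/
noncomputable abbrev blk (Q : Matrix V V ℝ) {u v w : V} (l : Rest u v w → Fin 7) (k : Fin 7) :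
    Matrix {r // l r = k} {r // l r = k} ℝ :=
  (Q.submatrix Subtype.val Subtype.val : Matrix (Rest u v w) (Rest u v w) ℝ).toSquareBlock l k

/-- The polynomial `|σ|² b - σᵀ adj(1 + X B) σ` of the block `B` with label `k`. -/
noncomputable abbrev branchPoly (Q : Matrix V V ℝ) {u v w : V} (l : Rest u v w → Fin 7)
    (σ : Rest u v w → ℝ) (k : Fin 7) : ℝ[X] :=
  C (∑ r : {r // l r = k}, σ r ^ 2) * (pencil (blk Q l k)).det - adjForm (blk Q l k) (fun r => σ r)

variable (S : Surgery Q Q' l p y z σ s A)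
include S

omit S [Fintype V] [DecidableEq V] in
lemma eval_diffPoly (p a b N δ bu fu bv fv bw fw : ℝ[X]) (t : ℝ) :
    (diffPoly p a b N δ bu fu bv fv bw fw).eval t =
    (1 + t) * (bv.eval t * ((1 + 2 * t) * (1 + t) * t *
      (bu.eval t * bw.eval t * t * (2 * p.eval t + t * (a.eval t + b.eval t)) +
        δ.eval t * (fu.eval t * bw.eval t + fw.eval t * bu.eval t)) +
      2 * (1 + 2 * t) * (1 + 4 * t + 2 * t ^ 2) * t ^ 2 * N.eval t * bu.eval t * bw.eval t +
      (1 + t) * (1 + 4 * t + 2 * t ^ 2) * (bu.eval t * bw.eval t * t ^ 2 * p.eval t +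
        t * (p.eval t + t * b.eval t) * bu.eval t * fw.eval t +
        t * (p.eval t + t * a.eval t) * bw.eval t * fu.eval t +
        fu.eval t * fw.eval t * δ.eval t)) +
    fv.eval t * (1 + t) * ((1 + 3 * t + t ^ 2) *
      (bu.eval t * bw.eval t * t * (2 * p.eval t + t * (a.eval t + b.eval t)) +
        δ.eval t * (fu.eval t * bw.eval t + fw.eval t * bu.eval t)) +
      (1 + t) * (bu.eval t * bw.eval t * t ^ 2 * p.eval t +
        t * (p.eval t + t * b.eval t) * bu.eval t * fw.eval t +
        t * (p.eval t + t * a.eval t) * bw.eval t * fu.eval t +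
        fu.eval t * fw.eval t * δ.eval t))) := by
  simp only [diffPoly, eval_add, eval_mul, eval_one, eval_X, eval_ofNat, eval_pow]

-- The matrix D on the vertices other than u, v, w is common to Q and Q' and invertible for t > 0.
-- Both determinants are det D times a 3 × 3 determinant whose entries are sums of block shares, and
-- `diff_eq` subtracts them.
set_option maxHeartbeats 2000000 in
lemma eval_diff {t : ℝ} (ht : 0 < t) :
    (pencil Q).det.eval t - (pencil Q').det.eval t =
      (diffPoly (pencil A).det ((pencil A).adjugate y y) ((pencil A).adjugate z z)
        ((pencil A).adjugate y z) (pencil (blk Q l 6)).det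
        (pencil (blk Q l 3)).det (branchPoly Q l σ 3)
        (pencil (blk Q l 4)).det (branchPoly Q l σ 4)
        (pencil (blk Q l 5)).det (branchPoly Q l σ 5)).eval t := by
  set D : Matrix (Rest u v w) (Rest u v w) ℝ :=
    1 + t • Q.submatrix Subtype.val Subtype.val with hD
  have hDlabel : ∀ r s, l r ≠ l s → D r s = 0 := fun r s h => by
    have : r ≠ s := fun h' => h (congrArg l h')
    simp [hD, this, S.label r s h]
  have hblk : ∀ k, D.toSquareBlock l k = 1 + t • blk Q l k := fun k => by
    ext i j
    by_cases h : i = j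
    · subst h; simp [hD, toSquareBlock_def]
    · have : i.1 ≠ j.1 := fun h' => h (Subtype.ext h')
      simp [hD, toSquareBlock_def, h, this]
  have hpend : ∀ k, D (p k) (p k) = 1 + t := fun k => by simp [hD, S.diag]
  have hdetD : D.det = (1 + t) ^ 3 * (1 + t • blk Q l 6).det * (1 + t • blk Q l 3).det *
      (1 + t • blk Q l 4).det * (1 + t • blk Q l 5).det := by
    rw [det_eq_prod_of_label hDlabel, Fin.prod_univ_seven,
      det_toSquareBlock_of_unique (M := D) S.l_zero, det_toSquareBlock_of_unique (M := D) S.l_one,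
      det_toSquareBlock_of_unique (M := D) S.l_two, hblk, hblk, hblk, hblk, hpend, hpend, hpend]
    ring
  have hpos3 := det_one_add_smul_pos (S.posDef 3 (by simp)).posSemidef ht
  have hpos4 := det_one_add_smul_pos (S.posDef 4 (by simp)).posSemidef ht
  have hpos5 := det_one_add_smul_pos (S.posDef 5 (by simp)).posSemidef ht
  have hsingle : ∀ i : {r // l r = 6}, (Matrix.single i i (1 : ℝ)).PosSemidef := fun i => by
    rw [← Matrix.diagonal_single]
    exact PosSemidef.diagonal fun j => by
      by_cases h : j = i
      · subst h; simp
      · simp [h]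
  have hpos6 : 0 < (1 + t • blk Q l 6).det := by
    refine det_one_add_smul_pos ?_ ht
    rw [blk, S.link]
    exact (S.link_psd.add (hsingle y)).add (hsingle z)
  have hdet0 : D.det ≠ 0 := by rw [hdetD]; positivity
  obtain ⟨L1, L2, L3, L4⟩ := link_eval S.link_psd ht y z rfl rfl rfl rfl
    (M := D.toSquareBlock l 6) (by rw [hblk, blk, S.link]) rfl (by rw [hblk]; exact hpos6.ne')
  have B3 := branch_eval (x := fun r : {r // l r = 3} => Q r.1 u) (σ := fun r => σ r)
    (A := blk Q l 3) (isHermitian_iff_isSymm.mp (S.posDef 3 (by simp)).1) hpos3.ne' (S.sq_s 0)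
    S.mulVec_u fun r => S.sign_u r r.2
  have B4 := branch_eval (x := fun r : {r // l r = 4} => Q r.1 v) (σ := fun r => σ r)
    (A := blk Q l 4) (isHermitian_iff_isSymm.mp (S.posDef 4 (by simp)).1) hpos4.ne' (S.sq_s 1)
    S.mulVec_v fun r => S.sign_v r r.2
  have B5 := branch_eval (x := fun r : {r // l r = 5} => Q r.1 w) (σ := fun r => σ r)
    (A := blk Q l 5) (isHermitian_iff_isSymm.mp (S.posDef 5 (by simp)).1) hpos5.ne' (S.sq_s 2)
    S.mulVec_w fun r => S.sign_w r r.2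
  have hL6 : (D.toSquareBlock l 6).det = (1 + t • blk Q l 6).det := by rw [hblk]
  have hsymm6 : (D.toSquareBlock l 6)⁻¹ z y = (D.toSquareBlock l 6)⁻¹ y z := by
    have hs : (D.toSquareBlock l 6)ᵀ = D.toSquareBlock l 6 := by
      ext i j
      simp [hD, toSquareBlock_def, Matrix.one_apply, S.symm.apply, eq_comm]
    conv_rhs => rw [← hs, ← transpose_nonsing_inv, transpose_apply]
  rw [← hblk] at B3 B4 B5
  set cu : Rest u v w → ℝ := fun r => Q r u with hcu
  set cv : Rest u v w → ℝ := fun r => Q r v with hcv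
  set cw : Rest u v w → ℝ := fun r => Q r w with hcw
  set cu' : Rest u v w → ℝ := fun r => Q' r u with hcu'
  set cv' : Rest u v w → ℝ := fun r => Q' r v with hcv'
  set cw' : Rest u v w → ℝ := fun r => Q' r w with hcw'
  have p01 : p 0 ≠ p 1 := fun h => by
    have h0 := (S.l_zero _).mpr rfl
    rw [h, (S.l_one _).mpr rfl] at h0
    exact absurd h0 (by decide)
  have p02 : p 0 ≠ p 2 := fun h => by
    have h0 := (S.l_zero _).mpr rfl
    rw [h, (S.l_two _).mpr rfl] at h0
    exact absurd h0 (by decide)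
  have p12 : p 1 ≠ p 2 := fun h => by
    have h0 := (S.l_one _).mpr rfl
    rw [h, (S.l_two _).mpr rfl] at h0
    exact absurd h0 (by decide)
  have hp : ∀ r k, 3 ≤ l r → r ≠ p k := fun r k h h' => by
    fin_cases k
    · rw [(S.l_zero r).mpr h'] at h; exact absurd h (by decide)
    · rw [(S.l_one r).mpr h'] at h; exact absurd h (by decide)
    · rw [(S.l_two r).mpr h'] at h; exact absurd h (by decide)
  have hlink : ∀ r (i : {r // l r = 6}), l r ≠ 6 → r ≠ i := fun r i h h' => h (h' ▸ i.2)
  have hu0 : ∀ r, l r ≠ 3 → l r ≠ 0 → l r ≠ 6 → cu r = 0 := fun r h3 h0 h6 => by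
    rw [hcu]; dsimp only
    rw [S.col_u r h3, if_neg (not_or.mpr ⟨fun h => h0 ((S.l_zero r).mpr h), hlink r y h6⟩)]
  have hv0 : ∀ r, l r ≠ 4 → l r ≠ 1 → cv r = 0 := fun r h4 h1 => by
    rw [hcv]; dsimp only
    rw [S.col_v r h4, if_neg fun h => h1 ((S.l_one r).mpr h)]
  have hw0 : ∀ r, l r ≠ 5 → l r ≠ 2 → l r ≠ 6 → cw r = 0 := fun r h5 h2 h6 => by
    rw [hcw]; dsimp only
    rw [S.col_w r h5, if_neg (not_or.mpr ⟨fun h => h2 ((S.l_two r).mpr h), hlink r z h6⟩)]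
  have hu6 : ∀ r, l r = 6 → cu r = if r = y then 1 else 0 := fun r h6 => by
    rw [hcu]; dsimp only
    rw [S.col_u r (by rw [h6]; decide)]
    simp [hp r 0 (by rw [h6]; decide)]
  have hw6 : ∀ r, l r = 6 → cw r = if r = z then 1 else 0 := fun r h6 => by
    rw [hcw]; dsimp only
    rw [S.col_w r (by rw [h6]; decide)]
    simp [hp r 2 (by rw [h6]; decide)]
  have hup : cu (p 0) = 1 := by
    rw [hcu]; dsimp only
    rw [S.col_u _ (by rw [(S.l_zero _).mpr rfl]; decide)]
    simp
  have hvp : cv (p 1) = 1 := by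
    rw [hcv]; dsimp only
    rw [S.col_v _ (by rw [(S.l_one _).mpr rfl]; decide)]
    simp
  have hwp : cw (p 2) = 1 := by
    rw [hcw]; dsimp only
    rw [S.col_w _ (by rw [(S.l_two _).mpr rfl]; decide)]
    simp
  have hcu1 : ∀ r, l r ≠ 1 → l r ≠ 2 → cu' r = cu r + cv r + cw r := fun r h1 h2 =>
    S.col_u' r (fun h => h1 ((S.l_one r).mpr h)) (fun h => h2 ((S.l_two r).mpr h))
  have hone : ∀ r : Rest u v w, l r = 1 → r = p 1 := fun r => (S.l_one r).mp
  have htwo : ∀ r : Rest u v w, l r = 2 → r = p 2 := fun r => (S.l_two r).mp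
  -- diagonal entries of the Schur complements
  have ha : 1 + t + (t * ∑ r, cu r - t ^ 2 * (cu ⬝ᵥ D⁻¹ *ᵥ cu)) = 1 + t + t / (1 + t) +
      (branchPoly Q l σ 3).eval t / (pencil (blk Q l 3)).det.eval t +
      t * ((pencil A).det.eval t + t * ((pencil A).adjugate z z).eval t) /
        (D.toSquareBlock l 6).det := by
    rw [response_sum hDlabel hdet0, Fin.sum_univ_seven,
      response_of_unique ht S.l_zero (hpend 0) hup,
      response_eq_zero (k := 1) fun r h => hu0 r (by rw [h]; decide) (by rw [h]; decide)
        (by rw [h]; decide),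
      response_eq_zero (k := 2) fun r h => hu0 r (by rw [h]; decide) (by rw [h]; decide)
        (by rw [h]; decide),
      response_eq_zero (k := 4) fun r h => hu0 r (by rw [h]; decide) (by rw [h]; decide)
        (by rw [h]; decide),
      response_eq_zero (k := 5) fun r h => hu0 r (by rw [h]; decide) (by rw [h]; decide)
        (by rw [h]; decide),
      response_congr hu6, ← B3, ← L1]
    simp only [response, blockForm_ite, sum_ite_block]
    simp only [blockForm]
    ring
  have hb : 1 + 2 * t + (t * ∑ r, cv r - t ^ 2 * (cv ⬝ᵥ D⁻¹ *ᵥ cv)) = 1 + 2 * t + t / (1 + t) +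
      (branchPoly Q l σ 4).eval t / (pencil (blk Q l 4)).det.eval t := by
    rw [response_sum hDlabel hdet0, Fin.sum_univ_seven,
      response_of_unique ht S.l_one (hpend 1) hvp,
      response_eq_zero (k := 0) fun r h => hv0 r (by rw [h]; decide) (by rw [h]; decide),
      response_eq_zero (k := 2) fun r h => hv0 r (by rw [h]; decide) (by rw [h]; decide),
      response_eq_zero (k := 3) fun r h => hv0 r (by rw [h]; decide) (by rw [h]; decide),
      response_eq_zero (k := 5) fun r h => hv0 r (by rw [h]; decide) (by rw [h]; decide),
      response_eq_zero (k := 6) fun r h => hv0 r (by rw [h]; decide) (by rw [h]; decide), ← B4]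
    simp only [response]
    simp only [blockForm]
    ring
  have hc : 1 + t + (t * ∑ r, cw r - t ^ 2 * (cw ⬝ᵥ D⁻¹ *ᵥ cw)) = 1 + t + t / (1 + t) +
      (branchPoly Q l σ 5).eval t / (pencil (blk Q l 5)).det.eval t +
      t * ((pencil A).det.eval t + t * ((pencil A).adjugate y y).eval t) /
        (D.toSquareBlock l 6).det := by
    rw [response_sum hDlabel hdet0, Fin.sum_univ_seven,
      response_of_unique ht S.l_two (hpend 2) hwp,
      response_eq_zero (k := 0) fun r h => hw0 r (by rw [h]; decide) (by rw [h]; decide)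
        (by rw [h]; decide),
      response_eq_zero (k := 1) fun r h => hw0 r (by rw [h]; decide) (by rw [h]; decide)
        (by rw [h]; decide),
      response_eq_zero (k := 3) fun r h => hw0 r (by rw [h]; decide) (by rw [h]; decide)
        (by rw [h]; decide),
      response_eq_zero (k := 4) fun r h => hw0 r (by rw [h]; decide) (by rw [h]; decide)
        (by rw [h]; decide),
      response_congr hw6, ← B5, ← L2]
    simp only [response, blockForm_ite, sum_ite_block]
    simp only [blockForm]
    ring
  have hd : cu ⬝ᵥ D⁻¹ *ᵥ cv = 0 := by
    rw [dotProduct_inv_eq_sum_blockForm hDlabel hdet0]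
    refine Finset.sum_eq_zero fun k _ => ?_
    by_cases h : k = 1 ∨ k = 4
    · refine blockForm_eq_zero_left fun r hr => hu0 r ?_ ?_ ?_ <;> rw [hr] <;>
        rcases h with rfl | rfl <;> decide
    · rw [not_or] at h
      exact blockForm_eq_zero_right fun r hr => hv0 r (by rw [hr]; exact h.2) (by rw [hr]; exact h.1)
  have he : cv ⬝ᵥ D⁻¹ *ᵥ cw = 0 := by
    rw [dotProduct_inv_eq_sum_blockForm hDlabel hdet0]
    refine Finset.sum_eq_zero fun k _ => ?_
    by_cases h : k = 1 ∨ k = 4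
    · refine blockForm_eq_zero_right fun r hr => hw0 r ?_ ?_ ?_ <;> rw [hr] <;>
        rcases h with rfl | rfl <;> decide
    · rw [not_or] at h
      exact blockForm_eq_zero_left fun r hr => hv0 r (by rw [hr]; exact h.2) (by rw [hr]; exact h.1)
  have hf : cu ⬝ᵥ D⁻¹ *ᵥ cw = ((pencil A).adjugate y z).eval t / (D.toSquareBlock l 6).det := by
    rw [dotProduct_inv_eq_sum_blockForm hDlabel hdet0, Finset.sum_eq_single (6 : Fin 7),
      blockForm_congr hu6 hw6, blockForm_ite, L3]
    · intro k _ hk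
      by_cases h : k = 0 ∨ k = 3
      · refine blockForm_eq_zero_right fun r hr => hw0 r ?_ ?_ ?_ <;> rw [hr] <;>
          rcases h with rfl | rfl <;> decide
      · rw [not_or] at h
        exact blockForm_eq_zero_left fun r hr => hu0 r (by rw [hr]; exact h.2)
          (by rw [hr]; exact h.1) (by rw [hr]; exact hk)
    · simp
  have ha' : 1 + 2 * t + (t * ∑ r, cu' r - t ^ 2 * (cu' ⬝ᵥ D⁻¹ *ᵥ cu')) =
      1 + 2 * t + t / (1 + t) + (branchPoly Q l σ 3).eval t / (pencil (blk Q l 3)).det.eval t +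
      (branchPoly Q l σ 4).eval t / (pencil (blk Q l 4)).det.eval t +
      (branchPoly Q l σ 5).eval t / (pencil (blk Q l 5)).det.eval t +
      t * ((pencil A).det.eval t + t * ((pencil A).adjugate z z).eval t) /
        (D.toSquareBlock l 6).det +
      t * ((pencil A).det.eval t + t * ((pencil A).adjugate y y).eval t) /
        (D.toSquareBlock l 6).det -
      2 * (t ^ 2 * ((pencil A).adjugate y z).eval t / (D.toSquareBlock l 6).det) := by
    -- After the transformation both ends of the link are joined to u; the mixed terms of e_y + e_z
    -- produce -2 t² N / δ.
    have h6 : ∀ r, l r = 6 → cu' r = ((fun r : Rest u v w => if r = y then (1 : ℝ) else 0) +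
        (fun r : Rest u v w => if r = z then (1 : ℝ) else 0) : Rest u v w → ℝ) r := fun r h => by
      rw [hcu1 r (by rw [h]; decide) (by rw [h]; decide), hu6 r h, hw6 r h,
        hv0 r (by rw [h]; decide) (by rw [h]; decide), add_zero]
      rfl
    rw [response_sum hDlabel hdet0, Fin.sum_univ_seven,
      response_of_unique ht S.l_zero (hpend 0) (by
        have h := (S.l_zero (p 0)).mpr rfl
        rw [hcu1 _ (by rw [h]; decide) (by rw [h]; decide), hup,
          hv0 _ (by rw [h]; decide) (by rw [h]; decide),
          hw0 _ (by rw [h]; decide) (by rw [h]; decide) (by rw [h]; decide)]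
        norm_num),
      response_eq_zero (k := 1) fun r h => by rw [hone r h]; exact S.col_u'_one,
      response_eq_zero (k := 2) fun r h => by rw [htwo r h]; exact S.col_u'_two,
      response_congr (k := 3) (x' := cu) fun r h => by
        rw [hcu1 r (by rw [h]; decide) (by rw [h]; decide),
          hv0 r (by rw [h]; decide) (by rw [h]; decide),
          hw0 r (by rw [h]; decide) (by rw [h]; decide) (by rw [h]; decide), add_zero, add_zero],
      response_congr (k := 4) (x' := cv) fun r h => by
        rw [hcu1 r (by rw [h]; decide) (by rw [h]; decide),
          hu0 r (by rw [h]; decide) (by rw [h]; decide) (by rw [h]; decide),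
          hw0 r (by rw [h]; decide) (by rw [h]; decide) (by rw [h]; decide), zero_add, add_zero],
      response_congr (k := 5) (x' := cw) fun r h => by
        rw [hcu1 r (by rw [h]; decide) (by rw [h]; decide),
          hu0 r (by rw [h]; decide) (by rw [h]; decide) (by rw [h]; decide),
          hv0 r (by rw [h]; decide) (by rw [h]; decide), zero_add, zero_add],
      response_congr h6, ← B3, ← B4, ← B5, ← L1, ← L2, mul_div_assoc (t ^ 2), ← L3]
    simp only [response, blockForm_add_left, blockForm_add_right, blockForm_ite, Pi.add_apply,
      Finset.sum_add_distrib, sum_ite_block, hsymm6]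
    simp only [blockForm]
    ring
  -- For the new columns at v and w, each supported on a single pendent vertex.
  have hpp : ∀ (k : Fin 7) (i : Fin 3), (∀ r, l r = k ↔ r = p i) → ∀ c : Rest u v w → ℝ,
      (∀ r, c r = if r = p i then 1 else 0) →
      1 + t + (t * ∑ r, c r - t ^ 2 * (c ⬝ᵥ D⁻¹ *ᵥ c)) = 1 + t + t / (1 + t) := by
    intro k i h c hcc
    rw [response_sum hDlabel hdet0, Finset.sum_eq_single k,
      response_of_unique ht h (hpend i) (by rw [hcc, if_pos rfl])]
    · intro m _ hm
      refine response_eq_zero fun r hr => ?_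
      rw [hcc, if_neg fun h' => hm (by rw [← hr, (h r).mpr h'])]
    · simp
  have hd' : cu' ⬝ᵥ D⁻¹ *ᵥ cv' = 0 := by
    rw [dotProduct_inv_eq_sum_blockForm hDlabel hdet0]
    refine Finset.sum_eq_zero fun k _ => ?_
    by_cases h : k = 1
    · exact blockForm_eq_zero_left fun r hr => by rw [hone r (hr.trans h)]; exact S.col_u'_one
    · refine blockForm_eq_zero_right fun r hr => ?_
      rw [hcv']; dsimp only
      rw [S.col_v', if_neg fun h' => h (by rw [← hr, (S.l_one r).mpr h'])]
  have hf' : cu' ⬝ᵥ D⁻¹ *ᵥ cw' = 0 := by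
    rw [dotProduct_inv_eq_sum_blockForm hDlabel hdet0]
    refine Finset.sum_eq_zero fun k _ => ?_
    by_cases h : k = 2
    · exact blockForm_eq_zero_left fun r hr => by rw [htwo r (hr.trans h)]; exact S.col_u'_two
    · refine blockForm_eq_zero_right fun r hr => ?_
      rw [hcw']; dsimp only
      rw [S.col_w', if_neg fun h' => h (by rw [← hr, (S.l_two r).mpr h'])]
  have he' : cv' ⬝ᵥ D⁻¹ *ᵥ cw' = 0 := by
    rw [dotProduct_inv_eq_sum_blockForm hDlabel hdet0]
    refine Finset.sum_eq_zero fun k _ => ?_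
    by_cases h : k = 2
    · refine blockForm_eq_zero_left fun r hr => ?_
      rw [hcv']; dsimp only
      rw [S.col_v', htwo r (hr.trans h), if_neg p12.symm]
    · refine blockForm_eq_zero_right fun r hr => ?_
      rw [hcw']; dsimp only
      rw [S.col_w', if_neg fun h' => h (by rw [← hr, (S.l_two r).mpr h'])]
  rw [eval_det_pencil (blk Q l 3)] at ha
  rw [eval_det_pencil (blk Q l 4)] at hb
  rw [eval_det_pencil (blk Q l 5)] at hc
  rw [eval_det_pencil (blk Q l 3), eval_det_pencil (blk Q l 4), eval_det_pencil (blk Q l 5)] at ha'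
  have key := diff_eq ht (δ := (D.toSquareBlock l 6).det) (bu := (1 + t • blk Q l 3).det)
    (bv := (1 + t • blk Q l 4).det) (bw := (1 + t • blk Q l 5).det)
    (by rw [hL6]; exact hpos6.ne') hpos3.ne' hpos4.ne' hpos5.ne' L4 ha hb hc rfl ha'
  have hsymmM : ∀ B : Matrix V V ℝ, B.IsSymm → (1 + t • B).IsSymm := fun B hB =>
    isSymm_one.add (hB.smul t)
  have hentry : ∀ (B : Matrix V V ℝ) {a b : V}, a ≠ b → (1 + t • B) a b = t * B a b :=
    fun B a b h => by simp [h]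
  have hdiag : ∀ (B : Matrix V V ℝ) (a : V), (1 + t • B) a a = 1 + t * B a a :=
    fun B a => by simp
  have hsc : ∀ x y : Rest u v w → ℝ, (t • x) ⬝ᵥ D⁻¹ *ᵥ (t • y) = t ^ 2 * (x ⬝ᵥ D⁻¹ *ᵥ y) :=
    fun x y => by
      rw [mulVec_smul, dotProduct_smul, smul_dotProduct, smul_eq_mul, smul_eq_mul]; ring
  have hDQ : D = (1 + t • Q).submatrix Subtype.val Subtype.val := by
    ext i j
    by_cases h : i = j
    · subst h; simp [hD]
    · have : i.1 ≠ j.1 := fun h' => h (Subtype.ext h')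
      simp [hD, h, this]
  have hDQ' : D = (1 + t • Q').submatrix Subtype.val Subtype.val := by
    ext i j
    rw [hDQ]
    simp [S.rest, Matrix.one_apply]
  have e1 := det_eq_det_mul_schur (hsymmM Q S.symm) S.huv S.huw S.hvw hDQ hdet0
    (x := t • cu) (y := t • cv) (z := t • cw) (fun r => hentry Q r.2.1) (fun r => hentry Q r.2.2.1)
    (fun r => hentry Q r.2.2.2) rfl rfl rfl rfl rfl rfl
  have e2 := det_eq_det_mul_schur (hsymmM Q' S.symm') S.huv S.huw S.hvw hDQ' hdet0
    (x := t • cu') (y := t • cv') (z := t • cw') (fun r => hentry Q' r.2.1)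
    (fun r => hentry Q' r.2.2.1) (fun r => hentry Q' r.2.2.2) rfl rfl rfl rfl rfl rfl
  rw [hdiag, hdiag, hdiag, hentry Q S.huv, hentry Q S.huw, hentry Q S.hvw, hsc, hsc, hsc, hsc, hsc,
    hsc, hd, he, hf, S.uu, S.vv, S.ww, S.uv, S.vw, S.uw] at e1
  rw [hdiag, hdiag, hdiag, hentry Q' S.huv, hentry Q' S.huw, hentry Q' S.hvw, hsc, hsc, hsc, hsc,
    hsc, hsc, hd', he', hf', S.uu', S.vv', S.ww', S.uv', S.vw', S.uw'] at e2
  have hb' := hpp 1 1 S.l_one cv' S.col_v'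
  have hc' := hpp 2 2 S.l_two cw' S.col_w'
  have hQ : (pencil Q).det.eval t = (1 + t • Q).det := eval_det_pencil Q t
  have hQ' : (pencil Q').det.eval t = (1 + t • Q').det := eval_det_pencil Q' t
  have hv' : 1 + t * (1 + ∑ r : Rest u v w, Q' r v) - t ^ 2 * (cv' ⬝ᵥ D⁻¹ *ᵥ cv') =
      1 + t + t / (1 + t) := by
    rw [← hb']; ring
  have hw' : 1 + t * (1 + ∑ r : Rest u v w, Q' r w) - t ^ 2 * (cw' ⬝ᵥ D⁻¹ *ᵥ cw') =
      1 + t + t / (1 + t) := by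
    rw [← hc']; ring
  rw [eval_diffPoly, eval_det_pencil (blk Q l 3), eval_det_pencil (blk Q l 4),
    eval_det_pencil (blk Q l 5), eval_det_pencil (blk Q l 6), ← hL6, ← key, hQ, hQ', e1, e2, hv',
    hw', hdetD, ← hL6]
  ring

/-- Two polynomials that agree at all t > 0 are equal. -/
lemma det_pencil_sub : (pencil Q).det - (pencil Q').det =
    diffPoly (pencil A).det ((pencil A).adjugate y y) ((pencil A).adjugate z z)
      ((pencil A).adjugate y z) (pencil (blk Q l 6)).det
      (pencil (blk Q l 3)).det (branchPoly Q l σ 3)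
      (pencil (blk Q l 4)).det (branchPoly Q l σ 4)
      (pencil (blk Q l 5)).det (branchPoly Q l σ 5) := by
  refine eq_of_infinite_eval_eq _ _ ((Set.Ioi_infinite (0 : ℝ)).mono fun t ht => ?_)
  rw [Set.mem_ofPred_eq, eval_sub]
  exact S.eval_diff ht

/-- The 6 counts u, v, w and the three pendent vertices. -/
lemma card_eq : Fintype.card V = 6 + Fintype.card {r // l r = 6} + Fintype.card {r // l r = 3} +
    Fintype.card {r // l r = 4} + Fintype.card {r // l r = 5} := by
  have h1 : Fintype.card V = 3 + Fintype.card (Rest u v w) := by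
    rw [← Fintype.card_congr (threeSumRest S.huv S.huw S.hvw), Fintype.card_sum, Fintype.card_fin]
  have h2 : Fintype.card (Rest u v w) = ∑ k, Fintype.card {r // l r = k} := by
    rw [← Fintype.card_sigma, Fintype.card_congr (Equiv.sigmaFiberEquiv l)]
  have h3 : ∀ (k : Fin 7) (r₀ : Rest u v w), (∀ r, l r = k ↔ r = r₀) →
      Fintype.card {r // l r = k} = 1 := fun k r₀ h =>
    Fintype.card_eq_one_iff.mpr ⟨⟨r₀, (h r₀).mpr rfl⟩, fun r => Subtype.ext ((h r).mp r.2)⟩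
  rw [h1, h2, Fin.sum_univ_seven, h3 0 _ S.l_zero, h3 1 _ S.l_one, h3 2 _ S.l_two]
  ring

/-- The coefficients of the difference of the two characteristic determinants. -/
theorem coeff_det_pencil_sub (i : ℕ) :
    0 ≤ ((pencil Q).det - (pencil Q').det).coeff i ∧
    (((pencil Q).det - (pencil Q').det).coeff i = 0 ↔
      i = 0 ∨ i = 1 ∨ Fintype.card V ≤ i ∨ (Fintype.card V = 8 ∧ i = 7)) := by
  have hσ : ∀ k, ∀ r : {r // l r = k}, σ r ^ 2 = 1 := fun k r => S.sq_σ r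
  have H := isLink_of_kernel S.link_psd (hσ 6) S.link_σ S.link_ker S.y_ne_z S.sign_two
  rw [← S.link] at H
  rw [S.card_eq, S.det_pencil_sub]
  exact coeff_diffPoly H (isBranch_of_posDef (S.posDef 3 (by simp)) (hσ 3))
    (isBranch_of_posDef (S.posDef 4 (by simp)) (hσ 4))
    (isBranch_of_posDef (S.posDef 5 (by simp)) (hσ 5)) i

end Surgery
end SignlessUnicyclic

/-! ### Cutting a unicyclic graph into a forest -/

namespace SignlessUnicyclic
open SimpleGraph

variable {V : Type*}

/-- The forest `F` arises from `G` by deleting the edges `u v`, `v w`, `u y`, `w z`, and its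
components are those of `u`, `v`, `w` and `y`; the last one contains `z`. -/
structure IsSplit (G F : SimpleGraph V) (u v w y z : V) : Prop where
  adj_iff : ∀ a b, F.Adj a b ↔ G.Adj a b ∧
    s(a, b) ∉ ({s(u, v), s(v, w), s(u, y), s(w, z)} : Set (Sym2 V))
  acyclic : F.IsAcyclic
  adj_uy : G.Adj u y
  adj_wz : G.Adj w z
  ne : y ≠ z
  reach_yz : F.Reachable y z
  not_uv : ¬ F.Reachable u v
  not_uw : ¬ F.Reachable u w
  not_vw : ¬ F.Reachable v w
  not_uy : ¬ F.Reachable u y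
  not_vy : ¬ F.Reachable v y
  not_wy : ¬ F.Reachable w y
  cover : ∀ x, F.Reachable x u ∨ F.Reachable x v ∨ F.Reachable x w ∨ F.Reachable x y

lemma length_eq_one_of_mem_edges {G : SimpleGraph V} {a b : V} {p : G.Walk a b} (hp : p.IsPath)
    (h : s(a, b) ∈ p.edges) : p.length = 1 := by
  cases p with
  | nil => simp at h
  | @cons _ c _ hac q =>
    rw [Walk.cons_isPath_iff] at hp
    rw [Walk.edges_cons, List.mem_cons] at h
    rcases h with h | h
    · obtain rfl : b = c := by
        have : b ∈ s(a, c) := h ▸ Sym2.mem_mk_right a b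
        rcases Sym2.mem_iff.mp this with rfl | rfl
        · exact absurd q.end_mem_support hp.2
        · rfl
      rw [Walk.length_cons, Walk.length_eq_zero_iff.mpr (Walk.isPath_iff_nil.mp hp.1)]
    · exact absurd (Walk.fst_mem_support_of_mem_edges q h) hp.2

/-- Deleting an edge that is not a bridge keeps G connected and leaves n - 1 edges. -/
lemma isTree_deleteEdges {G : SimpleGraph V} [Fintype V] (hG : IsUnicyclic G) {a b : V}
    (hab : G.Adj a b) (hr : (G.deleteEdges {s(a, b)}).Reachable a b) :
    (G.deleteEdges {s(a, b)}).IsTree := by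
  rw [isTree_iff_connected_and_card]
  refine ⟨hG.1.connected_delete_edge_of_not_isBridge (by rwa [isBridge_iff, not_not]), ?_⟩
  rw [Nat.card_coe_set_eq, edgeSet_deleteEdges, Nat.card_eq_fintype_card, ← hG.2]
  exact Set.ncard_sdiff_singleton_add_one (G.mem_edgeSet.mpr hab)

/-- Deleting a chord would leave a tree that still contains the cycle. -/
lemma mem_edges_of_isCycle {G : SimpleGraph V} [Fintype V] (hG : IsUnicyclic G) {r : V}
    {c : G.Walk r r} (hc : c.IsCycle) {a b : V} (ha : a ∈ c.support) (hb : b ∈ c.support)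
    (hab : G.Adj a b) : s(a, b) ∈ c.edges := by
  classical
  by_contra h
  have hs : ∀ e ∈ c.edges, e ∉ ({s(a, b)} : Set (Sym2 V)) := by
    rintro e he rfl
    exact h he
  refine (isTree_deleteEdges hG hab ?_).isAcyclic _ (hc.toDeleteEdges _ _ hs)
  have h1 : ∀ x ∈ c.support, (G.deleteEdges {s(a, b)}).Reachable r x := fun x hx =>
    ⟨(c.toDeleteEdges _ hs).takeUntil x (by simpa using hx)⟩
  exact (h1 a ha).symm.trans (h1 b hb)

/-- Rotate the cycle to start at a and cut it at b: one arc is the edge ab itself, the other is the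
path. -/
lemma exists_path_of_isCycle [DecidableEq V] {G : SimpleGraph V} {r : V} {c : G.Walk r r}
    (hc : c.IsCycle) {a b : V} (hab : G.Adj a b) (h : s(a, b) ∈ c.edges) :
    ∃ p : G.Walk a b, p.IsPath ∧ p.length + 1 = c.length ∧ s(a, b) ∉ p.edges := by
  have ha : a ∈ c.support := c.fst_mem_support_of_mem_edges h
  set d := c.rotate a ha with hd
  have hdc : d.IsCycle := hc.rotate ha
  have hlen : d.length = c.length := by simp [hd]
  have hde : s(a, b) ∈ d.edges := (c.rotate_edges a ha).mem_iff.mpr h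
  have hb : b ∈ d.support := d.snd_mem_support_of_mem_edges hde
  have hspec := d.take_spec hb
  have hp1 : (d.takeUntil b hb).IsPath := hdc.isPath_takeUntil hb
  have hp2 : (d.dropUntil b hb).IsPath := by
    exact Walk.IsCycle.isPath_of_append_right (p := d.takeUntil b hb)
      (fun h => hab.ne h.eq) (by rwa [hspec])
  have hnd := hdc.isTrail.edges_nodup
  rw [← hspec, Walk.edges_append] at hnd hde
  have hl := congrArg Walk.length hspec
  rw [Walk.length_append] at hl
  rcases List.mem_append.mp hde with h1 | h1
  · have := length_eq_one_of_mem_edges hp1 h1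
    refine ⟨(d.dropUntil b hb).reverse, hp2.reverse, ?_, ?_⟩
    · rw [Walk.length_reverse]; omega
    · rw [Walk.edges_reverse, List.mem_reverse]
      exact fun h2 => (List.nodup_append.mp hnd).2.2 _ h1 _ h2 rfl
  · have := length_eq_one_of_mem_edges hp2 (by rwa [Sym2.eq_swap])
    refine ⟨d.takeUntil b hb, hp1, by omega, ?_⟩
    exact fun h2 => (List.nodup_append.mp hnd).2.2 _ h2 _ h1 rfl

/-- Each step of the walk outside F lands in S, so what follows the last such step stays in F. -/
lemma exists_reachable_of_walk {F T : SimpleGraph V} {S : Set V}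
    (hS : ∀ a b, T.Adj a b → ¬ F.Adj a b → b ∈ S) {a b : V} (q : T.Walk a b) (ha : a ∈ S) :
    ∃ t ∈ S, F.Reachable b t := by
  suffices ∀ t ∈ S, F.Reachable a t → ∃ t ∈ S, F.Reachable b t from this a ha (.refl _)
  clear ha
  induction q with
  | nil => exact fun t ht h => ⟨t, ht, h⟩
  | @cons a d _ had q ih =>
    intro t ht h
    by_cases hF : F.Adj a d
    · exact ih t ht (hF.symm.reachable.trans h)
    · exact ih d (hS a d had hF) (.refl _)

/-- T = G - vw is a tree, and deleting uv separates v from u and w. The path from u to w on that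
side has length g - 2 ≥ 3, so its second vertex y and its last but one z differ. As uv, uy, wz are
bridges of T, the components of u, v, w, y in F are distinct. -/
theorem exists_isSplit [Fintype V] {G : SimpleGraph V} (hG : IsUnicyclic G) {r : V}
    {c : G.Walk r r} (hc : c.IsCycle) (hg : 5 ≤ c.length) {u v w : V} (hu : u ∈ c.support)
    (hv : v ∈ c.support) (hw : w ∈ c.support) (huv : G.Adj u v) (hvw : G.Adj v w) (huw : u ≠ w) :
    ∃ y z F, IsSplit G F u v w y z := by
  classical
  have huvc := mem_edges_of_isCycle hG hc hu hv huv
  have hvwc := mem_edges_of_isCycle hG hc hv hw hvw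
  obtain ⟨p₁, hp₁, hl₁, he₁⟩ := exists_path_of_isCycle hc hvw hvwc
  obtain ⟨p₂, -, -, he₂⟩ := exists_path_of_isCycle hc huv huvc
  set T := G.deleteEdges {s(v, w)} with hT
  have hTtree : T.IsTree := isTree_deleteEdges hG hvw
    (reachable_deleteEdges_iff_exists_walk.mpr ⟨p₁, he₁⟩)
  have hUtree : (G.deleteEdges {s(u, v)}).IsTree := isTree_deleteEdges hG huv
    (reachable_deleteEdges_iff_exists_walk.mpr ⟨p₂, he₂⟩)
  have hbr : ∀ {a b}, T.Adj a b → ¬ (T.deleteEdges {s(a, b)}).Reachable a b := fun {a b} h =>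
    isBridge_iff.mp (isAcyclic_iff_forall_isBridge.mp hTtree.isAcyclic (T.mem_edgeSet.mpr h))
  have huv' : T.Adj u v := by
    rw [hT, deleteEdges_adj]
    exact ⟨huv, by simp [huw, huv.ne]⟩
  set T₂ := T.deleteEdges {s(u, v)} with hT₂
  -- in the forest `T₂`, the vertex `w` lies in the component of `u`
  have hcomp : ∀ x, T₂.Reachable x u ∨ T₂.Reachable x v := by
    have hstep : ∀ {a b : V} (q : T.Walk a b), (T₂.Reachable b u ∨ T₂.Reachable b v) →
        (T₂.Reachable a u ∨ T₂.Reachable a v) := by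
      intro a b q hb
      induction q with
      | nil => exact hb
      | @cons a d _ hac q ih =>
        by_cases h : s(a, d) = s(u, v)
        · rcases Sym2.mem_iff.mp (h ▸ Sym2.mem_mk_left a d : a ∈ s(u, v)) with rfl | rfl
          · exact .inl (.refl _)
          · exact .inr (.refl _)
        · have hadj : T₂.Adj a d := by
            rw [hT₂, deleteEdges_adj]; exact ⟨hac, h⟩
          exact (ih hb).imp hadj.reachable.trans hadj.reachable.trans
    intro x
    obtain ⟨q⟩ := hTtree.1.preconnected x u
    exact hstep q (.inl (.refl _))
  -- If w were on the side of v, putting vw back would not reconnect u with v, yet G - uv is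
  -- connected.
  have hwu : T₂.Reachable w u := by
    refine (hcomp w).resolve_right fun hwv => ?_
    have hstep : ∀ {a b : V} (q : (G.deleteEdges {s(u, v)}).Walk a b), T₂.Reachable b v →
        T₂.Reachable a v := by
      intro a b q hb
      induction q with
      | nil => exact hb
      | @cons a d _ had q ih =>
        by_cases h : s(a, d) = s(v, w)
        · rcases Sym2.mem_iff.mp (h ▸ Sym2.mem_mk_left a d : a ∈ s(v, w)) with rfl | rfl
          · exact .refl _
          · exact hwv
        · have hadj : T₂.Adj a d := by
            rw [hT₂, deleteEdges_adj, hT, deleteEdges_adj]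
            exact ⟨⟨had.1, h⟩, (deleteEdges_adj.mp had).2⟩
          exact hadj.reachable.trans (ih hb)
    obtain ⟨q⟩ := hUtree.1.preconnected u v
    exact hbr huv' (hstep q (.refl _))
  obtain ⟨P, hP⟩ := hwu.exists_isPath
  have hvP : v ∉ P.support := fun h =>
    hbr huv' ⟨(P.dropUntil v h).reverse⟩
  -- P followed by uv is the only path from w to v in T, namely the cycle without vw, of length g -
  -- 1 ≥ 4.
  have hlen : 3 ≤ P.length := by
    have hle : T₂ ≤ T := deleteEdges_le _
    have hPT : (P.mapLe hle).IsPath := hP.mapLe hle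
    have hP' : ((P.mapLe hle).concat huv').IsPath := by
      refine hPT.concat ?_ huv'
      simpa using hvP
    have hs : ∀ e ∈ p₁.edges, e ∉ ({s(v, w)} : Set (Sym2 V)) := by
      rintro e he rfl
      exact he₁ he
    have hp' := (hp₁.toDeleteEdges _ {s(v, w)} hs).reverse
    have hl : (p₁.toDeleteEdges _ hs).length = p₁.length := Walk.length_transfer _ _
    have := congrArg (fun q : T.Path w v => q.1.length)
      ((hTtree.isAcyclic.subsingleton_path w v).elim ⟨_, hP'⟩ ⟨_, hp'⟩)
    simp only [Walk.length_concat, Walk.length_reverse, Walk.length_map] at this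
    rw [hl] at this
    omega
  have hT₂adj : ∀ {a b}, T₂.Adj a b ↔ G.Adj a b ∧ s(a, b) ≠ s(v, w) ∧ s(a, b) ≠ s(u, v) := by
    intro a b
    rw [hT₂, deleteEdges_adj, hT, deleteEdges_adj]
    simp only [Set.mem_singleton_iff, and_assoc, ne_eq]
  -- The first step of P gives z; the first step of the reversed remainder gives y.
  cases P with
  | nil => exact absurd rfl huw
  | @cons _ z _ hwz P₁ =>
  rw [Walk.cons_isPath_iff] at hP
  generalize hR : P₁.reverse = P₁' at *
  have hP₁' : P₁'.IsPath := hR ▸ hP.1.reverse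
  have hwP : w ∉ P₁'.support := by rw [← hR]; simpa using hP.2
  have hlen' : P₁'.length = P₁.length := by rw [← hR, Walk.length_reverse]
  rw [Walk.length_cons] at hlen
  cases P₁' with
  | nil => simp at hlen'; omega
  | @cons _ y _ huy P₂ =>
  rw [Walk.cons_isPath_iff] at hP₁'
  have hyz : y ≠ z := by
    rintro rfl
    have := Walk.length_eq_zero_iff.mpr (Walk.isPath_iff_nil.mp hP₁'.1)
    rw [Walk.length_cons] at hlen'
    omega
  have hwP₂ : w ∉ P₂.support := fun h => hwP (by rw [Walk.support_cons]; exact .tail _ h)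
  set F := G.deleteEdges {s(u, v), s(v, w), s(u, y), s(w, z)} with hF
  have hFadj : ∀ a b, F.Adj a b ↔ G.Adj a b ∧
      s(a, b) ∉ ({s(u, v), s(v, w), s(u, y), s(w, z)} : Set (Sym2 V)) := fun a b => deleteEdges_adj
  have hFT₂ : F ≤ T₂ := fun a b h => by
    rw [hFadj] at h
    rw [hT₂adj]
    simp only [Set.mem_insert_iff, Set.mem_singleton_iff, not_or] at h
    exact ⟨h.1, h.2.2.1, h.2.1⟩
  have hFT : F ≤ T := hFT₂.trans (deleteEdges_le _)
  have hreach : F.Reachable y z := by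
    refine ⟨P₂.transfer F fun e he => ?_⟩
    induction e with | h a b =>
    have hab := hT₂adj.mp (P₂.adj_of_mem_edges he)
    rw [mem_edgeSet, hFadj]
    refine ⟨hab.1, ?_⟩
    simp only [Set.mem_insert_iff, Set.mem_singleton_iff, not_or]
    refine ⟨hab.2.2, hab.2.1, fun h => ?_, fun h => ?_⟩
    · rw [h] at he; exact hP₁'.2 (P₂.fst_mem_support_of_mem_edges he)
    · rw [h] at he; exact hwP₂ (P₂.fst_mem_support_of_mem_edges he)
  have huyT : T.Adj u y := (deleteEdges_le _ : T₂ ≤ T) huy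
  have hwzT : T.Adj w z := (deleteEdges_le _ : T₂ ≤ T) hwz
  have hFuy : F ≤ T.deleteEdges {s(u, y)} := fun a b h => by
    rw [deleteEdges_adj]
    refine ⟨hFT h, fun h' => ((hFadj a b).mp h).2 ?_⟩
    rw [Set.mem_singleton_iff.mp h']; simp
  have hFwz : F ≤ T.deleteEdges {s(w, z)} := fun a b h => by
    rw [deleteEdges_adj]
    refine ⟨hFT h, fun h' => ((hFadj a b).mp h).2 ?_⟩
    rw [Set.mem_singleton_iff.mp h']; simp
  have nuv : ¬ T₂.Reachable u v := hbr huv'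
  have hwT₂ : T₂.Reachable w u := hwz.reachable.trans ⟨P₁⟩
  have huwne : u ≠ z := fun h => hP₁'.2 (h ▸ P₂.end_mem_support)
  refine ⟨y, z, F, hFadj, hTtree.isAcyclic.anti hFT, (hT₂adj.mp huy).1, (hT₂adj.mp hwz).1, hyz,
    hreach, fun h => nuv (h.mono hFT₂), fun h => ?_, fun h => ?_, fun h => hbr huyT (h.mono hFuy),
    fun h => nuv (huy.reachable.trans (h.mono hFT₂).symm), fun h =>
      hbr hwzT ((h.trans hreach).mono hFwz), ?_⟩
  -- Without uy, the vertex w still reaches y through z, so u must not reach w.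
  · have h1 : (T.deleteEdges {s(u, y)}).Adj w z := by
      rw [deleteEdges_adj]
      refine ⟨hwzT, fun h' => ?_⟩
      rcases Sym2.mem_iff.mp (Set.mem_singleton_iff.mp h' ▸ Sym2.mem_mk_left u y :
        u ∈ s(w, z)) with h | h
      · exact huw h
      · exact huwne h
    exact hbr huyT ((h.mono hFuy).trans (h1.reachable.trans (hreach.symm.mono hFuy)))
  · exact nuv (((h.mono hFT₂).trans hwT₂).symm)
  · intro x
    obtain ⟨q⟩ := hTtree.1.preconnected u x
    have hS : ∀ a b, T.Adj a b → ¬ F.Adj a b → b ∈ ({u, v, w, y, z} : Set V) := by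
      intro a b hab hn
      have h : s(a, b) ∈ ({s(u, v), s(v, w), s(u, y), s(w, z)} : Set (Sym2 V)) := by
        by_contra h
        exact hn ((hFadj a b).mpr ⟨(deleteEdges_adj.mp hab).1, h⟩)
      have hb : b ∈ s(a, b) := Sym2.mem_mk_right a b
      rcases h with h | h | h | h <;> rw [h] at hb <;> rcases Sym2.mem_iff.mp hb with rfl | rfl <;>
        simp
    obtain ⟨t, ht, h⟩ := exists_reachable_of_walk (F := F) (S := {u, v, w, y, z}) hS q (by simp)
    simp only [Set.mem_insert_iff, Set.mem_singleton_iff] at ht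
    rcases ht with rfl | rfl | rfl | rfl | rfl
    · exact .inl h
    · exact .inr (.inl h)
    · exact .inr (.inr (.inl h))
    · exact .inr (.inr (.inr h))
    · exact .inr (.inr (.inr (h.trans hreach.symm)))

end SignlessUnicyclic

/-! ### Signless Laplacians of two-coloured graphs and their principal submatrices -/

namespace SignlessUnicyclic
open SimpleGraph Matrix

section SignlessMatrix
variable {V : Type*} [Fintype V] [DecidableEq V]

/-- The signless Laplacian matrix with real entries. -/
def realSignless (G : SimpleGraph V) [DecidableRel G.Adj] : Matrix V V ℝ :=
  G.degMatrix ℝ + G.adjMatrix ℝ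

variable (G F : SimpleGraph V) [DecidableRel G.Adj] [DecidableRel F.Adj]

lemma map_signlessLaplacian :
    (signlessLaplacian G).map (Int.castRingHom ℝ) = realSignless G := by
  ext i j
  by_cases h : i = j
  · subst h; simp [signlessLaplacian, realSignless, degMatrix]
  · by_cases h' : G.Adj i j <;> simp [signlessLaplacian, realSignless, degMatrix, h, h']

lemma realSignless_of_ne {a b : V} (h : a ≠ b) :
    realSignless G a b = if G.Adj a b then 1 else 0 := by
  simp [realSignless, degMatrix, h, adjMatrix_apply]

lemma realSignless_self (a : V) : realSignless G a a = ∑ x, if G.Adj x a then 1 else 0 := by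
  rw [realSignless, Matrix.add_apply, degMatrix, diagonal_apply_eq, adjMatrix_apply,
    if_neg G.irrefl, add_zero, degree_eq_sum_if_adj]
  simp only [G.adj_comm]

lemma realSignless_isSymm : (realSignless G).IsSymm :=
  (G.isSymm_degMatrix (R := ℝ)).add (G.isSymm_adjMatrix (α := ℝ))

variable {F} {σ : V → ℝ}

/-- Opposite signs along every edge turn the adjacency matrix into its negative and leave the
degrees alone. -/
lemma realSignless_eq_conj (hσ : ∀ a, σ a ^ 2 = 1) (hF : ∀ a b, F.Adj a b → σ a = -σ b) :
    realSignless F = diagonal σ * F.lapMatrix ℝ * diagonal σ := by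
  ext a b
  rw [mul_diagonal, diagonal_mul]
  by_cases h : a = b
  · subst h
    simp only [realSignless, lapMatrix, Matrix.add_apply, Matrix.sub_apply, degMatrix,
      diagonal_apply_eq, adjMatrix_apply, F.irrefl, if_false, add_zero, sub_zero]
    linear_combination -(F.degree a : ℝ) * hσ a
  · rw [realSignless_of_ne F h, lapMatrix, Matrix.sub_apply, degMatrix, diagonal_apply_ne _ h,
      adjMatrix_apply]
    split_ifs with h'
    · rw [hF a b h']; linear_combination -hσ b
    · ring

lemma realSignless_posSemidef (hσ : ∀ a, σ a ^ 2 = 1) (hF : ∀ a b, F.Adj a b → σ a = -σ b) :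
    (realSignless F).PosSemidef := by
  have := (posSemidef_lapMatrix ℝ F).conjTranspose_mul_mul_same (diagonal σ)
  rwa [diagonal_conjTranspose, star_trivial, ← realSignless_eq_conj hσ hF] at this

lemma realSignless_mulVec_eq_zero (hσ : ∀ a, σ a ^ 2 = 1) (hF : ∀ a b, F.Adj a b → σ a = -σ b) :
    realSignless F *ᵥ σ = 0 := by
  rw [realSignless_eq_conj hσ hF, ← mulVec_mulVec, ← mulVec_mulVec,
    show diagonal σ *ᵥ σ = fun _ => 1 from _root_.funext fun a => by
      rw [mulVec_diagonal, ← sq, hσ], lapMatrix_mulVec_const_eq_zero, mulVec_zero]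

/-- If g is in the kernel of Q(F), then σ g is in the kernel of the Laplacian and so constant on
components. -/
lemma mul_eq_mul_of_reachable (hσ : ∀ a, σ a ^ 2 = 1) (hF : ∀ a b, F.Adj a b → σ a = -σ b)
    {g : V → ℝ} (hg : realSignless F *ᵥ g = 0) {a b : V} (h : F.Reachable a b) :
    g a * σ b = g b * σ a := by
  have h1 : F.lapMatrix ℝ *ᵥ (fun a => σ a * g a) = 0 := by
    have h2 : diagonal σ *ᵥ (realSignless F *ᵥ g) = 0 := by rw [hg, mulVec_zero]
    rw [realSignless_eq_conj hσ hF, ← mulVec_mulVec, ← mulVec_mulVec, mulVec_mulVec,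
      diagonal_mul_diagonal] at h2
    simp only [← sq, hσ] at h2
    rw [diagonal_one, one_mulVec] at h2
    rwa [show diagonal σ *ᵥ g = fun a => σ a * g a from
      _root_.funext fun a => mulVec_diagonal σ g a] at h2
  have h3 := (F.lapMatrix_mulVec_eq_zero_iff_forall_reachable).mp h1 a b h
  linear_combination σ a * σ b * h3 - σ b * g a * hσ a + σ a * g b * hσ b

end SignlessMatrix

section Extend
variable {V ι : Type*} [Fintype V] [Fintype ι] {M : Matrix V V ℝ} {e : ι → V}

lemma submatrix_mulVec_extend (he : e.Injective) (x : ι → ℝ) (i : ι) :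
    (M.submatrix e e *ᵥ x) i = (M *ᵥ Function.extend e x 0) (e i) := by
  refine Fintype.sum_of_injective e he _ _ (fun j hj => ?_) fun j => ?_
  · rw [Function.extend_apply' _ _ _ hj, Pi.zero_apply, mul_zero]
  · simp only [he.extend_apply, submatrix_apply]

lemma extend_dotProduct (he : e.Injective) (x : ι → ℝ) (f : V → ℝ) :
    Function.extend e x 0 ⬝ᵥ f = x ⬝ᵥ (fun i => f (e i)) := by
  refine (Fintype.sum_of_injective e he _ _ (fun j hj => ?_) fun j => ?_).symm
  · rw [Function.extend_apply' _ _ _ hj, Pi.zero_apply, zero_mul]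
  · rw [he.extend_apply]

/-- Extension by zero preserves the value of the quadratic form, and for semidefinite M a vector of
value zero is in the kernel. -/
lemma mulVec_extend_eq_zero (hM : M.PosSemidef) (he : e.Injective) {x : ι → ℝ}
    (hx : M.submatrix e e *ᵥ x = 0) : M *ᵥ Function.extend e x 0 = 0 := by
  classical
  rw [← hM.dotProduct_mulVec_zero_iff, star_trivial, extend_dotProduct he,
    show (fun i => (M *ᵥ Function.extend e x 0) (e i)) = M.submatrix e e *ᵥ x from
      _root_.funext fun i => (submatrix_mulVec_extend he x i).symm, hx, dotProduct_zero]

variable [DecidableEq ι]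

/-- A kernel vector of the principal submatrix, extended by zero, is a kernel vector of M. -/
lemma posDef_submatrix (hM : M.PosSemidef) (he : e.Injective)
    (h : ∀ g, M *ᵥ g = 0 → (∀ a ∉ Set.range e, g a = 0) → ∀ i, g (e i) = 0) :
    (M.submatrix e e).PosDef := by
  rw [(hM.submatrix e).posDef_iff_det_ne_zero]
  intro hdet
  obtain ⟨x, hx0, hx⟩ := exists_mulVec_eq_zero_iff.mpr hdet
  refine hx0 (_root_.funext fun i => ?_)
  have := h _ (mulVec_extend_eq_zero hM he hx) (fun a ha => Function.extend_apply' _ _ _ ha) i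
  rwa [he.extend_apply] at this

omit [DecidableEq ι] in
lemma sum_eq_add_sum_of_injective (he : e.Injective) {ρ : V} (hρ : ρ ∉ Set.range e) {f : V → ℝ}
    (hf : ∀ a ∉ Set.range e, a ≠ ρ → f a = 0) : ∑ a, f a = f ρ + ∑ i, f (e i) := by
  classical
  have hinj : (fun o : Option ι => o.elim ρ e).Injective := by
    rintro (_ | i) (_ | j) h
    · rfl
    · exact absurd ⟨j, h.symm⟩ hρ
    · exact absurd ⟨i, h⟩ hρ
    · exact congrArg some (he h)
  rw [← Fintype.sum_of_injective _ hinj (fun o : Option ι => f (o.elim ρ e)) f ?_ fun _ => rfl,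
    Fintype.sum_option]
  · rfl
  · intro a ha
    refine hf a (fun ⟨i, hi⟩ => ha ⟨some i, hi⟩) fun h => ha ⟨none, h.symm⟩

end Extend

lemma sum_eq_add_sum_rest {V : Type*} [Fintype V] [DecidableEq V] {u v w : V} (huv : u ≠ v)
    (huw : u ≠ w) (hvw : v ≠ w) (f : V → ℝ) :
    ∑ x, f x = f u + f v + f w + ∑ r : Rest u v w, f r := by
  rw [← (threeSumRest huv huw hvw).sum_comp, Fintype.sum_sum_type, Fin.sum_univ_three]
  rfl

lemma exists_sign_of_isAcyclic {V : Type*} {F : SimpleGraph V} (hF : F.IsAcyclic) :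
    ∃ σ : V → ℝ, (∀ a, σ a ^ 2 = 1) ∧ ∀ a b, F.Adj a b → σ a = -σ b := by
  obtain ⟨C⟩ := hF.colorable_two
  refine ⟨fun a => if C a = 0 then 1 else -1, fun a => ?_, fun a b h => ?_⟩
  · simp only; split_ifs <;> norm_num
  · have := C.valid h
    rcases Fin.exists_fin_two.mp ⟨C a, rfl⟩ with h1 | h1 <;>
      rcases Fin.exists_fin_two.mp ⟨C b, rfl⟩ with h2 | h2 <;> simp_all

end SignlessUnicyclic

/-! ### Adjacency in the graph, the forest and the transformed graph -/

namespace SignlessUnicyclic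
open SimpleGraph Matrix

variable {V : Type*}

/-- A graph that is split by `IsSplit`, with pendent vertices `u'`, `v'` and `w'` at `u`, `v` and
`w`. -/
structure IsPendentSplit (G F : SimpleGraph V) (u v w y z u' v' w' : V) : Prop extends
    IsSplit G F u v w y z where
  adj_uv : G.Adj u v
  adj_vw : G.Adj v w
  adj_u' : ∀ x, G.Adj u' x ↔ x = u
  adj_v' : ∀ x, G.Adj v' x ↔ x = v
  adj_w' : ∀ x, G.Adj w' x ↔ x = w

namespace IsSplit
variable {G F : SimpleGraph V} {u v w y z : V} (S : IsSplit G F u v w y z)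
include S

lemma u_ne_v : u ≠ v := fun h => S.not_uv (h ▸ .refl _)
lemma u_ne_w : u ≠ w := fun h => S.not_uw (h ▸ .refl _)
lemma v_ne_w : v ≠ w := fun h => S.not_vw (h ▸ .refl _)
lemma y_ne_u : y ≠ u := fun h => S.not_uy (h ▸ .refl _)
lemma y_ne_v : y ≠ v := fun h => S.not_vy (h ▸ .refl _)
lemma y_ne_w : y ≠ w := fun h => S.not_wy (h ▸ .refl _)
lemma z_ne_u : z ≠ u := fun h => S.not_uy (h ▸ S.reach_yz.symm)
lemma z_ne_v : z ≠ v := fun h => S.not_vy (h ▸ S.reach_yz.symm)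
lemma z_ne_w : z ≠ w := fun h => S.not_wy (h ▸ S.reach_yz.symm)

lemma adj_iff' (a b : V) : F.Adj a b ↔ G.Adj a b ∧
    ¬ (a = u ∧ b = v ∨ a = v ∧ b = u ∨ a = v ∧ b = w ∨ a = w ∧ b = v ∨ a = u ∧ b = y ∨
      a = y ∧ b = u ∨ a = w ∧ b = z ∨ a = z ∧ b = w) := by
  rw [S.adj_iff]
  simp only [Set.mem_insert_iff, Set.mem_singleton_iff, Sym2.eq_iff, or_assoc]

lemma not_adj_uw : ¬ G.Adj u w := fun h => by
  refine S.not_uw ((S.adj_iff' u w).mpr ⟨h, ?_⟩).reachable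
  have := S.u_ne_v; have := S.u_ne_w; have := S.v_ne_w; have := S.y_ne_w; have := S.z_ne_u
  have := S.y_ne_u
  grind

variable (r s : Rest u v w)

lemma adj_rest : G.Adj r s ↔ F.Adj r s := by
  obtain ⟨r, hr⟩ := r
  obtain ⟨s, hs⟩ := s
  rw [S.adj_iff']
  grind

lemma adj_rest_u : G.Adj r u ↔ F.Adj r u ∨ (r : V) = y := by
  obtain ⟨r, hr⟩ := r
  rw [S.adj_iff']
  have := S.u_ne_v; have := S.u_ne_w; have := S.adj_uy.symm
  grind

lemma adj_rest_v : G.Adj r v ↔ F.Adj r v := by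
  obtain ⟨r, hr⟩ := r
  rw [S.adj_iff']
  have := S.u_ne_v; have := S.v_ne_w; have := S.y_ne_v; have := S.z_ne_v
  grind

lemma adj_rest_w : G.Adj r w ↔ F.Adj r w ∨ (r : V) = z := by
  obtain ⟨r, hr⟩ := r
  rw [S.adj_iff']
  have := S.v_ne_w; have := S.u_ne_w; have := S.adj_wz.symm
  grind

/-- A common neighbour would connect two components of F. With its two companions this ensures that
edges moved to u never coincide, so degrees off u, v, w are preserved. -/
lemma not_adj_v_of_adj_u (h : G.Adj r u) : ¬ G.Adj r v := fun h' => by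
  rw [S.adj_rest_u] at h
  rw [S.adj_rest_v] at h'
  rcases h with h | h
  · exact S.not_uv (h.symm.reachable.trans h'.reachable)
  · rw [h] at h'; exact S.not_vy h'.symm.reachable

lemma not_adj_w_of_adj_u (h : G.Adj r u) : ¬ G.Adj r w := fun h' => by
  rw [S.adj_rest_u] at h
  rw [S.adj_rest_w] at h'
  rcases h with h | h <;> rcases h' with h' | h'
  · exact S.not_uw (h.symm.reachable.trans h'.reachable)
  · rw [h'] at h; exact S.not_uy (h.symm.reachable.trans S.reach_yz.symm)
  · rw [h] at h'; exact S.not_wy h'.symm.reachable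
  · exact S.ne (h.symm.trans h')

lemma not_adj_w_of_adj_v (h : G.Adj r v) : ¬ G.Adj r w := fun h' => by
  rw [S.adj_rest_v] at h
  rw [S.adj_rest_w] at h'
  rcases h' with h' | h'
  · exact S.not_vw (h.symm.reachable.trans h'.reachable)
  · rw [h'] at h; exact S.not_vy (h.symm.reachable.trans S.reach_yz.symm)

lemma exists_adj_y : ∃ x, F.Adj y x := by
  obtain ⟨p⟩ := S.reach_yz
  cases p with
  | nil => exact absurd rfl S.ne
  | cons h _ => exact ⟨_, h⟩

lemma exists_adj_z : ∃ x, F.Adj z x := by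
  obtain ⟨p⟩ := S.reach_yz.symm
  cases p with
  | nil => exact absurd rfl S.ne
  | cons h _ => exact ⟨_, h⟩

/-- Reaching z ≠ y inside F, the vertex y has a neighbour in the link, whereas the only neighbour of
a is one of u, v, w. -/
lemma ne_y_of_pendent {a b : V} (hb : b = u ∨ b = v ∨ b = w) (ha : ∀ x, G.Adj a x ↔ x = b) :
    a ≠ y := by
  rintro rfl
  obtain ⟨x, hx⟩ := S.exists_adj_y
  obtain rfl := (ha x).mp ((S.adj_iff' _ _).mp hx).1
  rcases hb with rfl | rfl | rfl
  · exact S.not_uy hx.symm.reachable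
  · exact S.not_vy hx.symm.reachable
  · exact S.not_wy hx.symm.reachable

lemma ne_z_of_pendent {a b : V} (hb : b = u ∨ b = v ∨ b = w) (ha : ∀ x, G.Adj a x ↔ x = b) :
    a ≠ z := by
  rintro rfl
  obtain ⟨x, hx⟩ := S.exists_adj_z
  obtain rfl := (ha x).mp ((S.adj_iff' _ _).mp hx).1
  rcases hb with rfl | rfl | rfl
  · exact S.not_uy (hx.symm.reachable.trans S.reach_yz.symm)
  · exact S.not_vy (hx.symm.reachable.trans S.reach_yz.symm)
  · exact S.not_wy (hx.symm.reachable.trans S.reach_yz.symm)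

/-- On the rest, the signless Laplacian matrices of `G` and `F` differ at `y` and `z` only. -/
lemma realSignless_rest [Fintype V] [DecidableEq V] [DecidableRel G.Adj] [DecidableRel F.Adj] :
    realSignless G r s = realSignless F r s + (if (r : V) = y ∧ (s : V) = y then 1 else 0) +
      if (r : V) = z ∧ (s : V) = z then 1 else 0 := by
  by_cases h : r = s
  · subst h
    rw [realSignless_self, realSignless_self, sum_eq_add_sum_rest S.u_ne_v S.u_ne_w S.v_ne_w,
      sum_eq_add_sum_rest S.u_ne_v S.u_ne_w S.v_ne_w]
    simp only [S.adj_rest, and_self]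
    have e1 : (if G.Adj u r then (1 : ℝ) else 0) =
        (if F.Adj u r then 1 else 0) + if (r : V) = y then 1 else 0 := by
      have := S.adj_rest_u r
      simp only [G.adj_comm u, F.adj_comm u]
      by_cases hy : (r : V) = y
      · have : ¬ F.Adj r u := fun h => S.not_uy (hy ▸ h.symm.reachable)
        simp_all
      · simp_all
    have e2 : (if G.Adj v r then (1 : ℝ) else 0) = if F.Adj v r then 1 else 0 := by
      have := S.adj_rest_v r
      simp only [G.adj_comm v, F.adj_comm v]
      simp_all
    have e3 : (if G.Adj w r then (1 : ℝ) else 0) =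
        (if F.Adj w r then 1 else 0) + if (r : V) = z then 1 else 0 := by
      have := S.adj_rest_w r
      simp only [G.adj_comm w, F.adj_comm w]
      by_cases hz : (r : V) = z
      · have : ¬ F.Adj r w := fun h => S.not_wy ((hz ▸ h.symm.reachable).trans S.reach_yz.symm)
        simp_all
      · simp_all
    rw [e1, e2, e3]
    ring
  · have h' : (r : V) ≠ s := fun e => h (Subtype.ext e)
    rw [realSignless_of_ne G h', realSignless_of_ne F h', if_neg (c := (r : V) = y ∧ (s : V) = y),
      if_neg (c := (r : V) = z ∧ (s : V) = z)]
    · simp only [S.adj_rest, add_zero]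
    · exact fun e => h' (e.1.trans e.2.symm)
    · exact fun e => h' (e.1.trans e.2.symm)

end IsSplit

namespace IsPendentSplit
variable {G F : SimpleGraph V} {u v w y z u' v' w' : V}
  (S : IsPendentSplit G F u v w y z u' v' w')
include S

lemma u'_rest : u' ≠ u ∧ u' ≠ v ∧ u' ≠ w := by
  refine ⟨?_, ?_, ?_⟩ <;> rintro rfl
  · exact G.irrefl ((S.adj_u' _).mpr rfl)
  · exact S.u_ne_w ((S.adj_u' _).mp S.adj_vw).symm
  · exact S.u_ne_v ((S.adj_u' _).mp S.adj_vw.symm).symm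

lemma v'_rest : v' ≠ u ∧ v' ≠ v ∧ v' ≠ w := by
  refine ⟨?_, ?_, ?_⟩ <;> rintro rfl
  · exact S.y_ne_v ((S.adj_v' _).mp S.adj_uy)
  · exact G.irrefl ((S.adj_v' _).mpr rfl)
  · exact S.z_ne_v ((S.adj_v' _).mp S.adj_wz)

lemma w'_rest : w' ≠ u ∧ w' ≠ v ∧ w' ≠ w := by
  refine ⟨?_, ?_, ?_⟩ <;> rintro rfl
  · exact S.v_ne_w ((S.adj_w' _).mp S.adj_uv)
  · exact S.u_ne_w ((S.adj_w' _).mp S.adj_uv.symm)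
  · exact G.irrefl ((S.adj_w' _).mpr rfl)

lemma u'_ne_v' : u' ≠ v' := by
  rintro rfl
  exact S.u_ne_v ((S.adj_v' _).mp ((S.adj_u' _).mpr rfl))

lemma u'_ne_w' : u' ≠ w' := by
  rintro rfl
  exact S.u_ne_w ((S.adj_w' _).mp ((S.adj_u' _).mpr rfl))

lemma v'_ne_w' : v' ≠ w' := by
  rintro rfl
  exact S.v_ne_w ((S.adj_w' _).mp ((S.adj_v' _).mpr rfl))

omit S in
lemma shortenCycle_adj (a b : V) : (shortenCycle G u v w v' w').Adj a b ↔
    (G.Adj a b ∧ ¬ ((((a = v ∧ b = w ∨ a = w ∧ b = v) ∨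
        (a = w ∧ G.Adj w b ∧ ¬(b = v ∨ b = w') ∨ b = w ∧ G.Adj w a ∧ ¬(a = v ∨ a = w'))) ∨
        (a = v ∧ G.Adj v b ∧ ¬(b = u ∨ b = w ∨ b = v') ∨
          b = v ∧ G.Adj v a ∧ ¬(a = u ∨ a = w ∨ a = v'))))) ∨
      (((a = u ∧ b = w ∨ a = w ∧ b = u) ∨
        (a = u ∧ G.Adj w b ∧ ¬(b = v ∨ b = w') ∨ b = u ∧ G.Adj w a ∧ ¬(a = v ∨ a = w'))) ∨
        (a = u ∧ G.Adj v b ∧ ¬(b = u ∨ b = w ∨ b = v') ∨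
          b = u ∧ G.Adj v a ∧ ¬(a = u ∨ a = w ∨ a = v'))) ∧ a ≠ b := by
  have himg : ∀ (c : V) (T : Set V), s(a, b) ∈ (fun x => s(c, x)) '' T ↔
      a = c ∧ b ∈ T ∨ b = c ∧ a ∈ T := fun c T => by
    simp only [Set.mem_image, Sym2.eq_iff]
    grind
  simp only [shortenCycle, sup_adj, deleteEdges_adj, fromEdgeSet_adj, Set.mem_union, himg,
    Set.mem_singleton_iff, Sym2.eq_iff, Set.mem_sdiff, Set.mem_insert_iff, mem_neighborSet]

lemma adj'_uv : (shortenCycle G u v w v' w').Adj u v := by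
  rw [shortenCycle_adj]
  have := S.u_ne_v; have := S.u_ne_w; have := S.v_ne_w; have := S.adj_uv
  grind

lemma not_adj'_vw : ¬ (shortenCycle G u v w v' w').Adj v w := by
  rw [shortenCycle_adj]
  have := S.u_ne_v; have := S.u_ne_w; have := S.v_ne_w; have := S.adj_vw
  grind

lemma adj'_uw : (shortenCycle G u v w v' w').Adj u w := by
  rw [shortenCycle_adj]
  have := S.u_ne_w
  grind

variable (r s : Rest u v w)

omit S in
lemma adj'_rest : (shortenCycle G u v w v' w').Adj r s ↔ G.Adj r s := by
  obtain ⟨r, hr⟩ := r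
  obtain ⟨s, hs⟩ := s
  rw [shortenCycle_adj]
  grind

lemma adj'_rest_u : (shortenCycle G u v w v' w').Adj r u ↔
    G.Adj r u ∨ G.Adj r v ∧ (r : V) ≠ v' ∨ G.Adj r w ∧ (r : V) ≠ w' := by
  obtain ⟨r, hr, hr', hr''⟩ := r
  rw [shortenCycle_adj, G.adj_comm v, G.adj_comm w]
  simp only [hr, hr', hr'', S.u_ne_v, S.u_ne_w, false_and, and_false, true_and, or_false,
    false_or, not_false_iff, and_true, ne_eq, not_or]
  tauto

lemma adj'_rest_v : (shortenCycle G u v w v' w').Adj r v ↔ (r : V) = v' := by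
  have h : (r : V) = v' → G.Adj r v := fun h => h ▸ (S.adj_v' v).mpr rfl
  obtain ⟨r, hr, hr', hr''⟩ := r
  rw [shortenCycle_adj, G.adj_comm v]
  simp only [hr, hr', hr'', S.v_ne_w, S.u_ne_v.symm, false_and, and_false, true_and, or_false,
    false_or, and_true] at h ⊢
  tauto

lemma adj'_rest_w : (shortenCycle G u v w v' w').Adj r w ↔ (r : V) = w' := by
  have h : (r : V) = w' → G.Adj r w := fun h => h ▸ (S.adj_w' w).mpr rfl
  obtain ⟨r, hr, hr', hr''⟩ := r
  rw [shortenCycle_adj, G.adj_comm w]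
  simp only [hr, hr', hr'', S.v_ne_w.symm, S.u_ne_w.symm, false_and, and_false, true_and, or_false,
    false_or, and_true] at h ⊢
  tauto

end IsPendentSplit
end SignlessUnicyclic

/-! ### The blocks of the remaining vertices -/

namespace SignlessUnicyclic
open SimpleGraph Matrix

namespace IsPendentSplit
variable {V : Type*} {G F : SimpleGraph V} {u v w y z u' v' w' : V}

open Classical in
/-- The labels of the blocks into which the rest falls. -/
noncomputable def label (F : SimpleGraph V) (u v w u' v' w' : V) (r : Rest u v w) : Fin 7 :=
  if (r : V) = u' then 0 else if (r : V) = v' then 1 else if (r : V) = w' then 2 else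
    if F.Reachable r u then 3 else if F.Reachable r v then 4 else if F.Reachable r w then 5 else 6

variable (S : IsPendentSplit G F u v w y z u' v' w')
include S

/-- The three pendent vertices. -/
def pendents : Fin 3 → Rest u v w := ![⟨u', S.u'_rest⟩, ⟨v', S.v'_rest⟩, ⟨w', S.w'_rest⟩]

variable (r s : Rest u v w)

omit S in
lemma label_eq_zero : label F u v w u' v' w' r = 0 ↔ (r : V) = u' := by
  unfold label
  split_ifs <;> simp_all

lemma label_eq_one : label F u v w u' v' w' r = 1 ↔ (r : V) = v' := by
  have := S.u'_ne_v'
  unfold label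
  split_ifs <;> simp_all

lemma label_eq_two : label F u v w u' v' w' r = 2 ↔ (r : V) = w' := by
  have := S.u'_ne_w'
  have := S.v'_ne_w'
  unfold label
  split_ifs <;> simp_all

omit S in
lemma label_eq_three : label F u v w u' v' w' r = 3 ↔
    ((r : V) ≠ u' ∧ (r : V) ≠ v' ∧ (r : V) ≠ w') ∧ F.Reachable r u := by
  unfold label
  split_ifs <;> simp_all

lemma label_eq_four : label F u v w u' v' w' r = 4 ↔
    ((r : V) ≠ u' ∧ (r : V) ≠ v' ∧ (r : V) ≠ w') ∧ F.Reachable r v := by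
  have : F.Reachable r v → ¬ F.Reachable r u := fun h h' => S.not_uv (h'.symm.trans h)
  unfold label
  split_ifs <;> simp_all

lemma label_eq_five : label F u v w u' v' w' r = 5 ↔
    ((r : V) ≠ u' ∧ (r : V) ≠ v' ∧ (r : V) ≠ w') ∧ F.Reachable r w := by
  have : F.Reachable r w → ¬ F.Reachable r u := fun h h' => S.not_uw (h'.symm.trans h)
  have : F.Reachable r w → ¬ F.Reachable r v := fun h h' => S.not_vw (h'.symm.trans h)
  unfold label
  split_ifs <;> simp_all

lemma label_eq_six : label F u v w u' v' w' r = 6 ↔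
    ((r : V) ≠ u' ∧ (r : V) ≠ v' ∧ (r : V) ≠ w') ∧ F.Reachable r y := by
  have : F.Reachable r y → ¬ F.Reachable r u := fun h h' => S.not_uy (h'.symm.trans h)
  have : F.Reachable r y → ¬ F.Reachable r v := fun h h' => S.not_vy (h'.symm.trans h)
  have : F.Reachable r y → ¬ F.Reachable r w := fun h h' => S.not_wy (h'.symm.trans h)
  have := S.cover r
  unfold label
  split_ifs <;> simp_all

lemma not_pendent_of_adj {a : V} (h : F.Adj r a) (ha : a ≠ u ∧ a ≠ v ∧ a ≠ w) :
    (r : V) ≠ u' ∧ (r : V) ≠ v' ∧ (r : V) ≠ w' := by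
  have h := ((S.adj_iff' _ _).mp h).1
  refine ⟨?_, ?_, ?_⟩ <;> intro e <;> rw [e] at h
  · exact ha.1 ((S.adj_u' a).mp h)
  · exact ha.2.1 ((S.adj_v' a).mp h)
  · exact ha.2.2 ((S.adj_w' a).mp h)

/-- Neither end is u', v' or w', whose only neighbours are u, v, w; the label is then determined by
the component in F. -/
lemma label_eq_of_adj (h : F.Adj r s) :
    label F u v w u' v' w' r = label F u v w u' v' w' s := by
  have h1 := S.not_pendent_of_adj r h s.2
  have h2 := S.not_pendent_of_adj s h.symm r.2
  have h3 : F.Reachable r = F.Reachable s := _root_.funext fun c =>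
    propext ⟨h.symm.reachable.trans, h.reachable.trans⟩
  simp only [label, h1, h2, if_false]
  rw [h3]

lemma y_rest : y ≠ u ∧ y ≠ v ∧ y ≠ w := ⟨S.y_ne_u, S.y_ne_v, S.y_ne_w⟩
lemma z_rest : z ≠ u ∧ z ≠ v ∧ z ≠ w := ⟨S.z_ne_u, S.z_ne_v, S.z_ne_w⟩

lemma label_y : label F u v w u' v' w' ⟨y, S.y_rest⟩ = 6 := by
  rw [S.label_eq_six]
  exact ⟨⟨(S.ne_y_of_pendent (.inl rfl) S.adj_u').symm,
    (S.ne_y_of_pendent (.inr (.inl rfl)) S.adj_v').symm,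
    (S.ne_y_of_pendent (.inr (.inr rfl)) S.adj_w').symm⟩, .refl _⟩

lemma label_z : label F u v w u' v' w' ⟨z, S.z_rest⟩ = 6 := by
  rw [S.label_eq_six]
  exact ⟨⟨(S.ne_z_of_pendent (.inl rfl) S.adj_u').symm,
    (S.ne_z_of_pendent (.inr (.inl rfl)) S.adj_v').symm,
    (S.ne_z_of_pendent (.inr (.inr rfl)) S.adj_w').symm⟩, S.reach_yz.symm⟩

lemma adj_pendent_u (h : F.Adj r u) (h3 : label F u v w u' v' w' r ≠ 3) : (r : V) = u' := by
  rw [Ne, label_eq_three, not_and'] at h3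
  have := h3 h.reachable
  by_contra hu
  have hG := (S.adj_rest_u r).mpr (.inl h)
  refine this ⟨hu, fun e => ?_, fun e => ?_⟩ <;> rw [e] at hG
  · exact S.u_ne_v ((S.adj_v' _).mp hG)
  · exact S.u_ne_w ((S.adj_w' _).mp hG)

lemma adj_pendent_v (h : F.Adj r v) (h4 : label F u v w u' v' w' r ≠ 4) : (r : V) = v' := by
  rw [Ne, S.label_eq_four, not_and'] at h4
  have := h4 h.reachable
  by_contra hv
  have hG := (S.adj_rest_v r).mpr h
  refine this ⟨fun e => ?_, hv, fun e => ?_⟩ <;> rw [e] at hG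
  · exact S.u_ne_v ((S.adj_u' _).mp hG).symm
  · exact S.v_ne_w ((S.adj_w' _).mp hG)

lemma adj_pendent_w (h : F.Adj r w) (h5 : label F u v w u' v' w' r ≠ 5) : (r : V) = w' := by
  rw [Ne, S.label_eq_five, not_and'] at h5
  have := h5 h.reachable
  by_contra hw
  have hG := (S.adj_rest_w r).mpr (.inl h)
  refine this ⟨fun e => ?_, fun e => ?_, hw⟩ <;> rw [e] at hG
  · exact S.u_ne_w ((S.adj_u' _).mp hG).symm
  · exact S.v_ne_w ((S.adj_v' _).mp hG).symm

section RealSignless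
variable [Fintype V] [DecidableEq V] [DecidableRel G.Adj] [DecidableRel F.Adj]

lemma realSignless_toSquareBlock {k : Fin 7} (hk : k ≠ 6) :
    ((realSignless G).submatrix Subtype.val Subtype.val :
      Matrix (Rest u v w) (Rest u v w) ℝ).toSquareBlock (label F u v w u' v' w') k =
    (realSignless F).submatrix (fun r : {r // label F u v w u' v' w' r = k} => (r.1 : V))
      (fun r : {r // label F u v w u' v' w' r = k} => (r.1 : V)) := by
  ext r s
  have hy : (r.1 : V) ≠ y := fun e => hk (by
    rw [← r.2, ← S.label_y]; exact congrArg _ (Subtype.ext e))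
  have hz : (r.1 : V) ≠ z := fun e => hk (by
    rw [← r.2, ← S.label_z]; exact congrArg _ (Subtype.ext e))
  simp only [toSquareBlock_def, of_apply, submatrix_apply, S.realSignless_rest, hy, hz, false_and,
    if_false, add_zero]

/-- In row r of Q(F) σ = 0 split off the entry at the root ρ; every other neighbour of r lies in the
block. -/
lemma realSignless_mulVec_branch {σ : V → ℝ} (hσ : ∀ a, σ a ^ 2 = 1)
    (hF : ∀ a b, F.Adj a b → σ a = -σ b) {k : Fin 7} (hk : k ≠ 6) {ρ : V}
    (hρ : ρ = u ∨ ρ = v ∨ ρ = w)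
    (hrange : ∀ (a : V) (r : Rest u v w), label F u v w u' v' w' r = k → F.Adj r a → a ≠ ρ →
      ∃ h, label F u v w u' v' w' ⟨a, h⟩ = k) :
    ((realSignless G).submatrix Subtype.val Subtype.val :
      Matrix (Rest u v w) (Rest u v w) ℝ).toSquareBlock (label F u v w u' v' w') k *ᵥ
        (fun r => σ r.1) = -σ ρ • fun r => realSignless F r.1 ρ := by
  rw [S.realSignless_toSquareBlock hk]
  ext r
  have h := congrFun (realSignless_mulVec_eq_zero hσ hF) r.1
  have hinj : (fun r : {r // label F u v w u' v' w' r = k} => (r.1 : V)).Injective :=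
    Subtype.val_injective.comp Subtype.val_injective
  rw [mulVec, dotProduct, sum_eq_add_sum_of_injective hinj (ρ := ρ), Pi.zero_apply] at h
  · rw [Pi.smul_apply, smul_eq_mul]
    simp only [mulVec, dotProduct, submatrix_apply]
    linear_combination h
  · rintro ⟨r, e⟩
    have := r.1.2
    simp only at e
    rw [e] at this
    tauto
  · intro a ha haρ
    have hne : (r.1 : V) ≠ a := fun e => ha ⟨r, e⟩
    rw [realSignless_of_ne F hne, if_neg, zero_mul]
    intro hadj
    obtain ⟨h1, h2⟩ := hrange a r.1 r.2 hadj haρ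
    exact ha ⟨⟨⟨a, h1⟩, h2⟩, rfl⟩

/-- A kernel vector of Q(F) that vanishes at the root vanishes on its whole component. -/
lemma posDef_branch {σ : V → ℝ} (hσ : ∀ a, σ a ^ 2 = 1)
    (hF : ∀ a b, F.Adj a b → σ a = -σ b) {k : Fin 7} (hk : k ≠ 6) {ρ : V}
    (hρ : ρ = u ∨ ρ = v ∨ ρ = w)
    (hreach : ∀ (r : Rest u v w), label F u v w u' v' w' r = k → F.Reachable r ρ) :
    (((realSignless G).submatrix Subtype.val Subtype.val :
      Matrix (Rest u v w) (Rest u v w) ℝ).toSquareBlock (label F u v w u' v' w') k).PosDef := by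
  rw [S.realSignless_toSquareBlock hk]
  refine posDef_submatrix (realSignless_posSemidef hσ hF)
    (Subtype.val_injective.comp Subtype.val_injective) fun g hg h0 r => ?_
  have h1 := mul_eq_mul_of_reachable hσ hF hg (hreach r.1 r.2)
  have h2 : g ρ = 0 := h0 ρ (by
    rintro ⟨r, e⟩
    have := r.1.2
    simp only at e
    rw [e] at this
    tauto)
  have h3 : σ ρ ≠ 0 := fun e => by have := hσ ρ; rw [e] at this; norm_num at this
  rw [h2, zero_mul] at h1
  exact (mul_eq_zero.mp h1).resolve_right h3

end RealSignless
end IsPendentSplit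
end SignlessUnicyclic

/-! ### The transformed graph realises the abstract transformation -/

namespace SignlessUnicyclic
open SimpleGraph Matrix

namespace IsPendentSplit
variable {V : Type*} {G F : SimpleGraph V} {u v w y z u' v' w' : V}
variable (S : IsPendentSplit G F u v w y z u' v' w')
include S
variable [Fintype V] [DecidableEq V] [DecidableRel G.Adj]

lemma realSignless_col_u (r : Rest u v w) (h : label F u v w u' v' w' r ≠ 3) :
    realSignless G r u = if r = S.pendents 0 ∨ r = (⟨y, S.y_rest⟩ : Rest u v w) then 1 else 0 := by
  rw [realSignless_of_ne G r.2.1]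
  refine if_congr ?_ rfl rfl
  rw [Subtype.ext_iff, Subtype.ext_iff, S.adj_rest_u]
  refine or_congr_left ⟨fun h' => S.adj_pendent_u r h' h, fun e => ?_⟩
  have : G.Adj r u := e ▸ (S.adj_u' u).mpr rfl
  refine ((S.adj_rest_u r).mp this).resolve_right fun hy =>
    S.ne_y_of_pendent (.inl rfl) S.adj_u' (e.symm.trans hy)

lemma realSignless_col_v (r : Rest u v w) (h : label F u v w u' v' w' r ≠ 4) :
    realSignless G r v = if r = S.pendents 1 then 1 else 0 := by
  rw [realSignless_of_ne G r.2.2.1]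
  refine if_congr ?_ rfl rfl
  rw [Subtype.ext_iff, S.adj_rest_v]
  refine ⟨fun h' => S.adj_pendent_v r h' h, fun e => ?_⟩
  exact (S.adj_rest_v r).mp (e ▸ (S.adj_v' v).mpr rfl : G.Adj r v)

lemma realSignless_col_w (r : Rest u v w) (h : label F u v w u' v' w' r ≠ 5) :
    realSignless G r w = if r = S.pendents 2 ∨ r = (⟨z, S.z_rest⟩ : Rest u v w) then 1 else 0 := by
  rw [realSignless_of_ne G r.2.2.2]
  refine if_congr ?_ rfl rfl
  rw [Subtype.ext_iff, Subtype.ext_iff, S.adj_rest_w]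
  refine or_congr_left ⟨fun h' => S.adj_pendent_w r h' h, fun e => ?_⟩
  have : G.Adj r w := e ▸ (S.adj_w' w).mpr rfl
  refine ((S.adj_rest_w r).mp this).resolve_right fun hz =>
    S.ne_z_of_pendent (.inr (.inr rfl)) S.adj_w' (e.symm.trans hz)

omit S in
lemma realSignless_apply_self (huv : u ≠ v) (huw : u ≠ w) (hvw : v ≠ w) {a : V}
    (ha : a = u ∨ a = v ∨ a = w) : realSignless G a a =
      (if G.Adj u a then 1 else 0) + (if G.Adj v a then 1 else 0) + (if G.Adj w a then 1 else 0) +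
        ∑ r : Rest u v w, realSignless G r a := by
  rw [realSignless_self, sum_eq_add_sum_rest huv huw hvw]
  congr 1
  refine Finset.sum_congr rfl fun r _ => ?_
  rw [realSignless_of_ne]
  rintro e
  have := r.2
  rw [e] at this
  tauto

section ShortenCycle
variable [DecidableRel (shortenCycle G u v w v' w').Adj]

lemma realSignless_col_u' (r : Rest u v w) (hv : (r : V) ≠ v') (hw : (r : V) ≠ w') :
    realSignless (shortenCycle G u v w v' w') r u =
      realSignless G r u + realSignless G r v + realSignless G r w := by
  rw [realSignless_of_ne _ r.2.1, realSignless_of_ne _ r.2.1, realSignless_of_ne _ r.2.2.1,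
    realSignless_of_ne _ r.2.2.2]
  have h := S.adj'_rest_u r
  have h1 := S.not_adj_v_of_adj_u r
  have h2 := S.not_adj_w_of_adj_u r
  have h3 := S.not_adj_w_of_adj_v r
  simp only [h, hv, hw, ne_eq, not_false_iff, and_true]
  split_ifs <;> simp_all

/-- On the diagonal: an edge to v or w, unless pendent, is replaced by one edge to u, and no vertex
had two edges to u, v, w, so degrees do not change. -/
lemma realSignless_rest' (r s : Rest u v w) :
    realSignless (shortenCycle G u v w v' w') r s = realSignless G r s := by
  by_cases hrs : r = s
  · subst hrs
    rw [realSignless_self, realSignless_self, sum_eq_add_sum_rest S.u_ne_v S.u_ne_w S.v_ne_w,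
      sum_eq_add_sum_rest S.u_ne_v S.u_ne_w S.v_ne_w]
    simp only [adj'_rest]
    congr 1
    simp only [adj_comm _ u, adj_comm _ v, adj_comm _ w]
    by_cases hv : (r : V) = v'
    · have h1 := S.adj_v'
      have h2 := S.v'_ne_w'
      rw [← hv] at h1
      simp only [S.adj'_rest_u, S.adj'_rest_v, S.adj'_rest_w, h1]
      simp [hv, h2, S.u_ne_v, S.v_ne_w.symm]
    by_cases hw : (r : V) = w'
    · have h1 := S.adj_w'
      have h2 := S.v'_ne_w'
      rw [← hw] at h1
      simp only [S.adj'_rest_u, S.adj'_rest_v, S.adj'_rest_w, h1]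
      simp [hw, h2.symm, S.u_ne_w, S.v_ne_w]
    have h := S.realSignless_col_u' r hv hw
    rw [realSignless_of_ne _ r.2.1, realSignless_of_ne _ r.2.1, realSignless_of_ne _ r.2.2.1,
      realSignless_of_ne _ r.2.2.2] at h
    rw [h]
    simp [S.adj'_rest_v, S.adj'_rest_w, hv, hw]
  · have h : (r : V) ≠ s := fun e => hrs (Subtype.ext e)
    rw [realSignless_of_ne _ h, realSignless_of_ne _ h]
    simp only [adj'_rest]

end ShortenCycle

variable [DecidableRel F.Adj]

omit S [DecidableRel G.Adj] in
lemma neg_sign_mul {σ : V → ℝ}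
    (hF : ∀ a b, F.Adj a b → σ a = -σ b) {r ρ : V} (hr : r ≠ ρ) :
    realSignless F r ρ * σ r = -σ ρ * realSignless F r ρ := by
  rw [realSignless_of_ne _ hr]
  split_ifs with h
  · rw [hF _ _ h]; ring
  · ring

lemma realSignless_u_eq (r : Rest u v w) (h : (r : V) ≠ y) :
    realSignless G r u = realSignless F r u := by
  rw [realSignless_of_ne _ r.2.1, realSignless_of_ne _ r.2.1]
  exact if_congr (by simp [S.adj_rest_u, h]) rfl rfl

lemma realSignless_v_eq (r : Rest u v w) : realSignless G r v = realSignless F r v := by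
  rw [realSignless_of_ne _ r.2.2.1, realSignless_of_ne _ r.2.2.1]
  exact if_congr (S.adj_rest_v r) rfl rfl

lemma realSignless_w_eq (r : Rest u v w) (h : (r : V) ≠ z) :
    realSignless G r w = realSignless F r w := by
  rw [realSignless_of_ne _ r.2.2.2, realSignless_of_ne _ r.2.2.2]
  exact if_congr (by simp [S.adj_rest_w, h]) rfl rfl

/-- The signs attached to the branches are opposite to those of u, v, w, as they are the values of σ
at the neighbours of these roots in F. -/
theorem surgery [DecidableRel (shortenCycle G u v w v' w').Adj] {σ : V → ℝ} (hσ : ∀ a, σ a ^ 2 = 1) (hF : ∀ a b, F.Adj a b → σ a = -σ b) :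
    Surgery (realSignless G) (realSignless (shortenCycle G u v w v' w'))
      (label F u v w u' v' w') S.pendents ⟨⟨y, S.y_rest⟩, S.label_y⟩ ⟨⟨z, S.z_rest⟩, S.label_z⟩
      (fun r => σ r) ![-σ u, -σ v, -σ w]
      ((realSignless F).submatrix (fun r : {r // label F u v w u' v' w' r = 6} => (r.1 : V))
        (fun r : {r // label F u v w u' v' w' r = 6} => (r.1 : V))) := by
  have huv := S.u_ne_v
  have huw := S.u_ne_w
  have hvw := S.v_ne_w
  have hy : ∀ {r : Rest u v w}, label F u v w u' v' w' r ≠ 6 → (r : V) ≠ y := fun h e => h (by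
    rw [← S.label_y]; exact congrArg _ (Subtype.ext e))
  have hz : ∀ {r : Rest u v w}, label F u v w u' v' w' r ≠ 6 → (r : V) ≠ z := fun h e => h (by
    rw [← S.label_z]; exact congrArg _ (Subtype.ext e))
  have hadj : ∀ (a : V) (r : Rest u v w), F.Adj r a → (h : a ≠ u ∧ a ≠ v ∧ a ≠ w) →
      ∃ h, label F u v w u' v' w' ⟨a, h⟩ = label F u v w u' v' w' r := fun a r h h' =>
    ⟨h', (S.label_eq_of_adj r ⟨a, h'⟩ h).symm⟩
  have hinj : (fun r : {r // label F u v w u' v' w' r = 6} => (r.1 : V)).Injective :=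
    Subtype.val_injective.comp Subtype.val_injective
  have hdiag : ∀ (r : Rest u v w) (ρ : V), (∀ x, G.Adj r x ↔ x = ρ) → realSignless G r r = 1 := by
    intro r ρ h
    have h' : ∀ x, G.Adj x r ↔ x = ρ := fun x => (G.adj_comm _ _).trans (h x)
    rw [realSignless_self, Finset.sum_congr rfl fun x _ => if_congr (h' x) rfl rfl]
    simp
  refine
    { huv := huv
      huw := huw
      hvw := hvw
      symm := realSignless_isSymm G
      symm' := realSignless_isSymm _
      rest := S.realSignless_rest'
      label := fun r s hrs => ?_
      l_zero := fun r => by rw [label_eq_zero, Subtype.ext_iff]; rfl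
      l_one := fun r => by rw [S.label_eq_one, Subtype.ext_iff]; rfl
      l_two := fun r => by rw [S.label_eq_two, Subtype.ext_iff]; rfl
      diag := fun k => ?_
      uu := ?_
      vv := ?_
      ww := ?_
      uv := by rw [realSignless_of_ne _ huv, if_pos S.adj_uv]
      vw := by rw [realSignless_of_ne _ hvw, if_pos S.adj_vw]
      uw := by rw [realSignless_of_ne _ huw, if_neg S.not_adj_uw]
      col_u := S.realSignless_col_u
      col_v := S.realSignless_col_v
      col_w := S.realSignless_col_w
      uu' := ?_
      vv' := ?_
      ww' := ?_
      uv' := by rw [realSignless_of_ne _ huv, if_pos S.adj'_uv]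
      vw' := by rw [realSignless_of_ne _ hvw, if_neg S.not_adj'_vw]
      uw' := by rw [realSignless_of_ne _ huw, if_pos S.adj'_uw]
      col_u' := fun r h1 h2 => S.realSignless_col_u' r (fun e => h1 (Subtype.ext e))
        (fun e => h2 (Subtype.ext e))
      col_u'_one := ?_
      col_u'_two := ?_
      col_v' := fun r => ?_
      col_w' := fun r => ?_
      sq_σ := fun r => hσ r
      sq_s := fun k => by fin_cases k <;> simp [hσ]
      posDef := ?_
      mulVec_u := ?_
      mulVec_v := ?_
      mulVec_w := ?_
      sign_u := fun r h => ?_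
      sign_v := fun r h => ?_
      sign_w := fun r h => ?_
      link := ?_
      link_psd := (realSignless_posSemidef hσ hF).submatrix _
      link_σ := ?_
      link_ker := fun g hg i j => ?_
      y_ne_z := fun e => S.ne (congrArg (fun r => (r.1 : V)) e)
      sign_two := fun hcard => ?_ }
  · have h : (r : V) ≠ s := fun e => hrs (congrArg _ (Subtype.ext e))
    rw [realSignless_of_ne _ h, if_neg]
    exact fun h' => hrs (S.label_eq_of_adj r s ((S.adj_rest r s).mp h'))
  · fin_cases k
    · exact hdiag _ u S.adj_u'
    · exact hdiag _ v S.adj_v'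
    · exact hdiag _ w S.adj_w'
  · rw [realSignless_apply_self huv huw hvw (.inl rfl), if_neg G.irrefl, if_pos S.adj_uv.symm,
      if_neg fun h => S.not_adj_uw h.symm]
    ring
  · rw [realSignless_apply_self huv huw hvw (.inr (.inl rfl)), if_pos S.adj_uv, if_neg G.irrefl,
      if_pos S.adj_vw.symm]
    ring
  · rw [realSignless_apply_self huv huw hvw (.inr (.inr rfl)), if_neg S.not_adj_uw,
      if_pos S.adj_vw, if_neg G.irrefl]
    ring
  · rw [realSignless_apply_self huv huw hvw (.inl rfl), if_neg (SimpleGraph.irrefl _),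
      if_pos S.adj'_uv.symm, if_pos S.adj'_uw.symm]
    ring
  · rw [realSignless_apply_self huv huw hvw (.inr (.inl rfl)), if_pos S.adj'_uv,
      if_neg (SimpleGraph.irrefl _), if_neg fun h => S.not_adj'_vw h.symm]
    ring
  · rw [realSignless_apply_self huv huw hvw (.inr (.inr rfl)), if_pos S.adj'_uw,
      if_neg S.not_adj'_vw, if_neg (SimpleGraph.irrefl _)]
    ring
  · rw [realSignless_of_ne _ (S.pendents 1).2.1, if_neg]
    rw [S.adj'_rest_u]
    have : (S.pendents 1 : V) = v' := rfl
    simp [this, S.adj_v', huv, hvw.symm]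
  · rw [realSignless_of_ne _ (S.pendents 2).2.1, if_neg]
    rw [S.adj'_rest_u]
    have : (S.pendents 2 : V) = w' := rfl
    simp [this, S.adj_w', huw, hvw]
  · rw [realSignless_of_ne _ r.2.2.1]
    exact if_congr ((S.adj'_rest_v r).trans (Subtype.ext_iff (a2 := S.pendents 1)).symm) rfl rfl
  · rw [realSignless_of_ne _ r.2.2.2]
    exact if_congr ((S.adj'_rest_w r).trans (Subtype.ext_iff (a2 := S.pendents 2)).symm) rfl rfl
  · rintro k (rfl | rfl | rfl)
    · exact S.posDef_branch hσ hF (by decide) (.inl rfl) fun r h =>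
        ((label_eq_three r).mp h).2
    · exact S.posDef_branch hσ hF (by decide) (.inr (.inl rfl)) fun r h =>
        ((S.label_eq_four r).mp h).2
    · exact S.posDef_branch hσ hF (by decide) (.inr (.inr rfl)) fun r h =>
        ((S.label_eq_five r).mp h).2
  · rw [S.realSignless_mulVec_branch hσ hF (by decide) (.inl rfl)]
    · congr 1
      ext r
      exact (S.realSignless_u_eq r.1 (hy (by rw [r.2]; decide))).symm
    · intro a r h ha hne
      rw [← h]
      have hr := ((label_eq_three r).mp h).2
      exact hadj a r ha ⟨hne, fun e => S.not_uv (hr.symm.trans (e ▸ ha.reachable)),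
        fun e => S.not_uw (hr.symm.trans (e ▸ ha.reachable))⟩
  · rw [S.realSignless_mulVec_branch hσ hF (by decide) (.inr (.inl rfl))]
    · congr 1
      ext r
      exact (S.realSignless_v_eq r.1).symm
    · intro a r h ha hne
      rw [← h]
      have hr := ((S.label_eq_four r).mp h).2
      exact hadj a r ha ⟨fun e => S.not_uv ((e ▸ ha.symm.reachable : F.Reachable u r).trans hr),
        hne, fun e => S.not_vw (hr.symm.trans (e ▸ ha.reachable))⟩
  · rw [S.realSignless_mulVec_branch hσ hF (by decide) (.inr (.inr rfl))]
    · congr 1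
      ext r
      exact (S.realSignless_w_eq r.1 (hz (by rw [r.2]; decide))).symm
    · intro a r h ha hne
      rw [← h]
      have hr := ((S.label_eq_five r).mp h).2
      exact hadj a r ha ⟨fun e => S.not_uw ((e ▸ ha.symm.reachable : F.Reachable u r).trans hr),
        fun e => S.not_vw ((e ▸ ha.symm.reachable : F.Reachable v r).trans hr), hne⟩
  · rw [S.realSignless_u_eq r (hy (by rw [h]; decide))]
    exact neg_sign_mul hF r.2.1
  · rw [S.realSignless_v_eq r]
    exact neg_sign_mul hF r.2.2.1
  · rw [S.realSignless_w_eq r (hz (by rw [h]; decide))]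
    exact neg_sign_mul hF r.2.2.2
  · ext r s
    simp only [toSquareBlock_def, of_apply, submatrix_apply, S.realSignless_rest, Matrix.add_apply,
      single_apply, Subtype.ext_iff, eq_comm]
  -- The link is a whole component of F, so restricting Q(F) σ = 0 to it loses no entries.
  · ext r
    have h := congrFun (realSignless_mulVec_eq_zero hσ hF) r.1
    rw [Pi.zero_apply] at h ⊢
    rw [← h]
    refine Fintype.sum_of_injective _ hinj _ _ (fun a ha => ?_) fun _ => rfl
    have hne : (r.1 : V) ≠ a := fun e => ha ⟨r, e⟩
    simp only
    rw [realSignless_of_ne F hne, if_neg, zero_mul]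
    intro h'
    have hr := ((S.label_eq_six r.1).mp r.2).2
    obtain ⟨h1, h2⟩ := hadj a r.1 h'
      ⟨fun e => S.not_uy ((e ▸ h'.symm.reachable : F.Reachable u r.1).trans hr),
        fun e => S.not_vy ((e ▸ h'.symm.reachable : F.Reachable v r.1).trans hr),
        fun e => S.not_wy ((e ▸ h'.symm.reachable : F.Reachable w r.1).trans hr)⟩
    exact ha ⟨⟨⟨a, h1⟩, h2.trans r.2⟩, rfl⟩
  · have h := mul_eq_mul_of_reachable hσ hF
      (mulVec_extend_eq_zero (realSignless_posSemidef hσ hF) hinj hg)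
      (((S.label_eq_six i.1).mp i.2).2.trans ((S.label_eq_six j.1).mp j.2).2.symm)
    rwa [hinj.extend_apply g 0 i, hinj.extend_apply g 0 j] at h
  -- A neighbour of y in F lies in the link. If the link has two vertices, it is z, so yz is an edge
  -- and the signs are opposite.
  · obtain ⟨x, hx⟩ := S.exists_adj_y
    obtain ⟨h1, h2⟩ := hadj x ⟨y, S.y_rest⟩ hx
      ⟨fun e => S.not_uy (e ▸ hx.symm.reachable), fun e => S.not_vy (e ▸ hx.symm.reachable),
        fun e => S.not_wy (e ▸ hx.symm.reachable)⟩
    have hxz : x = z := by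
      by_contra hxz
      have h3 : ({⟨⟨y, S.y_rest⟩, S.label_y⟩, ⟨⟨z, S.z_rest⟩, S.label_z⟩, ⟨⟨x, h1⟩, h2.trans S.label_y⟩} :
          Finset {r // label F u v w u' v' w' r = 6}).card = 3 := by
        rw [Finset.card_eq_three]
        refine ⟨_, _, _, ?_, ?_, ?_, rfl⟩ <;> intro e <;>
          have e := congrArg (fun r : {r // label F u v w u' v' w' r = 6} => (r.1 : V)) e
        · exact S.ne e
        · exact hx.ne e
        · exact hxz e.symm
      have := Finset.card_le_univ ({⟨⟨y, S.y_rest⟩, S.label_y⟩, ⟨⟨z, S.z_rest⟩, S.label_z⟩,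
        ⟨⟨x, h1⟩, h2.trans S.label_y⟩} : Finset {r // label F u v w u' v' w' r = 6})
      omega
    have h3 := hF y x hx
    have h4 := hσ z
    simp only
    rw [h3, hxz]
    linear_combination -h4

end IsPendentSplit
end SignlessUnicyclic

/-! ### From the coefficients of det(1 + X Q) to the theorem -/

namespace SignlessUnicyclic
open Matrix

section Coefficients
variable {V : Type*} [Fintype V]

lemma adj_iff_of_isPendentEdgeAt {G : SimpleGraph V} [DecidableRel G.Adj] {x x' : V}
    (h : IsPendentEdgeAt G x x') (a : V) : G.Adj x' a ↔ a = x := by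
  obtain ⟨b, hb, huniq⟩ := G.degree_eq_one_iff_existsUnique_adj.mp h.2
  exact ⟨fun ha => (huniq a ha).trans (huniq x h.1.symm).symm, fun e => e ▸ h.1.symm⟩

/-- Both sides are the sum of the i × i principal minors; the two factors (-1)^i cancel. -/
lemma cast_charpoly_coeff [DecidableEq V] (G : SimpleGraph V) [DecidableRel G.Adj] {i : ℕ}
    (hi : i ≤ Fintype.card V) :
    (((-1) ^ i * (signlessLaplacian G).charpoly.coeff (Fintype.card V - i) : ℤ) : ℝ) =
      (pencil (realSignless G)).det.coeff i := by
  have hmap : ((signlessLaplacian G).charpoly.coeff (Fintype.card V - i) : ℝ) =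
      (realSignless G).charpoly.coeff (Fintype.card V - i) := by
    rw [← map_signlessLaplacian, charpoly_map, Polynomial.coeff_map, eq_intCast]
  rw [Int.cast_mul, Int.cast_pow, Int.cast_neg, Int.cast_one, hmap, charpoly_coeff_eq_sum_minors _ _ hi,
    ← mul_assoc, ← mul_pow, neg_one_mul, neg_neg, one_pow, one_mul, pencil,
    coeff_det_one_add_X_smul_eq_sum_minors]

lemma phi_eq_coeff_det_pencil [DecidableEq V] (G : SimpleGraph V) [DecidableRel G.Adj] {i : ℕ}
    (hi : i ≤ Fintype.card V) : (phi G i : ℝ) = (pencil (realSignless G)).det.coeff i := by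
  rw [← cast_charpoly_coeff G hi, phi]
  congr!

end Coefficients
end SignlessUnicyclic

theorem theorem2p8 {V : Type*} [Fintype V] (G : SimpleGraph V) [DecidableRel G.Adj]
    (hn : 8 ≤ Fintype.card V) (hG : SignlessUnicyclic.IsUnicyclic G)
    {r : V} (c : G.Walk r r) (hc : c.IsCycle) (hg : 5 ≤ c.length)
    (hpaths : SignlessUnicyclic.OnlyShortPendentPaths c)
    (u v w u' v' w' : V)
    (hu : u ∈ c.support) (hv : v ∈ c.support) (hw : w ∈ c.support)
    (huv : G.Adj u v) (hvw : G.Adj v w) (huw : u ≠ w)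
    (hu' : SignlessUnicyclic.IsPendentEdgeAt G u u')
    (hv' : SignlessUnicyclic.IsPendentEdgeAt G v v')
    (hw' : SignlessUnicyclic.IsPendentEdgeAt G w w') :
    ∀ i : ℕ, i ≤ Fintype.card V →
      SignlessUnicyclic.phi (SignlessUnicyclic.shortenCycle G u v w v' w') i
          ≤ SignlessUnicyclic.phi G i ∧
      (SignlessUnicyclic.phi G i
          = SignlessUnicyclic.phi (SignlessUnicyclic.shortenCycle G u v w v' w') i ↔
        i = 0 ∨ i = 1 ∨ i = Fintype.card V ∨ (Fintype.card V = 8 ∧ i = 7)) := by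
  classical
  obtain ⟨y, z, F, hF⟩ := SignlessUnicyclic.exists_isSplit hG hc hg hu hv hw huv hvw huw
  have S : SignlessUnicyclic.IsPendentSplit G F u v w y z u' v' w' :=
    { hF with
      adj_uv := huv
      adj_vw := hvw
      adj_u' := SignlessUnicyclic.adj_iff_of_isPendentEdgeAt hu'
      adj_v' := SignlessUnicyclic.adj_iff_of_isPendentEdgeAt hv'
      adj_w' := SignlessUnicyclic.adj_iff_of_isPendentEdgeAt hw' }
  obtain ⟨σ, hσ, hσF⟩ := SignlessUnicyclic.exists_sign_of_isAcyclic hF.acyclic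
  intro i hi
  have h := (S.surgery hσ hσF).coeff_det_pencil_sub i
  rw [Polynomial.coeff_sub, ← SignlessUnicyclic.phi_eq_coeff_det_pencil G hi,
    ← SignlessUnicyclic.phi_eq_coeff_det_pencil _ hi,
    sub_nonneg, Int.cast_le, sub_eq_zero, Int.cast_inj] at h
  have hle : Fintype.card V ≤ i ↔ i = Fintype.card V := ⟨fun h => le_antisymm hi h, fun h => h.ge⟩
  rwa [hle] at h
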